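/- Let $l,m$ be integers with $m>0$ and $l-m-1>0$, and let $\{P_0,\dots,P_m\}$ be a symmetric Clifford system on $\mathbb{R}^{2l}$, i.e. symmetric matrices with $P_\alpha P_\beta+P_\beta P_\alpha=2\delta_{\alpha\beta}I_{2l}$. Put $F(x)=|x|^4-2\sum_{\alpha=0}^m\langle P_\alpha x,x\rangle^2$, let $f=F|_{S^{2l-1}(1)}$, and set $M_+=f^{-1}(1)$, $M_-=f^{-1}(-1)$ and $M_c=f^{-1}(c)$ for $c\in(-1,1)$. These are closed embedded submanifolds of $\mathbb{R}^{2l}$, of dimensions $2l-m-2$, $l+m-1$ and $2l-2$ respectively, and carry the induced Riemannian metrics. A smooth map $\varphi:X\to Y$ between closed Riemannian manifolds is called harmonic if it is a critical point of the energy $E(\varphi)=\frac12\int_X|d\varphi|^2\,dV_X$ with respect to smooth variations through maps $X\to Y$. Let $\mathrm{dist}$ be the spherical (great-circle) distance between subsets of $S^{2l-1}(1)$. (1) Let $P=\sum_{\alpha=0}^m a_\alpha P_\alpha$ with $\sum_{\alpha=0}^m a_\alpha^2=1$. Then the map $\phi:M_+\to M_-$, $\phi(x)=\frac{1}{\sqrt2}(x+Px)$,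 is harmonic, and for every $c\in(-1,1)$, with $t=\mathrm{dist}(M_+,M_c)$, the map $\psi:M_+\to M_c$, $\psi(x)=\cos t\,x+\sin t\,Px$, is harmonic. (2) Let $P_{m+1}$ be a matrix such that $\{P_0,\dots,P_m,P_{m+1}\}$ is again a symmetric Clifford system on $\mathbb{R}^{2l}$. Then the map $\tilde\phi:M_-\to M_+$, $\tilde\phi(x)=\frac{1}{\sqrt2}(x+P_{m+1}x)$, is harmonic, and for every $c\in(-1,1)$, with $s=\mathrm{dist}(M_-,M_c)$, the map $\tilde\psi:M_-\to M_c$, $\tilde\psi(x)=\cos s\,x+\sin s\,P_{m+1}x$, is harmonic. -/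

import Mathlib

open scoped ContDiff

noncomputable section

/-! ### Submanifolds of Euclidean space with the induced metric -/

/-- `φ`, restricted to `U`, is a smooth local parametrization (the inverse of a chart) of the
`d`-dimensional submanifold `M` of `ℝⁿ`: `U ⊆ ℝᵈ` is open, `φ` is a smooth immersion on `U` and a
homeomorphism from `U` onto a relatively open subset of `M`. -/
structure IsLocalParametrization {n : ℕ} (d : ℕ) (M : Set (EuclideanSpace ℝ (Fin n)))
    (U : Set (EuclideanSpace ℝ (Fin d)))
    (φ : EuclideanSpace ℝ (Fin d) → EuclideanSpace ℝ (Fin n)) : Prop where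
  isOpen_source : IsOpen U
  contDiffOn : ContDiffOn ℝ ∞ φ U
  injective_fderiv : ∀ u ∈ U, Function.Injective (fderiv ℝ φ u)
  isEmbedding : Topology.IsEmbedding (U.domRestrict φ)
  image_eq : ∃ O : Set (EuclideanSpace ℝ (Fin n)), IsOpen O ∧ φ '' U = M ∩ O

/-- `M` is a closed (compact, without boundary) embedded smooth `d`-dimensional submanifold
of `ℝⁿ`. -/
structure IsClosedSubmanifold {n : ℕ} (d : ℕ) (M : Set (EuclideanSpace ℝ (Fin n))) : Prop where
  isCompact : IsCompact M
  exists_parametrization : ∀ x ∈ M, ∃ U φ, IsLocalParametrization d M U φ ∧ x ∈ φ '' U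

/-- The Riemannian volume measure `dV_M` of a `d`-dimensional submanifold `M` of `ℝⁿ` with the
induced metric. On the image of a local parametrization `φ : U → M` it is the push-forward of
`√(det g) du`, where `g = (Dφ)ᵀ Dφ` is the induced metric in the coordinates `u`. These measures
agree on overlaps, and `dV_M` is their supremum, that is, the measure glued from them. -/
def riemannianVolume {n : ℕ} (d : ℕ) (M : Set (EuclideanSpace ℝ (Fin n))) :
    MeasureTheory.Measure (EuclideanSpace ℝ (Fin n)) :=
  ⨆ (U : Set (EuclideanSpace ℝ (Fin d)))
    (φ : EuclideanSpace ℝ (Fin d) → EuclideanSpace ℝ (Fin n))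
    (_ : IsLocalParametrization d M U φ),
    MeasureTheory.Measure.map φ ((MeasureTheory.volume.restrict U).withDensity fun u =>
      ENNReal.ofReal (√(((fderiv ℝ φ u).adjoint ∘L fderiv ℝ φ u).det)))

/-- The tangent space `T_x M ⊆ ℝⁿ` (for a submanifold, the tangent cone is already a linear
subspace). It carries the inner product of `ℝⁿ`, which is the induced Riemannian metric. -/
def tangentSpaceAt {n : ℕ} (M : Set (EuclideanSpace ℝ (Fin n))) (x : EuclideanSpace ℝ (Fin n)) :
    Submodule ℝ (EuclideanSpace ℝ (Fin n)) :=
  Submodule.span ℝ (tangentConeAt ℝ M x)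

/-! ### Energy and harmonic maps -/

/-- `|df|²(x) = ∑ᵢ |df(eᵢ)|²`, where `(eᵢ)` is an orthonormal basis of `T_x M`. The derivative of
`f` within `M` at `x` is determined on `T_x M`, where it is the differential of `f|_M`. -/
def normSqDifferential {n k : ℕ} (M : Set (EuclideanSpace ℝ (Fin n)))
    (f : EuclideanSpace ℝ (Fin n) → EuclideanSpace ℝ (Fin k)) (x : EuclideanSpace ℝ (Fin n)) : ℝ :=
  ∑ i, ‖fderivWithin ℝ f M x
    (stdOrthonormalBasis ℝ (tangentSpaceAt M x) i : EuclideanSpace ℝ (Fin n))‖ ^ 2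

/-- The energy `E(f) = ½ ∫_M |df|² dV_M`. -/
def energy {n k : ℕ} (d : ℕ) (M : Set (EuclideanSpace ℝ (Fin n)))
    (f : EuclideanSpace ℝ (Fin n) → EuclideanSpace ℝ (Fin k)) : ℝ :=
  (1 / 2) * ∫ x, normSqDifferential M f x ∂(riemannianVolume d M)

/-- `Φ`, defined for `|s| < ε`, is a smooth variation of `f : M → N` through maps `M → N`. -/
structure IsSmoothVariation {n k : ℕ} (M : Set (EuclideanSpace ℝ (Fin n)))
    (N : Set (EuclideanSpace ℝ (Fin k)))
    (f : EuclideanSpace ℝ (Fin n) → EuclideanSpace ℝ (Fin k)) (ε : ℝ)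
    (Φ : ℝ → EuclideanSpace ℝ (Fin n) → EuclideanSpace ℝ (Fin k)) : Prop where
  pos : 0 < ε
  contDiffOn : ContDiffOn ℝ ∞ (fun q : ℝ × EuclideanSpace ℝ (Fin n) => Φ q.1 q.2)
    (Set.Ioo (-ε) ε ×ˢ M)
  mapsTo : ∀ s ∈ Set.Ioo (-ε) ε, Set.MapsTo (Φ s) M N
  eqOn_zero : Set.EqOn (Φ 0) f M

/-- `f` restricts to a harmonic map `M → N` from the closed `d`-dimensional submanifold `M ⊆ ℝⁿ` to
the closed `e`-dimensional submanifold `N ⊆ ℝᵏ` (both with the induced metric): a smooth map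
that is a critical point of the energy with respect to all smooth variations through maps
`M → N`. -/
structure IsHarmonicMap {n k : ℕ} (d e : ℕ) (M : Set (EuclideanSpace ℝ (Fin n)))
    (N : Set (EuclideanSpace ℝ (Fin k)))
    (f : EuclideanSpace ℝ (Fin n) → EuclideanSpace ℝ (Fin k)) : Prop where
  domain : IsClosedSubmanifold d M
  codomain : IsClosedSubmanifold e N
  contDiffOn : ContDiffOn ℝ ∞ f M
  mapsTo : Set.MapsTo f M N
  critical : ∀ ε Φ, IsSmoothVariation M N f ε Φ → HasDerivAt (fun s => energy d M (Φ s)) 0 0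

/-! ### Clifford systems and the foliations of OT-FKM type -/

/-- A symmetric Clifford system on `ℝᴺ`: symmetric matrices with
`P_α P_β + P_β P_α = 2 δ_{αβ} I`. -/
def IsCliffordSystem {N k : ℕ} (P : Fin k → Matrix (Fin N) (Fin N) ℝ) : Prop :=
  (∀ a, (P a).IsSymm) ∧ ∀ a b, P a * P b + P b * P a = (if a = b then (2 : ℝ) else 0) • 1

/-- The Clifford sphere `Σ(P_0, …, P_m)`. -/
def cliffordSphere {N k : ℕ} (P : Fin k → Matrix (Fin N) (Fin N) ℝ) :
    Set (Matrix (Fin N) (Fin N) ℝ) :=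
  {Q | ∃ a : Fin k → ℝ, ∑ i, a i ^ 2 = 1 ∧ Q = ∑ i, a i • P i}

/-- The polynomial `F(x) = |x|⁴ - 2 ∑_α ⟨P_α x, x⟩²`. -/
def fkmPolynomial {N k : ℕ} (P : Fin k → Matrix (Fin N) (Fin N) ℝ)
    (x : EuclideanSpace ℝ (Fin N)) : ℝ :=
  ‖x‖ ^ 4 - 2 * ∑ a, (inner ℝ ((P a).toEuclideanLin x) x) ^ 2

/-- The level set `f⁻¹(c)` of `f = F|_S`, where `S` is the unit sphere. -/
def fkmLevel {N k : ℕ} (P : Fin k → Matrix (Fin N) (Fin N) ℝ) (c : ℝ) :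
    Set (EuclideanSpace ℝ (Fin N)) :=
  {x | ‖x‖ = 1 ∧ fkmPolynomial P x = c}

/-- The focal submanifold `M_+ = f⁻¹(1)`. -/
def focalPlus {N k : ℕ} (P : Fin k → Matrix (Fin N) (Fin N) ℝ) :
    Set (EuclideanSpace ℝ (Fin N)) :=
  fkmLevel P 1

/-- The focal submanifold `M_- = f⁻¹(-1)`. -/
def focalMinus {N k : ℕ} (P : Fin k → Matrix (Fin N) (Fin N) ℝ) :
    Set (EuclideanSpace ℝ (Fin N)) :=
  fkmLevel P (-1)

/-- The spherical distance of two subsets of a unit sphere: the infimum of the great-circle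
distances (that is, of the angles) between their points. -/
def sphericalDist {N : ℕ} (A B : Set (EuclideanSpace ℝ (Fin N))) : ℝ :=
  sInf {θ | ∃ p ∈ A, ∃ q ∈ B, θ = InnerProductGeometry.angle p q}

/-- The map `x ↦ cos t · x + sin t · Qx`. -/
def normalMap {N : ℕ} (Q : Matrix (Fin N) (Fin N) ℝ) (t : ℝ)
    (x : EuclideanSpace ℝ (Fin N)) : EuclideanSpace ℝ (Fin N) :=
  Real.cos t • x + Real.sin t • Q.toEuclideanLin x

/-- The map `x ↦ (x + Qx) / √2`. -/
def focalNormalMap {N : ℕ} (Q : Matrix (Fin N) (Fin N) ℝ)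
    (x : EuclideanSpace ℝ (Fin N)) : EuclideanSpace ℝ (Fin N) :=
  (1 / √2) • (x + Q.toEuclideanLin x)

end

/-! All four maps are restrictions of linear maps `A`. The theorem therefore reduces to two facts:
both focal submanifolds are minimal in the unit sphere, and a linear map restricted to a minimal
submanifold M of the sphere is harmonic into every closed submanifold of a unit sphere containing
its image. Classically, Δx = -d x on a d-dimensional minimal M (Takahashi), so ΔA = -d A is normal
to the target sphere.

Here the second fact comes from an exact energy formula. If g maps M into the unit sphere, the cross
term in |dg|² = |dA + d(g - A)|² is twice the tangential divergence of Aᵀ(g - A). The divergence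
theorem ∫ div_M W = d ∫ ⟨x, W⟩, which holds on M for W not necessarily tangent
(`integral_tangentialDiv`), turns its integral into d ∫ ⟨Ax, g - Ax⟩ = -(d/2) ∫ |g - A|², because
|g| = |A| = 1. Hence E(g) = E(A) + ½ ∫ (|d(g - A)|² - d |g - A|²) (`energy_eq`). Along a smooth
variation the remainder is O(s²) (`exists_variation_bound`), so the derivative at 0 vanishes and
nothing is differentiated under the integral sign.

Minimality is encoded by a smooth field of operators `Pr`, equal on M to the tangent projections,
with ∑ (D_{Pr eᵢ} Pr) eᵢ = -d x. On M_+ the vectors x, P_a x are an orthonormal normal frame, which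
gives `Pr` explicitly. M_- is the image of an explicit smooth retraction, whose derivative is `Pr`.
In both cases the Clifford relations evaluate the traces (`isMinimalInSphere_focalPlus`,
`mean_minusProj`).

It remains to see that the maps land in M_c. With c = cos 4τ and 0 < τ < π/4, the distance from M_c
is τ for M_+ and π/4 - τ for M_-, if these are nonempty. Cauchy-Schwarz bounds the inner products,
and the maps themselves attain the bound. -/

open Set Filter Topology MeasureTheory

local notation "𝔼" n:max => EuclideanSpace ℝ (Fin n)

/-! ### Local parametrizations, tangent spaces and tangential derivatives -/

section Charts

variable {n d k : ℕ} {M : Set (𝔼 n)} {U : Set (𝔼 d)} {φ : 𝔼 d → 𝔼 n}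

namespace IsLocalParametrization

theorem mem_nhds (h : IsLocalParametrization d M U φ) {u : 𝔼 d} (hu : u ∈ U) : U ∈ 𝓝 u :=
  h.isOpen_source.mem_nhds hu

theorem mapsTo (h : IsLocalParametrization d M U φ) : MapsTo φ U M := by
  obtain ⟨O, -, hO⟩ := h.image_eq
  intro u hu
  exact (hO ▸ mem_image_of_mem φ hu : φ u ∈ M ∩ O).1

theorem injOn (h : IsLocalParametrization d M U φ) : InjOn φ U :=
  injOn_iff_injective.2 h.isEmbedding.injective

theorem contDiffAt (h : IsLocalParametrization d M U φ) {u : 𝔼 d} (hu : u ∈ U) :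
    ContDiffAt ℝ ∞ φ u :=
  h.contDiffOn.contDiffAt (h.mem_nhds hu)

theorem hasFDerivAt (h : IsLocalParametrization d M U φ) {u : 𝔼 d} (hu : u ∈ U) :
    HasFDerivAt φ (fderiv ℝ φ u) u :=
  ((h.contDiffAt hu).differentiableAt (by simp)).hasFDerivAt

theorem contDiffOn_fderiv (h : IsLocalParametrization d M U φ) :
    ContDiffOn ℝ ∞ (fderiv ℝ φ) U :=
  h.contDiffOn.fderiv_of_isOpen h.isOpen_source (by simp)

/-- This is how local statements along `M` are pulled back to an open set of ℝᵈ: being an embedding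
with relatively open image makes `φ` carry neighbourhoods of `u` exactly to neighbourhoods of `φ u`
within `M`. -/
theorem map_nhds (h : IsLocalParametrization d M U φ) {u : 𝔼 d} (hu : u ∈ U) :
    map φ (𝓝 u) = 𝓝[M] (φ u) := by
  obtain ⟨O, hO, hUO⟩ := h.image_eq
  have h1 := h.isEmbedding.map_nhds_eq ⟨u, hu⟩
  have h2 : range (U.domRestrict φ) = M ∩ O := by
    rw [← hUO, range_domRestrict]
  have h3 : U.domRestrict φ = φ ∘ Subtype.val := rfl
  rw [h2, h3, ← Filter.map_map, map_nhds_subtype_val, h.isOpen_source.nhdsWithin_eq hu] at h1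
  have h4 : φ u ∈ O := (hUO ▸ mem_image_of_mem φ hu : φ u ∈ M ∩ O).2
  rw [h1, Function.comp_apply, nhdsWithin_inter_of_mem' (mem_nhdsWithin_of_mem_nhds (hO.mem_nhds h4))]

/-- If `p` is a linear left inverse of Dφ(u), then p ∘ φ has derivative the identity at `u`, and the
inverse function theorem gives σ = (p ∘ φ)⁻¹ ∘ p. This σ lives on the ambient space, so transition
maps inherit its differentiability. -/
theorem exists_leftInverse (h : IsLocalParametrization d M U φ) {u : 𝔼 d} (hu : u ∈ U) :
    ∃ σ : 𝔼 n → 𝔼 d, DifferentiableAt ℝ σ (φ u) ∧ ∀ᶠ v in 𝓝 u, σ (φ v) = v := by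
  obtain ⟨π, hπ⟩ := LinearMap.exists_leftInverse_of_injective (fderiv ℝ φ u).toLinearMap
    (LinearMap.ker_eq_bot.2 (h.injective_fderiv u hu))
  let p : 𝔼 n →L[ℝ] 𝔼 d := LinearMap.toContinuousLinearMap π
  have h1 : HasStrictFDerivAt (p ∘ φ)
      ((ContinuousLinearEquiv.refl ℝ (𝔼 d) : 𝔼 d ≃L[ℝ] 𝔼 d) : 𝔼 d →L[ℝ] 𝔼 d) u := by
    have h2 := p.hasStrictFDerivAt.comp u ((h.contDiffAt hu).hasStrictFDerivAt (by simp))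
    convert! h2 using 1
    ext v : 1
    exact (LinearMap.congr_fun hπ v).symm
  refine ⟨h1.localInverse (p ∘ φ) _ u ∘ p, ?_, h1.eventually_left_inverse⟩
  exact h1.to_localInverse.hasFDerivAt.differentiableAt.comp (φ u) p.differentiableAt

/-- Near `φ u` the identity agrees on `M` with φ ∘ σ, so Dφ ∘ Dσ fixes the tangent cone; this is the
inclusion from left to right. Conversely, `φ` maps the tangent cone of `U`, which is everything,
into that of `M`. -/
theorem tangentSpaceAt_eq_range (h : IsLocalParametrization d M U φ) {u : 𝔼 d} (hu : u ∈ U) :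
    tangentSpaceAt M (φ u) = LinearMap.range (fderiv ℝ φ u).toLinearMap := by
  apply le_antisymm
  · rw [tangentSpaceAt, Submodule.span_le]
    obtain ⟨σ, hσ, hσφ⟩ := h.exists_leftInverse hu
    have h1 : HasFDerivWithinAt id ((fderiv ℝ φ u).comp (fderiv ℝ σ (φ u))) M (φ u) := by
      have h3 : σ (φ u) = u := hσφ.self_of_nhds
      have h2 : HasFDerivAt (φ ∘ σ) ((fderiv ℝ φ u).comp (fderiv ℝ σ (φ u))) (φ u) := by
        refine HasFDerivAt.comp (φ u) ?_ hσ.hasFDerivAt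
        rw [h3]
        exact h.hasFDerivAt hu
      refine h2.hasFDerivWithinAt.congr_of_eventuallyEq ?_ (by simp [h3])
      rw [← h.map_nhds hu]
      refine eventually_map.2 ?_
      filter_upwards [hσφ] with v hv
      simp [hv]
    intro v hv
    have h4 := (hasFDerivWithinAt_id (𝕜 := ℝ) (φ u) M).unique_on h1 hv
    exact ⟨fderiv ℝ σ (φ u) v, h4.symm⟩
  · rintro _ ⟨v, rfl⟩
    apply Submodule.subset_span
    have h1 := ((h.hasFDerivAt hu).hasFDerivWithinAt (s := U)).mapsTo_tangent_cone
    rw [tangentConeAt_of_mem_nhds (h.mem_nhds hu)] at h1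
    exact tangentConeAt_mono (image_subset_iff.2 h.mapsTo) (h1 (mem_univ v))

theorem hasFDerivAt_comp (h : IsLocalParametrization d M U φ) {u : 𝔼 d} (hu : u ∈ U)
    {f : 𝔼 n → 𝔼 k} {f' : 𝔼 n →L[ℝ] 𝔼 k} (hf : HasFDerivWithinAt f f' M (φ u)) :
    HasFDerivAt (f ∘ φ) (f' ∘L fderiv ℝ φ u) u := by
  have h1 : HasFDerivWithinAt (f ∘ φ) (f' ∘L fderiv ℝ φ u) U u :=
    hf.comp u (h.hasFDerivAt hu).hasFDerivWithinAt h.mapsTo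
  exact h1.hasFDerivAt (h.mem_nhds hu)

theorem contDiffOn_comp (h : IsLocalParametrization d M U φ)
    {f : 𝔼 n → 𝔼 k} (hf : ContDiffOn ℝ ∞ f M) : ContDiffOn ℝ ∞ (f ∘ φ) U :=
  hf.comp h.contDiffOn h.mapsTo

theorem fderivWithin_apply (h : IsLocalParametrization d M U φ) {u : 𝔼 d} (hu : u ∈ U)
    {f : 𝔼 n → 𝔼 k} (hf : DifferentiableWithinAt ℝ f M (φ u)) (v : 𝔼 d) :
    fderivWithin ℝ f M (φ u) (fderiv ℝ φ u v) = fderiv ℝ (f ∘ φ) u v := by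
  rw [(h.hasFDerivAt_comp hu hf.hasFDerivWithinAt).fderiv]
  rfl

end IsLocalParametrization

/-- A derivative within a thin set is not unique, but its values on tangent vectors are. This allows
`fderivWithin` to be replaced by any convenient derivative in `normSqDifferential` and
`tangentialDiv`. -/
theorem HasFDerivWithinAt.eqOn_tangentSpaceAt {f : 𝔼 n → 𝔼 k} {f' f₁ : 𝔼 n →L[ℝ] 𝔼 k} {x : 𝔼 n}
    (h : HasFDerivWithinAt f f' M x) (h₁ : HasFDerivWithinAt f f₁ M x) {e : 𝔼 n}
    (he : e ∈ tangentSpaceAt M x) : f' e = f₁ e := by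
  have := LinearMap.eqOn_span (f := f'.toLinearMap) (g := f₁.toLinearMap) (h.unique_on h₁)
  exact this he

theorem ContDiffOn.differentiableWithinAt' {f : 𝔼 n → 𝔼 k} {x : 𝔼 n}
    (h : ContDiffOn ℝ ∞ f M) (hx : x ∈ M) : DifferentiableWithinAt ℝ f M x :=
  h.differentiableOn (by simp) x hx

end Charts

/-! ### The Riemannian volume measure in a local parametrization -/

section Volume

variable {n d : ℕ} {M : Set (𝔼 n)} {U V : Set (𝔼 d)} {φ ψ : 𝔼 d → 𝔼 n}

/-- The volume density `√(det g)` of a parametrization. -/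
noncomputable def volDensity (φ : 𝔼 d → 𝔼 n) (u : 𝔼 d) : ℝ :=
  √(((fderiv ℝ φ u).adjoint ∘L fderiv ℝ φ u).det)

theorem volDensity_nonneg (φ : 𝔼 d → 𝔼 n) (u : 𝔼 d) : 0 ≤ volDensity φ u := Real.sqrt_nonneg _

/-- The push-forward of `√(det g) du` under a parametrization. -/
noncomputable def chartVolume (U : Set (𝔼 d)) (φ : 𝔼 d → 𝔼 n) : Measure (𝔼 n) :=
  Measure.map φ ((volume.restrict U).withDensity fun u => ENNReal.ofReal (volDensity φ u))

theorem riemannianVolume_eq (d : ℕ) (M : Set (𝔼 n)) :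
    riemannianVolume d M = ⨆ (U : Set (𝔼 d)) (φ : 𝔼 d → 𝔼 n)
      (_ : IsLocalParametrization d M U φ), chartVolume U φ := rfl

theorem volDensity_comp {τ : 𝔼 d → 𝔼 d} {u : 𝔼 d} {φ : 𝔼 d → 𝔼 n} 
    (hτ : DifferentiableAt ℝ τ u) (hφ : DifferentiableAt ℝ φ (τ u)) :
    volDensity (φ ∘ τ) u = |(fderiv ℝ τ u).det| * volDensity φ (τ u) := by
  rw [volDensity, volDensity, fderiv_comp u hφ hτ, ← Real.sqrt_sq_eq_abs, ← Real.sqrt_mul (sq_nonneg _)]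
  congr 1
  set T := fderiv ℝ τ u
  set L := fderiv ℝ φ (τ u)
  have h1 : (L ∘L T).adjoint ∘L (L ∘L T) = T.adjoint ∘L (L.adjoint ∘L L) ∘L T := by
    rw [ContinuousLinearMap.adjoint_comp]; rfl
  have h2 : ∀ A B : 𝔼 d →L[ℝ] 𝔼 d, (A ∘L B).det = A.det * B.det := fun A B =>
    LinearMap.det_comp A.toLinearMap B.toLinearMap
  have h3 : T.adjoint.det = T.det := by
    let b := (EuclideanSpace.basisFun (Fin d) ℝ)
    have h4 := LinearMap.toMatrix_adjoint b b (T : 𝔼 d →ₗ[ℝ] 𝔼 d)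
    have h5 := congrArg Matrix.det h4
    rw [Matrix.det_conjTranspose, LinearMap.det_toMatrix, LinearMap.det_toMatrix] at h5
    exact h5
  rw [h1, h2, h2, h3]
  ring

namespace IsLocalParametrization

theorem aemeasurable (h : IsLocalParametrization d M U φ) :
    AEMeasurable φ ((volume.restrict U).withDensity fun u => ENNReal.ofReal (volDensity φ u)) :=
  (h.contDiffOn.continuousOn.aemeasurable h.isOpen_source.measurableSet).mono_ac
    (withDensity_absolutelyContinuous _ _)

theorem measurableSet_inter_preimage (h : IsLocalParametrization d M U φ) {A : Set (𝔼 n)}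
    (hA : MeasurableSet A) : MeasurableSet (U ∩ φ ⁻¹' A) := by
  have h1 := (h.contDiffOn.continuousOn.domRestrict.measurable hA)
  have h2 := h.isOpen_source.measurableSet.subtype_image h1
  convert h2 using 1
  ext u
  simp [and_comm]

theorem chartVolume_apply (h : IsLocalParametrization d M U φ) {A : Set (𝔼 n)}
    (hA : MeasurableSet A) :
    chartVolume U φ A = ∫⁻ u in U ∩ φ ⁻¹' A, ENNReal.ofReal (volDensity φ u) := by
  obtain ⟨g, hg, hgφ⟩ := h.contDiffOn.continuousOn.aemeasurable (μ := volume) h.isOpen_source.measurableSet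
  have h1 : (volume.restrict U).withDensity (fun u => ENNReal.ofReal (volDensity φ u)) ≪ volume.restrict U :=
    withDensity_absolutelyContinuous _ _
  rw [chartVolume, Measure.map_congr (h1.ae_le hgφ), Measure.map_apply hg hA,
    withDensity_apply _ (hg hA), Measure.restrict_restrict (hg hA)]
  apply setLIntegral_congr
  have h2 := (ae_restrict_iff' h.isOpen_source.measurableSet).1 hgφ
  filter_upwards [h2] with u hu
  refine propext ⟨fun ⟨h3, h4⟩ => ⟨h4, ?_⟩, fun ⟨h3, h4⟩ => ⟨?_, h3⟩⟩
  · rw [mem_preimage, hu h4]; exact h3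
  · rw [mem_preimage, ← hu h3]; exact h4

end IsLocalParametrization

/-- Change of variables along the transition map τ = φ⁻¹ ∘ ψ, which is injective and differentiable
and scales the densities by |det Dτ|. The inequality suffices because the volume is defined as a
supremum. -/
theorem chartVolume_restrict_le (h : IsLocalParametrization d M U φ)
    (k : IsLocalParametrization d M V ψ) {O : Set (𝔼 n)} (hO : IsOpen O) (hUO : φ '' U = M ∩ O) :
    (chartVolume V ψ).restrict O ≤ chartVolume U φ := by
  refine Measure.le_iff.2 fun A hA => ?_
  have hAO := hA.inter hO.measurableSet
  rw [Measure.restrict_apply hA, k.chartVolume_apply hAO, h.chartVolume_apply hA]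
  set B := V ∩ ψ ⁻¹' (A ∩ O)
  have hB : MeasurableSet B := k.measurableSet_inter_preimage hAO
  let τ : 𝔼 d → 𝔼 d := Function.invFunOn φ U ∘ ψ
  have hmem : ∀ v ∈ V ∩ ψ ⁻¹' O, ψ v ∈ φ '' U := fun v hv => hUO ▸ ⟨k.mapsTo hv.1, hv.2⟩
  have hτU : ∀ v ∈ V ∩ ψ ⁻¹' O, τ v ∈ U := fun v hv => Function.invFunOn_mem (hmem v hv)
  have hτ : ∀ v ∈ V ∩ ψ ⁻¹' O, φ (τ v) = ψ v := fun v hv => Function.invFunOn_eq (hmem v hv)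
  have hopen : IsOpen (V ∩ ψ ⁻¹' O) := k.contDiffOn.continuousOn.isOpen_inter_preimage k.isOpen_source hO
  have hsub : B ⊆ V ∩ ψ ⁻¹' O := fun v hv => ⟨hv.1, hv.2.2⟩
  have hdiff : ∀ v ∈ V ∩ ψ ⁻¹' O, DifferentiableAt ℝ τ v := by
    intro v hv
    obtain ⟨σ, hσ, hσφ⟩ := h.exists_leftInverse (hτU v hv)
    rw [hτ v hv] at hσ
    have h1 : DifferentiableAt ℝ (σ ∘ ψ) v := hσ.comp v (k.hasFDerivAt hv.1).differentiableAt
    refine h1.congr_of_eventuallyEq ?_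
    have h2 : ∀ᶠ x in 𝓝[M] (ψ v), ∃ w ∈ U, φ w = x ∧ σ (φ w) = w := by
      rw [← hτ v hv, ← h.map_nhds (hτU v hv), eventually_map]
      filter_upwards [hσφ, h.mem_nhds (hτU v hv)] with w hw hwU
      exact ⟨w, hwU, rfl, hw⟩
    rw [← k.map_nhds hv.1, eventually_map] at h2
    filter_upwards [h2, hopen.mem_nhds hv] with w ⟨z, hzU, hz, hσz⟩ hw
    rw [Function.comp_apply, ← hz, hσz]
    exact h.injOn (hτU w hw) hzU ((hτ w hw).trans hz.symm)
  have hdens : ∀ v ∈ B, ENNReal.ofReal (volDensity ψ v)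
      = ENNReal.ofReal |(fderiv ℝ τ v).det| * ENNReal.ofReal (volDensity φ (τ v)) := by
    intro v hv
    rw [← ENNReal.ofReal_mul (abs_nonneg _), ← volDensity_comp (hdiff v (hsub hv))
      (h.hasFDerivAt (hτU v (hsub hv))).differentiableAt]
    congr 1
    have : ψ =ᶠ[𝓝 v] φ ∘ τ := by
      filter_upwards [hopen.mem_nhds (hsub hv)] with w hw using (hτ w hw).symm
    rw [volDensity, volDensity, this.fderiv_eq]
  have hinj : InjOn τ B := by
    intro v hv w hw hvw
    apply k.injOn hv.1 hw.1
    rw [← hτ v (hsub hv), ← hτ w (hsub hw), hvw]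
  rw [setLIntegral_congr_fun hB hdens, ← lintegral_image_eq_lintegral_abs_det_fderiv_mul volume hB
    (fun v hv => (hdiff v (hsub hv)).hasFDerivAt.hasFDerivWithinAt) hinj
    (fun u => ENNReal.ofReal (volDensity φ u))]
  apply lintegral_mono_set
  rintro _ ⟨v, hv, rfl⟩
  refine ⟨hτU v (hsub hv), ?_⟩
  rw [mem_preimage, hτ v (hsub hv)]
  exact hv.2.1

theorem riemannianVolume_restrict (h : IsLocalParametrization d M U φ) {O : Set (𝔼 n)}
    (hO : IsOpen O) (hUO : φ '' U = M ∩ O) :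
    (riemannianVolume d M).restrict O = chartVolume U φ := by
  have hOm := hO.measurableSet
  apply le_antisymm
  -- To avoid commuting restriction with a supremum, one fixed measure is made to dominate every
  -- chart measure: on `O` by the previous lemma, off `O` by the volume itself.
  · have h1 : riemannianVolume d M ≤ chartVolume U φ + (riemannianVolume d M).restrict Oᶜ := by
      nth_rewrite 1 [riemannianVolume_eq]
      refine iSup_le fun V => iSup_le fun ψ => iSup_le fun k => ?_
      rw [← Measure.restrict_add_restrict_compl (μ := chartVolume V ψ) hOm]
      refine add_le_add (chartVolume_restrict_le h k hO hUO) (Measure.restrict_mono_measure ?_ _)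
      rw [riemannianVolume_eq]
      exact le_iSup_of_le V (le_iSup_of_le ψ (le_iSup_of_le k le_rfl))
    have h2 := Measure.restrict_mono_measure h1 O
    rw [Measure.restrict_add, Measure.restrict_restrict hOm, inter_compl_self,
      Measure.restrict_empty, add_zero] at h2
    exact h2.trans Measure.restrict_le_self
  · have h1 : chartVolume U φ ≤ riemannianVolume d M := by
      rw [riemannianVolume_eq]
      exact le_iSup_of_le U (le_iSup_of_le φ (le_iSup_of_le h le_rfl))
    have h2 : (chartVolume U φ).restrict O = chartVolume U φ := by
      apply Measure.restrict_eq_self_of_ae_mem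
      rw [ae_iff]
      change chartVolume U φ Oᶜ = 0
      rw [h.chartVolume_apply hOm.compl]
      have : U ∩ φ ⁻¹' Oᶜ = ∅ := by
        ext u
        simp only [mem_inter_iff, mem_preimage, mem_compl_iff, mem_empty_iff_false, iff_false]
        rintro ⟨hu, hu'⟩
        exact hu' (hUO ▸ mem_image_of_mem φ hu : φ u ∈ M ∩ O).2
      rw [this]
      simp
    rw [← h2]
    exact Measure.restrict_mono_measure h1 O

theorem riemannianVolume_compl (hM : MeasurableSet M) : riemannianVolume d M Mᶜ = 0 := by
  have h1 : riemannianVolume d M ≤ (riemannianVolume d M).restrict M := by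
    nth_rewrite 1 [riemannianVolume_eq]
    refine iSup_le fun V => iSup_le fun ψ => iSup_le fun k => ?_
    have h2 : (chartVolume V ψ).restrict M = chartVolume V ψ := by
      apply Measure.restrict_eq_self_of_ae_mem
      rw [ae_iff]
      change chartVolume V ψ Mᶜ = 0
      rw [k.chartVolume_apply hM.compl]
      have : V ∩ ψ ⁻¹' Mᶜ = ∅ := by
        ext u
        simp only [mem_inter_iff, mem_preimage, mem_compl_iff, mem_empty_iff_false, iff_false]
        rintro ⟨hu, hu'⟩
        exact hu' (k.mapsTo hu)
      rw [this]
      simp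
    rw [← h2]
    refine Measure.restrict_mono_measure ?_ _
    rw [riemannianVolume_eq]
    exact le_iSup_of_le V (le_iSup_of_le ψ (le_iSup_of_le k le_rfl))
  have := h1 Mᶜ
  rw [Measure.restrict_apply hM.compl, compl_inter_self, measure_empty] at this
  exact le_antisymm this bot_le

theorem riemannianVolume_restrict_self (hM : MeasurableSet M) :
    (riemannianVolume d M).restrict M = riemannianVolume d M := by
  apply Measure.restrict_eq_self_of_ae_mem
  exact riemannianVolume_compl hM

end Volume

/-! ### Dual frames and the derivative of the Gram determinant -/

section Frames

variable {ι : Type*} [Fintype ι] [DecidableEq ι]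
variable {E : Type*} [NormedAddCommGroup E] [InnerProductSpace ℝ E]
variable {F : Type*} [AddCommGroup F] [Module ℝ F]

/-- The frame dual to `w` in the span of `w`. -/
noncomputable def dualFrame (w : ι → E) (j : ι) : E :=
  ∑ k, (Matrix.gram ℝ w)⁻¹ j k • w k

theorem det_gram_pos {w : ι → E} (hw : LinearIndependent ℝ w) : 0 < (Matrix.gram ℝ w).det :=
  (Matrix.posDef_gram_of_linearIndependent hw).det_pos

theorem inner_dualFrame {w : ι → E} (hw : LinearIndependent ℝ w) (j l : ι) :
    inner ℝ (dualFrame w j) (w l) = if j = l then 1 else 0 := by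
  have h := Matrix.nonsing_inv_mul (Matrix.gram ℝ w) (det_gram_pos hw).ne'.isUnit
  have h2 := congrFun (congrFun h j) l
  rw [Matrix.mul_apply, Matrix.one_apply] at h2
  simpa [dualFrame, sum_inner, real_inner_smul_left, Matrix.gram_apply] using h2

theorem dualFrame_mem_span (w : ι → E) (j : ι) : dualFrame w j ∈ Submodule.span ℝ (range w) :=
  Submodule.sum_mem _ fun k _ => Submodule.smul_mem _ _ (Submodule.subset_span (mem_range_self k))

theorem sum_inner_dualFrame {w : ι → E} (hw : LinearIndependent ℝ w) {z : E}
    (hz : z ∈ Submodule.span ℝ (range w)) : ∑ j, inner ℝ (dualFrame w j) z • w j = z := by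
  induction hz using Submodule.span_induction with
  | mem x hx =>
    obtain ⟨l, rfl⟩ := hx
    simp [inner_dualFrame hw]
  | zero => simp
  | add x y _ _ hx hy =>
    nth_rewrite 2 [← hx, ← hy]
    simp [inner_add_right, add_smul, Finset.sum_add_distrib]
  | smul a x _ hx =>
    nth_rewrite 2 [← hx]
    simp [inner_smul_right, mul_smul, Finset.smul_sum]

/-- Both sides are the metric trace of `B`: expand one entry in the frame, exchange the sums and
reassemble the dual vector. It replaces orthonormal bases chosen pointwise, with no continuity, by
coordinate frames that vary smoothly. -/
theorem sum_bilin_eq_sum_dualFrame {w : ι → E} (hw : LinearIndependent ℝ w) {T : Submodule ℝ E}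
    (hT : T = Submodule.span ℝ (range w)) {κ : Type*} [Fintype κ] (b : OrthonormalBasis κ ℝ T)
    (B : E →ₗ[ℝ] E →ₗ[ℝ] F) :
    ∑ i, B (b i) (b i) = ∑ j, B (dualFrame w j) (w j) := by
  have h1 : ∀ i, B (b i) (b i) = ∑ j, inner ℝ (dualFrame w j) (b i : E) • B (b i) (w j) := by
    intro i
    have := sum_inner_dualFrame hw (hT ▸ (b i).2 : (b i : E) ∈ Submodule.span ℝ (range w))
    nth_rewrite 2 [← this]
    simp [map_sum]
  have h2 : ∀ j, ∑ i, inner ℝ (dualFrame w j) (b i : E) • (b i : E) = dualFrame w j := by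
    intro j
    have hj : dualFrame w j ∈ T := hT ▸ dualFrame_mem_span w j
    have h3 := b.sum_repr' ⟨dualFrame w j, hj⟩
    have h4 := congrArg (Subtype.val) h3
    simp only [Submodule.coe_sum, Submodule.coe_smul] at h4
    nth_rewrite 2 [← h4]
    refine Finset.sum_congr rfl fun i _ => ?_
    rw [Submodule.coe_inner, real_inner_comm]
  simp_rw [h1]
  rw [Finset.sum_comm]
  refine Finset.sum_congr rfl fun j _ => ?_
  nth_rewrite 2 [← h2 j]
  simp [map_sum, LinearMap.sum_apply]

/-- Differentiating the Leibniz expansion gives the sum over i of the determinants with column i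
replaced by its derivative, and by Cramer's rule these are the diagonal entries of adj(A) A'. -/
theorem Matrix.hasDerivAt_det {A : ℝ → Matrix ι ι ℝ} {A' : Matrix ι ι ℝ} {t : ℝ}
    (h : ∀ i j, HasDerivAt (fun s => A s i j) (A' i j) t) :
    HasDerivAt (fun s => (A s).det) ((A t).adjugate * A').trace t := by
  have h1 : HasDerivAt (fun s => (A s).det)
      (∑ σ : Equiv.Perm ι, (Equiv.Perm.sign σ : ℤ) •
        ∑ i, (∏ j ∈ Finset.univ.erase i, A t (σ j) j) • A' (σ i) i) t := by
    simp_rw [Matrix.det_apply]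
    refine HasDerivAt.fun_sum fun σ _ => ?_
    have := HasDerivAt.fun_finsetProd (u := Finset.univ) (f := fun i s => A s (σ i) i)
      (f' := fun i => A' (σ i) i) (fun i _ => h (σ i) i)
    have h3 := this.const_mul (((Equiv.Perm.sign σ : ℤ)) : ℝ)
    simpa [zsmul_eq_mul, Units.smul_def] using h3
  convert! h1 using 1
  have h2 : ∀ i, ((A t).adjugate * A') i i = ((A t).updateCol i (fun j => A' j i)).det := by
    intro i
    rw [← Matrix.cramer_apply, Matrix.cramer_eq_adjugate_mulVec]
    rfl
  simp_rw [Matrix.trace, Matrix.diag, h2, Matrix.det_apply, Finset.smul_sum]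
  rw [Finset.sum_comm]
  refine Finset.sum_congr rfl fun σ _ => Finset.sum_congr rfl fun i _ => ?_
  rw [← Finset.mul_prod_erase Finset.univ _ (Finset.mem_univ i)]
  have h4 : ∏ x ∈ Finset.univ.erase i, (A t).updateCol i (fun j => A' j i) (σ x) x
      = ∏ x ∈ Finset.univ.erase i, A t (σ x) x :=
    Finset.prod_congr rfl fun x hx => by
      rw [Matrix.updateCol_ne (Finset.ne_of_mem_erase hx)]
  rw [h4]
  simp [Units.smul_def, mul_comm]

/-- **Jacobi's formula** for the volume spanned by a frame. -/
theorem hasDerivAt_sqrt_det_gram {w : ℝ → ι → E} {w' : ι → E} {t : ℝ}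
    (h : ∀ j, HasDerivAt (fun s => w s j) (w' j) t) (hw : LinearIndependent ℝ (w t)) :
    HasDerivAt (fun s => √(Matrix.gram ℝ (w s)).det)
      (√(Matrix.gram ℝ (w t)).det * ∑ j, inner ℝ (dualFrame (w t) j) (w' j)) t := by
  have hpos := det_gram_pos hw
  have h1 := Matrix.hasDerivAt_det (A := fun s => Matrix.gram ℝ (w s))
    (A' := Matrix.of fun i j => inner ℝ (w t i) (w' j) + inner ℝ (w' i) (w t j)) (t := t)
    (fun i j => (h i).inner ℝ (h j))
  have h2 := h1.sqrt hpos.ne'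
  convert! h2 using 1
  set G := Matrix.gram ℝ (w t) with hG
  have hadj : G.adjugate = G.det • G⁻¹ := by
    rw [Matrix.inv_def, smul_smul, Ring.mul_inverse_cancel _ hpos.ne'.isUnit, one_smul]
  have hsymm : ∀ i j, G⁻¹ i j = G⁻¹ j i := by
    intro i j
    have : (G⁻¹).IsHermitian := (Matrix.isHermitian_gram ℝ (w t)).inv
    simpa using (this.apply i j).symm
  -- By symmetry of `G⁻¹` the two halves of the derivative of the Gram matrix have the same trace
  -- against it; the resulting 2 cancels the ½ of the square root.
  have h3 : (G.adjugate * Matrix.of fun i j => inner ℝ (w t i) (w' j) + inner ℝ (w' i) (w t j)).trace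
      = G.det * (2 * ∑ j, inner ℝ (dualFrame (w t) j) (w' j)) := by
    rw [hadj, Matrix.smul_mul, Matrix.trace_smul, smul_eq_mul]
    congr 1
    simp only [Matrix.trace, Matrix.diag, Matrix.mul_apply, Matrix.of_apply, mul_add,
      Finset.sum_add_distrib, two_mul]
    simp only [dualFrame, sum_inner, real_inner_smul_left]
    congr 1
    rw [Finset.sum_comm]
    refine Finset.sum_congr rfl fun i _ => Finset.sum_congr rfl fun j _ => ?_
    rw [hsymm, real_inner_comm]
  rw [h3]
  have h5 := Real.mul_self_sqrt hpos.le
  have h6 := Real.sqrt_pos.2 hpos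
  field_simp
  rw [sq, h5, mul_comm]

section Smooth

variable {E₀ : Type*} [NormedAddCommGroup E₀] [NormedSpace ℝ E₀] {N : WithTop ℕ∞}

theorem ContDiffOn.matrix_det {A : E₀ → Matrix ι ι ℝ} {s : Set E₀}
    (h : ∀ i j, ContDiffOn ℝ N (fun x => A x i j) s) : ContDiffOn ℝ N (fun x => (A x).det) s := by
  simp_rw [Matrix.det_apply']
  exact ContDiffOn.sum fun σ _ => contDiffOn_const.mul (contDiffOn_prod fun i _ => h (σ i) i)

theorem ContDiffOn.matrix_inv {A : E₀ → Matrix ι ι ℝ} {s : Set E₀}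
    (h : ∀ i j, ContDiffOn ℝ N (fun x => A x i j) s) (hA : ∀ x ∈ s, (A x).det ≠ 0) (i j : ι) :
    ContDiffOn ℝ N (fun x => (A x)⁻¹ i j) s := by
  simp_rw [Matrix.inv_def, Matrix.smul_apply, Ring.inverse_eq_inv', smul_eq_mul]
  refine ((ContDiffOn.matrix_det h).inv hA).mul ?_
  simp_rw [Matrix.adjugate_apply]
  refine ContDiffOn.matrix_det fun k l => ?_
  by_cases hk : k = j
  · subst hk
    simpa using contDiffOn_const
  · simpa [Matrix.updateRow_ne hk] using h k l

theorem ContDiffOn.dualFrame {w : E₀ → ι → E} {s : Set E₀}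
    (h : ∀ j, ContDiffOn ℝ N (fun x => w x j) s) (hw : ∀ x ∈ s, LinearIndependent ℝ (w x)) (j : ι) :
    ContDiffOn ℝ N (fun x => dualFrame (w x) j) s :=
  ContDiffOn.sum fun k _ => (ContDiffOn.matrix_inv (fun i j => (h i).inner ℝ (h j))
    (fun x hx => (det_gram_pos (hw x hx)).ne') j k).smul (h k)

theorem ContDiffOn.sqrt_det_gram {w : E₀ → ι → E} {s : Set E₀}
    (h : ∀ j, ContDiffOn ℝ N (fun x => w x j) s) (hw : ∀ x ∈ s, LinearIndependent ℝ (w x)) :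
    ContDiffOn ℝ N (fun x => √(Matrix.gram ℝ (w x)).det) s :=
  (ContDiffOn.matrix_det (fun i j => (h i).inner ℝ (h j))).sqrt fun x hx => (det_gram_pos (hw x hx)).ne'

end Smooth

end Frames

/-! ### The coordinate frame of a parametrization -/

section CoordFrame

variable {n d k : ℕ} {M : Set (𝔼 n)} {U : Set (𝔼 d)} {φ : 𝔼 d → 𝔼 n}

/-- The coordinate vector fields of a parametrization. -/
noncomputable def coordFrame (φ : 𝔼 d → 𝔼 n) (u : 𝔼 d) (j : Fin d) : 𝔼 n :=
  fderiv ℝ φ u (EuclideanSpace.single j 1)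

theorem volDensity_eq (φ : 𝔼 d → 𝔼 n) (u : 𝔼 d) :
    volDensity φ u = √(Matrix.gram ℝ (coordFrame φ u)).det := by
  rw [volDensity]
  congr 1
  let b := EuclideanSpace.basisFun (Fin d) ℝ
  have h := LinearMap.det_toMatrix b.toBasis
    ((fderiv ℝ φ u).adjoint ∘L fderiv ℝ φ u : 𝔼 d →L[ℝ] 𝔼 d).toLinearMap
  change LinearMap.det _ = _
  rw [← h]
  congr 1
  ext i j
  rw [LinearMap.toMatrix_apply, Matrix.gram_apply]
  have h2 : ∀ z : 𝔼 d, b.toBasis.repr z i = inner ℝ (b i) z := fun z => by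
    rw [OrthonormalBasis.coe_toBasis_repr_apply, OrthonormalBasis.repr_apply_apply]
  rw [h2]
  simp [b, coordFrame, ContinuousLinearMap.adjoint_inner_right]

namespace IsLocalParametrization

theorem linearIndependent_coordFrame (h : IsLocalParametrization d M U φ) {u : 𝔼 d} (hu : u ∈ U) :
    LinearIndependent ℝ (coordFrame φ u) := by
  have h1 := (EuclideanSpace.basisFun (Fin d) ℝ).toBasis.linearIndependent
  have h2 := h1.map' (fderiv ℝ φ u).toLinearMap (LinearMap.ker_eq_bot.2 (h.injective_fderiv u hu))
  convert! h2 using 1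
  ext j : 1
  simp [coordFrame]

theorem tangentSpaceAt_eq_span (h : IsLocalParametrization d M U φ) {u : 𝔼 d} (hu : u ∈ U) :
    tangentSpaceAt M (φ u) = Submodule.span ℝ (range (coordFrame φ u)) := by
  rw [h.tangentSpaceAt_eq_range hu, LinearMap.range_eq_map,
    ← (EuclideanSpace.basisFun (Fin d) ℝ).toBasis.span_eq, Submodule.map_span, ← range_comp]
  congr 2
  ext j : 1
  simp [coordFrame]

theorem contDiffOn_coordFrame (h : IsLocalParametrization d M U φ) (j : Fin d) :
    ContDiffOn ℝ ∞ (fun u => coordFrame φ u j) U :=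
  h.contDiffOn_fderiv.clm_apply contDiffOn_const

theorem contDiffOn_dualFrame (h : IsLocalParametrization d M U φ) (j : Fin d) :
    ContDiffOn ℝ ∞ (fun u => dualFrame (coordFrame φ u) j) U :=
  ContDiffOn.dualFrame h.contDiffOn_coordFrame (fun _ hu => h.linearIndependent_coordFrame hu) j

theorem contDiffOn_volDensity (h : IsLocalParametrization d M U φ) :
    ContDiffOn ℝ ∞ (volDensity φ) U := by
  have := ContDiffOn.sqrt_det_gram h.contDiffOn_coordFrame
    (fun _ hu => h.linearIndependent_coordFrame hu)
  exact this.congr fun u _ => volDensity_eq φ u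

theorem normSqDifferential_eq (h : IsLocalParametrization d M U φ) {u : 𝔼 d} (hu : u ∈ U)
    {f : 𝔼 n → 𝔼 k} (hf : DifferentiableWithinAt ℝ f M (φ u)) :
    normSqDifferential M f (φ u) = ∑ j, inner ℝ (fderivWithin ℝ f M (φ u) (dualFrame (coordFrame φ u) j))
      (fderiv ℝ (f ∘ φ) u (EuclideanSpace.single j 1)) := by
  let D := (fderivWithin ℝ f M (φ u)).toLinearMap
  have h1 := sum_bilin_eq_sum_dualFrame (h.linearIndependent_coordFrame hu)
    (h.tangentSpaceAt_eq_span hu) (stdOrthonormalBasis ℝ (tangentSpaceAt M (φ u)))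
    ((innerₗ (𝔼 k)).compl₁₂ D D)
  simp only [LinearMap.compl₁₂_apply, innerₗ_apply_apply] at h1
  rw [normSqDifferential]
  simp_rw [← h.fderivWithin_apply hu hf, ← real_inner_self_eq_norm_sq]
  exact h1

end IsLocalParametrization

/-- The tangential divergence of a vector field along `M`. -/
noncomputable def tangentialDiv (M : Set (𝔼 n)) (W : 𝔼 n → 𝔼 n) (x : 𝔼 n) : ℝ :=
  ∑ i, inner ℝ (stdOrthonormalBasis ℝ (tangentSpaceAt M x) i : 𝔼 n)
    (fderivWithin ℝ W M x (stdOrthonormalBasis ℝ (tangentSpaceAt M x) i : 𝔼 n))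

theorem IsLocalParametrization.tangentialDiv_eq (h : IsLocalParametrization d M U φ) {u : 𝔼 d}
    (hu : u ∈ U) {W : 𝔼 n → 𝔼 n} (hW : DifferentiableWithinAt ℝ W M (φ u)) :
    tangentialDiv M W (φ u) = ∑ j, inner ℝ (dualFrame (coordFrame φ u) j)
      (fderiv ℝ (W ∘ φ) u (EuclideanSpace.single j 1)) := by
  let D := (fderivWithin ℝ W M (φ u)).toLinearMap
  have h1 := sum_bilin_eq_sum_dualFrame (h.linearIndependent_coordFrame hu)
    (h.tangentSpaceAt_eq_span hu) (stdOrthonormalBasis ℝ (tangentSpaceAt M (φ u)))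
    ((innerₗ (𝔼 n)).compl₁₂ LinearMap.id D)
  simp only [LinearMap.compl₁₂_apply, innerₗ_apply_apply] at h1
  simp_rw [← h.fderivWithin_apply hu hW]
  exact h1

end CoordFrame

/-! ### Minimal submanifolds of the unit sphere -/

/-- `Π x`, for `x ∈ M`, is the orthogonal projection onto `T_x M`, and the trace of its derivative
along `M`, which is the mean curvature vector of `M` in `ℝⁿ`, is `-d x`: the `d`-dimensional
submanifold `M` is minimal in the unit sphere. -/
structure IsMinimalInSphere {n : ℕ} (d : ℕ) (M : Set (𝔼 n)) (Pr : 𝔼 n → 𝔼 n →L[ℝ] 𝔼 n) : Prop where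
  contDiff : ContDiff ℝ ∞ Pr
  symm : ∀ x ∈ M, ∀ y z, inner ℝ (Pr x y) z = inner ℝ y (Pr x z)
  idem : ∀ x ∈ M, ∀ y, Pr x (Pr x y) = Pr x y
  trace : ∀ x ∈ M, LinearMap.trace ℝ (𝔼 n) (Pr x).toLinearMap = d
  tangent : ∀ x ∈ M, ∀ v ∈ tangentConeAt ℝ M x, Pr x v = v
  mean : ∀ x ∈ M, ∑ i, fderiv ℝ Pr x (Pr x (EuclideanSpace.single i 1)) (EuclideanSpace.single i 1)
    = -(d : ℝ) • x

section Local

variable {n d : ℕ} {M : Set (𝔼 n)} {U : Set (𝔼 d)} {φ : 𝔼 d → 𝔼 n} {Pr : 𝔼 n → 𝔼 n →L[ℝ] 𝔼 n}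

theorem IsMinimalInSphere.apply_eq_self (hM : IsMinimalInSphere d M Pr) {x v : 𝔼 n} (hx : x ∈ M)
    (hv : v ∈ tangentSpaceAt M x) : Pr x v = v :=
  LinearMap.eqOn_span (f := (Pr x).toLinearMap) (g := LinearMap.id) (hM.tangent x hx) hv

/-- The trace of an idempotent is its rank, so the range has dimension `d`, as does the tangent
space that it contains. -/
theorem IsMinimalInSphere.range_eq (hM : IsMinimalInSphere d M Pr)
    (h : IsLocalParametrization d M U φ) {u : 𝔼 d} (hu : u ∈ U) :
    LinearMap.range (Pr (φ u)).toLinearMap = tangentSpaceAt M (φ u) := by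
  have hx := h.mapsTo hu
  symm
  apply Submodule.eq_of_le_of_finrank_eq
  · exact fun v hv => ⟨v, hM.apply_eq_self hx hv⟩
  · rw [h.tangentSpaceAt_eq_span hu, finrank_span_eq_card (h.linearIndependent_coordFrame hu),
      Fintype.card_fin]
    have h1 : IsIdempotentElem (Pr (φ u)).toLinearMap := LinearMap.ext fun y => hM.idem _ hx y
    have h2 := (LinearMap.IsIdempotentElem.isProj_range _ h1).trace
    rw [hM.trace _ hx] at h2
    exact_mod_cast h2

theorem IsMinimalInSphere.eq_sum_coordFrame (hM : IsMinimalInSphere d M Pr)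
    (h : IsLocalParametrization d M U φ) {u : 𝔼 d} (hu : u ∈ U) (z : 𝔼 n) :
    Pr (φ u) z = ∑ j, inner ℝ (dualFrame (coordFrame φ u) j) z • coordFrame φ u j := by
  have hx := h.mapsTo hu
  have hspan := h.tangentSpaceAt_eq_span hu
  have h1 : Pr (φ u) z ∈ Submodule.span ℝ (range (coordFrame φ u)) := by
    rw [← hspan, ← hM.range_eq h hu]
    exact ⟨z, rfl⟩
  rw [← sum_inner_dualFrame (h.linearIndependent_coordFrame hu) h1]
  refine Finset.sum_congr rfl fun j _ => ?_
  rw [← hM.symm _ hx, hM.apply_eq_self hx (hspan ▸ dualFrame_mem_span _ _)]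

theorem fderiv_coordFrame_comm (h : IsLocalParametrization d M U φ) {u : 𝔼 d} (hu : u ∈ U)
    (j l : Fin d) :
    fderiv ℝ (fun u => coordFrame φ u j) u (EuclideanSpace.single l 1)
      = fderiv ℝ (fun u => coordFrame φ u l) u (EuclideanSpace.single j 1) := by
  have h1 : HasFDerivAt (fderiv ℝ φ) (fderiv ℝ (fderiv ℝ φ) u) u :=
    ((h.contDiffOn_fderiv.contDiffAt (h.mem_nhds hu)).differentiableAt (by simp)).hasFDerivAt
  have h2 : ∀ j, fderiv ℝ (fun u => coordFrame φ u j) u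
      = (fderiv ℝ (fderiv ℝ φ) u).flip (EuclideanSpace.single j 1) := fun j => by
    have := h1.clm_apply (hasFDerivAt_const (EuclideanSpace.single j (1 : ℝ)) u)
    exact (this.congr_fderiv (by ext v; simp)).fderiv
  rw [h2, h2]
  exact (h.contDiffAt hu).isSymmSndFDerivAt
    (by rw [minSmoothness_of_isRCLikeNormedField]; exact WithTop.coe_le_coe.2 le_top) _ _

theorem fderiv_volDensity (h : IsLocalParametrization d M U φ) {u : 𝔼 d} (hu : u ∈ U) (l : Fin d) :
    fderiv ℝ (volDensity φ) u (EuclideanSpace.single l 1)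
      = volDensity φ u * ∑ j, inner ℝ (dualFrame (coordFrame φ u) j)
        (fderiv ℝ (fun u => coordFrame φ u j) u (EuclideanSpace.single l 1)) := by
  have hJ : HasFDerivAt (volDensity φ) (fderiv ℝ (volDensity φ) u) u :=
    ((h.contDiffOn_volDensity.contDiffAt (h.mem_nhds hu)).differentiableAt (by simp)).hasFDerivAt
  have hw : ∀ j, HasFDerivAt (fun u => coordFrame φ u j) (fderiv ℝ (fun u => coordFrame φ u j) u) u :=
    fun j => (((h.contDiffOn_coordFrame j).contDiffAt
      (h.mem_nhds hu)).differentiableAt (by simp)).hasFDerivAt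
  have h1 := (hJ.hasLineDerivAt (EuclideanSpace.single l 1))
  have h2 := hasDerivAt_sqrt_det_gram (t := 0)
    (w := fun t => coordFrame φ (u + t • EuclideanSpace.single l (1 : ℝ)))
    (fun j => (hw j).hasLineDerivAt (EuclideanSpace.single l 1))
    (by simpa using h.linearIndependent_coordFrame hu)
  simp only [← volDensity_eq, zero_smul, add_zero] at h2
  exact HasDerivAt.unique h1 h2

/-- The Laplace-Beltrami operator applied to the position vector. -/
theorem IsMinimalInSphere.sum_fderiv_dualFrame (hM : IsMinimalInSphere d M Pr)
    (h : IsLocalParametrization d M U φ) {u : 𝔼 d} (hu : u ∈ U) :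
    ∑ j, (fderiv ℝ (volDensity φ) u (EuclideanSpace.single j 1) • dualFrame (coordFrame φ u) j
      + volDensity φ u • fderiv ℝ (fun u => dualFrame (coordFrame φ u) j) u (EuclideanSpace.single j 1))
      = -((d : ℝ) * volDensity φ u) • φ u := by
  have hx := h.mapsTo hu
  have hli := h.linearIndependent_coordFrame hu
  set f : Fin d → 𝔼 d := fun j => EuclideanSpace.single j 1 with hf
  set w := coordFrame φ with hw
  set J := volDensity φ u with hJ
  have hw' : ∀ j, HasFDerivAt (fun u => w u j) (fderiv ℝ (fun u => w u j) u) u :=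
    fun j => (((h.contDiffOn_coordFrame j).contDiffAt
      (h.mem_nhds hu)).differentiableAt (by simp)).hasFDerivAt
  have hd' : ∀ j, HasFDerivAt (fun u => dualFrame (w u) j)
      (fderiv ℝ (fun u => dualFrame (w u) j) u) u :=
    fun j => (((h.contDiffOn_dualFrame j).contDiffAt
      (h.mem_nhds hu)).differentiableAt (by simp)).hasFDerivAt
  -- Differentiate ⟨wʲ, w_l⟩ = δ_{jl} in direction j; symmetry of second derivatives replaces ∂_j
  -- w_l by ∂_l w_j.
  have hdual : ∀ j l, inner ℝ (fderiv ℝ (fun u => dualFrame (w u) j) u (f j)) (w u l)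
      = - inner ℝ (dualFrame (w u) j) (fderiv ℝ (fun u => w u j) u (f l)) := by
    intro j l
    have h1 := ((hd' j).inner ℝ (hw' l))
    have h2 : (fun u => (inner ℝ (dualFrame (w u) j) (w u l) : ℝ)) =ᶠ[𝓝 u]
        fun _ => if j = l then 1 else 0 := by
      filter_upwards [h.mem_nhds hu] with v hv
      exact inner_dualFrame (h.linearIndependent_coordFrame hv) j l
    have h3 := (hasFDerivAt_const (𝕜 := ℝ) (if j = l then (1 : ℝ) else 0) u).congr_of_eventuallyEq h2
    have h4 := congrArg (fun A : 𝔼 d →L[ℝ] ℝ => A (f j)) (h1.unique h3)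
    simp [fderivInnerCLM_apply] at h4
    have h5 := fderiv_coordFrame_comm h hu j l
    change fderiv ℝ (fun u => w u j) u (f l) = fderiv ℝ (fun u => w u l) u (f j) at h5
    rw [h5]
    linarith
  -- Differentiating Pr(φ) wʲ = wʲ separates the normal part of ∂_j wʲ, which involves only the
  -- derivative of `Pr`.
  have hproj : ∀ j, fderiv ℝ (fun u => dualFrame (w u) j) u (f j)
      = fderiv ℝ Pr (φ u) (w u j) (dualFrame (w u) j)
        + Pr (φ u) (fderiv ℝ (fun u => dualFrame (w u) j) u (f j)) := by
    intro j
    have h0 : HasFDerivAt Pr (fderiv ℝ Pr (φ u)) (φ u) :=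
      (hM.contDiff.differentiable (by simp) _).hasFDerivAt
    have h1 := (h0.comp u (h.hasFDerivAt hu)).clm_apply (hd' j)
    have h2 : (fun u => dualFrame (w u) j) =ᶠ[𝓝 u] fun y => (Pr ∘ φ) y (dualFrame (w y) j) := by
      filter_upwards [h.mem_nhds hu] with v hv
      exact (hM.apply_eq_self (h.mapsTo hv)
        (h.tangentSpaceAt_eq_span hv ▸ dualFrame_mem_span _ _)).symm
    have h4 := congrArg (fun A : 𝔼 d →L[ℝ] 𝔼 n => A (f j)) ((hd' j).unique (h1.congr_of_eventuallyEq h2))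
    simp at h4
    nth_rewrite 1 [h4]
    rw [add_comm]
    rfl
  have hmean : ∑ j, fderiv ℝ Pr (φ u) (w u j) (dualFrame (w u) j) = -(d : ℝ) • φ u := by
    rw [← hM.mean _ hx]
    have h1 : ∀ j, fderiv ℝ Pr (φ u) (w u j) (dualFrame (w u) j)
        = ∑ i, fderiv ℝ Pr (φ u) (inner ℝ (dualFrame (w u) j) (EuclideanSpace.single i (1 : ℝ)) • w u j)
          (EuclideanSpace.single i 1) := by
      intro j
      have := (EuclideanSpace.basisFun (Fin n) ℝ).sum_repr' (dualFrame (w u) j)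
      nth_rewrite 1 [← this]
      simp only [map_sum, map_smul, EuclideanSpace.basisFun_apply, smul_apply]
      refine Finset.sum_congr rfl fun i _ => ?_
      rw [real_inner_comm]
    simp_rw [h1]
    rw [Finset.sum_comm]
    refine Finset.sum_congr rfl fun i _ => ?_
    rw [hM.eq_sum_coordFrame h hu]
    simp [map_sum, hw]
  -- N = ∑ ∂_j(J wʲ) is J times the Laplacian of the position vector. Its tangential part vanishes:
  -- Jacobi's formula for ∂_l J cancels the terms from `hdual`. Its normal part is J times the mean
  -- curvature vector, computed in `hmean`.
  set N := ∑ j, (fderiv ℝ (volDensity φ) u (f j) • dualFrame (w u) j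
      + J • fderiv ℝ (fun u => dualFrame (w u) j) u (f j)) with hN
  have hNw : ∀ l, inner ℝ N (w u l) = 0 := by
    intro l
    simp only [hN, sum_inner, inner_add_left, real_inner_smul_left, hdual,
      inner_dualFrame hli, Finset.sum_add_distrib]
    have := fderiv_volDensity h hu l
    simp only [mul_ite, mul_one, mul_zero, Finset.sum_ite_eq', Finset.mem_univ, if_true]
    rw [show fderiv ℝ (volDensity φ) u (f l) = _ from this, Finset.mul_sum,
      ← Finset.sum_add_distrib]
    exact Finset.sum_eq_zero fun j _ => by simp [hJ, hw, hf]
  have hPN : Pr (φ u) N = 0 := by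
    rw [hM.eq_sum_coordFrame h hu]
    refine Finset.sum_eq_zero fun j _ => ?_
    have : inner ℝ (dualFrame (coordFrame φ u) j) N = 0 := by
      rw [dualFrame, sum_inner]
      refine Finset.sum_eq_zero fun k _ => ?_
      rw [real_inner_smul_left, real_inner_comm, hNw, mul_zero]
    rw [this, zero_smul]
  have hN2 : N = Pr (φ u) N + J • ∑ j, fderiv ℝ Pr (φ u) (w u j) (dualFrame (w u) j) := by
    rw [hN, map_sum, Finset.smul_sum, ← Finset.sum_add_distrib]
    refine Finset.sum_congr rfl fun j _ => ?_
    rw [map_add, map_smul, map_smul]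
    have h1 : Pr (φ u) (dualFrame (w u) j) = dualFrame (w u) j :=
      hM.apply_eq_self hx (h.tangentSpaceAt_eq_span hu ▸ dualFrame_mem_span _ _)
    rw [h1, add_assoc, ← smul_add]
    congr 2
    rw [add_comm]
    exact hproj j
  rw [hN2, hPN, hmean, zero_add, smul_smul]
  congr 1
  ring

/-- This is the divergence theorem in coordinates: the left side is a flat divergence, which
integrates to zero under compact support, and for y = W ∘ φ the right side is J (div_M W - d ⟨x,
W⟩). -/
theorem IsMinimalInSphere.sum_fderiv_eq (hM : IsMinimalInSphere d M Pr)
    (h : IsLocalParametrization d M U φ) {u : 𝔼 d} (hu : u ∈ U) {y : 𝔼 d → 𝔼 n}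
    (hy : DifferentiableAt ℝ y u) :
    ∑ j, fderiv ℝ (fun u => volDensity φ u * inner ℝ (dualFrame (coordFrame φ u) j) (y u)) u
        (EuclideanSpace.single j 1)
      = volDensity φ u * (∑ j, inner ℝ (dualFrame (coordFrame φ u) j)
          (fderiv ℝ y u (EuclideanSpace.single j 1)) - d * inner ℝ (φ u) (y u)) := by
  have hJ : HasFDerivAt (volDensity φ) (fderiv ℝ (volDensity φ) u) u :=
    ((h.contDiffOn_volDensity.contDiffAt (h.mem_nhds hu)).differentiableAt (by simp)).hasFDerivAt
  have hd' : ∀ j, HasFDerivAt (fun u => dualFrame (coordFrame φ u) j)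
      (fderiv ℝ (fun u => dualFrame (coordFrame φ u) j) u) u :=
    fun j => (((h.contDiffOn_dualFrame j).contDiffAt
      (h.mem_nhds hu)).differentiableAt (by simp)).hasFDerivAt
  have h1 : ∀ j, fderiv ℝ (fun u => volDensity φ u * inner ℝ (dualFrame (coordFrame φ u) j) (y u)) u
        (EuclideanSpace.single j 1)
      = inner ℝ (fderiv ℝ (volDensity φ) u (EuclideanSpace.single j 1) • dualFrame (coordFrame φ u) j
      + volDensity φ u • fderiv ℝ (fun u => dualFrame (coordFrame φ u) j) u
        (EuclideanSpace.single j 1)) (y u) + volDensity φ u * inner ℝ (dualFrame (coordFrame φ u) j)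
          (fderiv ℝ y u (EuclideanSpace.single j 1)) := by
    intro j
    have := hJ.fun_mul ((hd' j).inner ℝ hy.hasFDerivAt)
    rw [this.fderiv]
    simp [fderivInnerCLM_apply, inner_add_left, real_inner_smul_left]
    ring
  simp_rw [h1]
  rw [Finset.sum_add_distrib, ← sum_inner, hM.sum_fderiv_dualFrame h hu, real_inner_smul_left,
    ← Finset.mul_sum]
  ring

end Local

/-! ### Integration over a closed submanifold and the divergence theorem -/

section Integration

variable {n d k : ℕ} {M : Set (𝔼 n)} {U : Set (𝔼 d)} {φ : 𝔼 d → 𝔼 n} {Pr : 𝔼 n → 𝔼 n →L[ℝ] 𝔼 n}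

theorem IsClosedSubmanifold.measurableSet (hM : IsClosedSubmanifold d M) : MeasurableSet M :=
  hM.isCompact.isClosed.measurableSet

theorem IsClosedSubmanifold.continuousOn (hM : IsClosedSubmanifold d M) {X : Type*}
    [TopologicalSpace X] {f : 𝔼 n → X}
    (hf : ∀ U φ, IsLocalParametrization d M U φ → ContinuousOn (f ∘ φ) U) : ContinuousOn f M := by
  intro x hx
  obtain ⟨U, φ, h, u, hu, rfl⟩ := hM.exists_parametrization x hx
  rw [ContinuousWithinAt, ← h.map_nhds hu, tendsto_map'_iff]
  exact (hf U φ h).continuousAt (h.mem_nhds hu)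

theorem IsClosedSubmanifold.isFiniteMeasure (hM : IsClosedSubmanifold d M) :
    IsFiniteMeasure (riemannianVolume d M) := by
  have h1 : riemannianVolume d M M < ⊤ := by
    refine hM.isCompact.measure_lt_top_of_nhdsWithin fun x hx => ?_
    obtain ⟨U, φ, h, u, hu, rfl⟩ := hM.exists_parametrization x hx
    obtain ⟨O, hO, hUO⟩ := h.image_eq
    obtain ⟨r, hr, hrU⟩ := Metric.nhds_basis_closedBall.mem_iff.1 (h.mem_nhds hu)
    have hK := isCompact_closedBall u r
    have hcomp : IsCompact (φ '' Metric.closedBall u r) :=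
      hK.image_of_continuousOn (h.contDiffOn.continuousOn.mono hrU)
    refine ⟨φ '' Metric.closedBall u r, ?_, ?_⟩
    · rw [← h.map_nhds hu]
      exact image_mem_map (Metric.closedBall_mem_nhds u hr)
    · have hsub : φ '' Metric.closedBall u r ⊆ O :=
        (image_mono hrU).trans (hUO ▸ inter_subset_right)
      rw [← Measure.restrict_eq_self _ hsub, riemannianVolume_restrict h hO hUO,
        h.chartVolume_apply hcomp.measurableSet, inter_comm, h.injOn.preimage_image_inter hrU]
      have hint : IntegrableOn (volDensity φ) (Metric.closedBall u r) :=
        (h.contDiffOn_volDensity.continuousOn.mono hrU).integrableOn_compact hK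
      exact (hasFiniteIntegral_iff_ofReal (ae_of_all _ fun u => volDensity_nonneg φ u)).1 hint.2
  refine ⟨?_⟩
  rw [← union_compl_self M]
  refine (measure_union_le _ _).trans_lt ?_
  rw [riemannianVolume_compl hM.measurableSet, add_zero]
  exact h1

theorem IsClosedSubmanifold.integrable (hM : IsClosedSubmanifold d M) {f : 𝔼 n → ℝ}
    (hf : ContinuousOn f M) : Integrable f (riemannianVolume d M) := by
  have := hM.isFiniteMeasure
  rw [← riemannianVolume_restrict_self hM.measurableSet]
  exact hf.integrableOn_compact hM.isCompact

theorem IsClosedSubmanifold.ae_mem (hM : IsClosedSubmanifold d M) :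
    ∀ᵐ x ∂riemannianVolume d M, x ∈ M := by
  rw [ae_iff]
  exact riemannianVolume_compl hM.measurableSet

theorem IsClosedSubmanifold.integral_congr (hM : IsClosedSubmanifold d M) {f g : 𝔼 n → ℝ}
    (hfg : EqOn f g M) : ∫ x, f x ∂riemannianVolume d M = ∫ x, g x ∂riemannianVolume d M :=
  integral_congr_ae (by filter_upwards [hM.ae_mem] with x hx using hfg hx)

theorem IsClosedSubmanifold.integral_eq_chart (hM : IsClosedSubmanifold d M)
    (h : IsLocalParametrization d M U φ) {O : Set (𝔼 n)} (hO : IsOpen O) (hUO : φ '' U = M ∩ O)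
    {f : 𝔼 n → ℝ} (hf : ContinuousOn f M) (hf0 : ∀ x ∈ M, x ∉ O → f x = 0) :
    ∫ x, f x ∂riemannianVolume d M = ∫ u in U, volDensity φ u * f (φ u) := by
  have h1 : ∫ x, f x ∂riemannianVolume d M = ∫ x in O, f x ∂riemannianVolume d M := by
    symm
    apply setIntegral_eq_integral_of_ae_compl_eq_zero
    filter_upwards [hM.ae_mem] with x hx hxO using hf0 x hx hxO
  have hmeas : AEStronglyMeasurable f (chartVolume U φ) := by
    rw [← riemannianVolume_restrict h hO hUO]
    exact (hM.integrable hf).aestronglyMeasurable.restrict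
  have hJ : AEMeasurable (fun u => ENNReal.ofReal (volDensity φ u)) (volume.restrict U) :=
    (h.contDiffOn_volDensity.continuousOn.aemeasurable h.isOpen_source.measurableSet).ennreal_ofReal
  rw [h1, riemannianVolume_restrict h hO hUO, chartVolume, integral_map h.aemeasurable hmeas,
    integral_withDensity_eq_integral_toReal_smul₀ hJ (ae_of_all _ fun _ => ENNReal.ofReal_lt_top)]
  simp_rw [ENNReal.toReal_ofReal (volDensity_nonneg φ _), smul_eq_mul]

/-- The extension of `G` by zero is smooth with compact support, and integration by parts against
the constant 1 applies to it. -/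
theorem setIntegral_fderiv_eq_zero (hU : IsOpen U) {G : 𝔼 d → ℝ} (hG : ContDiffOn ℝ ∞ G U)
    {K : Set (𝔼 d)} (hK : IsCompact K) (hKU : K ⊆ U) (hG0 : ∀ u ∈ U, u ∉ K → G u = 0) (v : 𝔼 d) :
    IntegrableOn (fun u => fderiv ℝ G u v) U ∧ ∫ u in U, fderiv ℝ G u v = 0 := by
  classical
  let H : 𝔼 d → ℝ := U.indicator G
  have hHU : ∀ u ∈ U, H =ᶠ[𝓝 u] G := fun u hu => by
    filter_upwards [hU.mem_nhds hu] with x hx using indicator_of_mem hx _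
  have hHK : ∀ u ∉ K, H u = 0 := fun u hu => by
    by_cases huU : u ∈ U
    · rw [show H u = G u from indicator_of_mem huU _, hG0 u huU hu]
    · exact indicator_of_notMem huU _
  have hH : ContDiff ℝ ∞ H := by
    rw [contDiff_iff_contDiffAt]
    intro u
    by_cases huU : u ∈ U
    · exact (hG.contDiffAt (hU.mem_nhds huU)).congr_of_eventuallyEq (hHU u huU)
    · have : H =ᶠ[𝓝 u] fun _ => 0 := by
        filter_upwards [hK.isClosed.isOpen_compl.mem_nhds fun h => huU (hKU h)] with x hx
          using hHK x hx
      exact contDiffAt_const.congr_of_eventuallyEq this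
  have hcs : HasCompactSupport H := HasCompactSupport.intro hK fun u hu => hHK u hu
  have hd : Continuous fun u => fderiv ℝ H u v :=
    (hH.continuous_fderiv (by simp)).clm_apply continuous_const
  have hdi : Integrable fun u => fderiv ℝ H u v :=
    hd.integrable_of_hasCompactSupport (hcs.fderiv_apply (𝕜 := ℝ) v)
  have hi : Integrable H := hH.continuous.integrable_of_hasCompactSupport hcs
  have hzero : ∫ u, fderiv ℝ H u v = 0 := by
    have := integral_mul_fderiv_eq_neg_fderiv_mul_of_integrable (μ := volume) (f := fun _ : 𝔼 d => (1 : ℝ))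
      (g := H) (v := v) (by simp) (by simpa using hdi) (by simpa using hi)
      (by fun_prop) (fun x _ => hH.differentiable (by simp) x)
    simpa using this
  have heq : EqOn (fun u => fderiv ℝ G u v) (fun u => fderiv ℝ H u v) U := fun u hu => by
    simp only [(hHU u hu).fderiv_eq]
  refine ⟨hdi.integrableOn.congr_fun heq.symm hU.measurableSet, ?_⟩
  rw [setIntegral_congr_fun hU.measurableSet heq, ← hzero]
  apply setIntegral_eq_integral_of_forall_compl_eq_zero
  intro u hu
  have h2 : H =ᶠ[𝓝 u] fun _ => 0 := by
    filter_upwards [hK.isClosed.isOpen_compl.mem_nhds fun h => hu (hKU h)] with x hx using hHK x hx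
  simp [h2.fderiv_eq]

theorem IsClosedSubmanifold.continuousOn_tangentialDiv (hM : IsClosedSubmanifold d M)
    {W : 𝔼 n → 𝔼 n} (hW : ContDiffOn ℝ ∞ W M) : ContinuousOn (tangentialDiv M W) M := by
  refine hM.continuousOn fun U φ h => ?_
  have h1 : ContinuousOn (fun u => ∑ j, (inner ℝ (dualFrame (coordFrame φ u) j)
      (fderiv ℝ (W ∘ φ) u (EuclideanSpace.single j 1)) : ℝ)) U := by
    refine continuousOn_finsetSum _ fun j _ => ContinuousOn.inner
      (h.contDiffOn_dualFrame j).continuousOn (ContinuousOn.clm_apply ?_ continuousOn_const)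
    exact (h.contDiffOn_comp hW).continuousOn_fderiv_of_isOpen h.isOpen_source (by simp)
  exact h1.congr fun u hu => h.tangentialDiv_eq hu (hW.differentiableWithinAt' (h.mapsTo hu))

theorem IsClosedSubmanifold.integral_tangentialDiv_of_chart (hM : IsClosedSubmanifold d M)
    (hmin : IsMinimalInSphere d M Pr)
    (h : IsLocalParametrization d M U φ) {O : Set (𝔼 n)} (hO : IsOpen O) (hUO : φ '' U = M ∩ O)
    {W : 𝔼 n → 𝔼 n} (hW : ContDiffOn ℝ ∞ W M) {C : Set (𝔼 n)} (hC : IsClosed C) (hCO : C ⊆ O)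
    (hW0 : ∀ x ∈ M, x ∉ C → W x = 0) :
    ∫ x, (tangentialDiv M W x - d * inner ℝ x (W x)) ∂riemannianVolume d M = 0 := by
  have hcont : ContinuousOn (fun x => tangentialDiv M W x - d * inner ℝ x (W x)) M :=
    (hM.continuousOn_tangentialDiv hW).sub
      (continuousOn_const.mul (continuousOn_id.inner hW.continuousOn))
  have hzero : ∀ x ∈ M, x ∉ O → tangentialDiv M W x - d * inner ℝ x (W x) = 0 := by
    intro x hx hxO
    have hxC : x ∉ C := fun h => hxO (hCO h)
    have h2 : fderivWithin ℝ W M x = fderivWithin ℝ (fun _ => 0) M x := by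
      apply Filter.EventuallyEq.fderivWithin_eq _ (hW0 x hx hxC)
      filter_upwards [mem_nhdsWithin_of_mem_nhds (hC.isOpen_compl.mem_nhds hxC),
        self_mem_nhdsWithin] with y hy hyM using hW0 y hyM hy
    simp [tangentialDiv, h2, hW0 x hx hxC]
  rw [hM.integral_eq_chart h hO hUO hcont hzero]
  -- M ∩ C is compact and lies in the image of the embedding `φ`, so its preimage is compact. This
  -- is why the support must lie in a closed set `C` inside `O`.
  have hK : IsCompact (U ∩ φ ⁻¹' C) := by
    have h1 : IsCompact (M ∩ C) := hM.isCompact.inter_right hC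
    have h2 : (U ∩ φ ⁻¹' C) = Subtype.val '' ((U.domRestrict φ) ⁻¹' (M ∩ C)) := by
      ext u
      simp only [mem_inter_iff, mem_preimage, mem_image, domRestrict_apply, Subtype.exists, exists_and_right,
        exists_eq_right]
      exact ⟨fun ⟨h3, h4⟩ => ⟨⟨h3, h.mapsTo h3⟩, h4⟩, fun ⟨⟨h3, _⟩, h4⟩ => ⟨h3, h4⟩⟩
    rw [h2]
    refine IsCompact.image ?_ continuous_subtype_val
    rw [h.isEmbedding.isInducing.isCompact_iff, image_preimage_eq_of_subset]
    · exact h1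
    · rw [range_domRestrict, hUO]
      exact inter_subset_inter_right _ hCO
  have hWφ := h.contDiffOn_comp hW
  have hG : ∀ j, ContDiffOn ℝ ∞ (fun u => volDensity φ u *
      inner ℝ (dualFrame (coordFrame φ u) j) ((W ∘ φ) u)) U := fun j =>
    h.contDiffOn_volDensity.mul ((h.contDiffOn_dualFrame j).inner ℝ hWφ)
  have hG0 : ∀ j, ∀ u ∈ U, u ∉ U ∩ φ ⁻¹' C → volDensity φ u *
      inner ℝ (dualFrame (coordFrame φ u) j) ((W ∘ φ) u) = 0 := by
    intro j u hu huK
    rw [Function.comp_apply, hW0 _ (h.mapsTo hu) fun hC => huK ⟨hu, hC⟩, inner_zero_right, mul_zero]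
  have hint := fun j => setIntegral_fderiv_eq_zero h.isOpen_source (hG j) hK inter_subset_left
    (hG0 j) (EuclideanSpace.single j 1)
  have hpt : EqOn (fun u => volDensity φ u * (tangentialDiv M W (φ u) - d * inner ℝ (φ u) (W (φ u))))
      (fun u => ∑ j, fderiv ℝ (fun u => volDensity φ u *
        inner ℝ (dualFrame (coordFrame φ u) j) ((W ∘ φ) u)) u (EuclideanSpace.single j 1)) U := by
    intro u hu
    simp only
    rw [hmin.sum_fderiv_eq h hu ((hWφ.contDiffAt (h.mem_nhds hu)).differentiableAt (by simp)),
      h.tangentialDiv_eq hu (hW.differentiableWithinAt' (h.mapsTo hu))]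
    rfl
  rw [setIntegral_congr_fun h.isOpen_source.measurableSet hpt,
    integral_finsetSum _ fun j _ => (hint j).1]
  exact Finset.sum_eq_zero fun j _ => (hint j).2

theorem tangentialDiv_sum {ι : Type*} (s : Finset ι) {W : ι → 𝔼 n → 𝔼 n} {x : 𝔼 n}
    (hW : ∀ i ∈ s, DifferentiableWithinAt ℝ (W i) M x) {V : 𝔼 n → 𝔼 n} (hx : x ∈ M)
    (hV : EqOn V (fun y => ∑ i ∈ s, W i y) M) :
    tangentialDiv M V x = ∑ i ∈ s, tangentialDiv M (W i) x := by
  have h1 : HasFDerivWithinAt V (∑ i ∈ s, fderivWithin ℝ (W i) M x) M x :=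
    (HasFDerivWithinAt.fun_sum fun i hi => (hW i hi).hasFDerivWithinAt).congr hV (hV hx)
  simp only [tangentialDiv]
  rw [Finset.sum_comm]
  refine Finset.sum_congr rfl fun e _ => ?_
  rw [← inner_sum]
  congr 1
  rw [h1.differentiableWithinAt.hasFDerivWithinAt.eqOn_tangentSpaceAt h1
    (stdOrthonormalBasis ℝ (tangentSpaceAt M x) e).2]
  simp

/-- **Divergence theorem** on a closed minimal submanifold of the unit sphere, for vector fields
which need not be tangent. -/
theorem IsClosedSubmanifold.integral_tangentialDiv (hM : IsClosedSubmanifold d M)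
    (hmin : IsMinimalInSphere d M Pr) {W : 𝔼 n → 𝔼 n} (hW : ContDiffOn ℝ ∞ W M) :
    ∫ x, tangentialDiv M W x ∂riemannianVolume d M
      = d * ∫ x, inner ℝ x (W x) ∂riemannianVolume d M := by
  choose! Uc φc hφc using hM.exists_parametrization
  have hO : ∀ x ∈ M, ∃ O : Set (𝔼 n), IsOpen O ∧ φc x '' Uc x = M ∩ O :=
    fun x hx => (hφc x hx).1.image_eq
  choose! Oc hOc hUOc using hO
  obtain ⟨t, ht⟩ := hM.isCompact.elim_nhds_subcover' (fun x hx => Oc x) (fun x hx =>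
    (hOc x hx).mem_nhds ((hUOc x hx) ▸ (hφc x hx).2 : x ∈ M ∩ Oc x).2)
  obtain ⟨ρ, hρ⟩ := SmoothPartitionOfUnity.exists_isSubordinate (modelWithCornersSelf ℝ (𝔼 n))
    hM.isCompact.isClosed (fun x : t => Oc (x : M)) (fun x => hOc _ (x : M).2)
    (fun x hx => by
      obtain ⟨i, hi, hxi⟩ := mem_iUnion₂.1 (ht hx)
      exact mem_iUnion.2 ⟨⟨i, hi⟩, hxi⟩)
  have hρs : ∀ i, ContDiff ℝ ∞ (ρ i) := fun i => (ρ i).contMDiff.contDiff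
  have hsum : ∀ x ∈ M, ∑ i, ρ i x = 1 := fun x hx => by
    rw [← finsum_eq_sum_of_fintype]
    exact ρ.sum_eq_one hx
  have hWi : ∀ i, ContDiffOn ℝ ∞ (fun x => ρ i x • W x) M := fun i => (hρs i).contDiffOn.smul hW
  have hi0 : ∀ i, ∫ x, (tangentialDiv M (fun x => ρ i x • W x) x
      - d * inner ℝ x (ρ i x • W x)) ∂riemannianVolume d M = 0 := by
    intro i
    refine hM.integral_tangentialDiv_of_chart hmin (hφc _ (i : M).2).1 (hOc _ (i : M).2)
      (hUOc _ (i : M).2) (hWi i) (isClosed_tsupport (ρ i)) (hρ i) fun x _ hx => ?_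
    rw [image_eq_zero_of_notMem_tsupport hx, zero_smul]
  have hWsum : EqOn W (fun x => ∑ i, ρ i x • W x) M := fun x hx => by
    simp only
    rw [← Finset.sum_smul, hsum x hx, one_smul]
  have hc1 : ∀ i, Integrable (fun x => tangentialDiv M (fun x => ρ i x • W x) x)
      (riemannianVolume d M) := fun i => hM.integrable (hM.continuousOn_tangentialDiv (hWi i))
  have hc2 : ∀ i, Integrable (fun x => d * inner ℝ x (ρ i x • W x) : 𝔼 n → ℝ)
      (riemannianVolume d M) := fun i => hM.integrable
        (continuousOn_const.mul (continuousOn_id.inner (hWi i).continuousOn))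
  have hL : ∫ x, tangentialDiv M W x ∂riemannianVolume d M
      = ∑ i, ∫ x, tangentialDiv M (fun x => ρ i x • W x) x ∂riemannianVolume d M := by
    rw [← integral_finsetSum _ fun i _ => hc1 i]
    exact hM.integral_congr fun x hx =>
      tangentialDiv_sum _ (fun i _ => (hWi i).differentiableWithinAt' hx) hx hWsum
  have hR : d * ∫ x, inner ℝ x (W x) ∂riemannianVolume d M
      = ∑ i, ∫ x, d * inner ℝ x (ρ i x • W x) ∂riemannianVolume d M := by
    rw [← integral_finsetSum _ fun i _ => hc2 i, ← integral_const_mul]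
    refine hM.integral_congr fun x hx => ?_
    rw [← Finset.mul_sum, ← inner_sum]
    congr 2
    exact hWsum hx
  rw [hL, hR]
  refine Finset.sum_congr rfl fun i _ => ?_
  have := hi0 i
  rw [integral_sub (hc1 i) (hc2 i)] at this
  linarith

end Integration

/-! ### Restrictions of linear maps to minimal submanifolds of spheres are harmonic -/

section Harmonic

variable {n d k e : ℕ} {M : Set (𝔼 n)} {N : Set (𝔼 k)} {U : Set (𝔼 d)} {φ : 𝔼 d → 𝔼 n}
  {Pr : 𝔼 n → 𝔼 n →L[ℝ] 𝔼 n}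

theorem normSqDifferential_nonneg (M : Set (𝔼 n)) (f : 𝔼 n → 𝔼 k) (x : 𝔼 n) :
    0 ≤ normSqDifferential M f x := Finset.sum_nonneg fun _ _ => sq_nonneg _

theorem IsLocalParametrization.fderivWithin_dualFrame (h : IsLocalParametrization d M U φ) {u : 𝔼 d}
    (hu : u ∈ U) {f : 𝔼 n → 𝔼 k} (hf : DifferentiableWithinAt ℝ f M (φ u)) (j : Fin d) :
    fderivWithin ℝ f M (φ u) (dualFrame (coordFrame φ u) j)
      = ∑ l, (Matrix.gram ℝ (coordFrame φ u))⁻¹ j l •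
        fderiv ℝ (f ∘ φ) u (EuclideanSpace.single l 1) := by
  rw [dualFrame, map_sum]
  refine Finset.sum_congr rfl fun l _ => ?_
  rw [map_smul, coordFrame, h.fderivWithin_apply hu hf]

theorem IsClosedSubmanifold.continuousOn_normSqDifferential (hM : IsClosedSubmanifold d M)
    {f : 𝔼 n → 𝔼 k} (hf : ContDiffOn ℝ ∞ f M) : ContinuousOn (normSqDifferential M f) M := by
  refine hM.continuousOn fun U φ h => ?_
  have hc : ∀ j : Fin d, ContinuousOn
      (fun u => fderiv ℝ (f ∘ φ) u (EuclideanSpace.single j 1)) U := fun j =>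
    ((h.contDiffOn_comp hf).continuousOn_fderiv_of_isOpen h.isOpen_source (by simp)).clm_apply
      continuousOn_const
  have hG : ∀ j l, ContinuousOn (fun u => (Matrix.gram ℝ (coordFrame φ u))⁻¹ j l) U := fun j l =>
    (ContDiffOn.matrix_inv (N := ∞)
      (fun i j => (h.contDiffOn_coordFrame i).inner ℝ (h.contDiffOn_coordFrame j))
      (fun u hu => (det_gram_pos (h.linearIndependent_coordFrame hu)).ne') j l).continuousOn
  have h1 : ContinuousOn (fun u => ∑ j, (inner ℝ (∑ l, (Matrix.gram ℝ (coordFrame φ u))⁻¹ j l •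
        fderiv ℝ (f ∘ φ) u (EuclideanSpace.single l 1))
      (fderiv ℝ (f ∘ φ) u (EuclideanSpace.single j 1)) : ℝ)) U :=
    continuousOn_finsetSum _ fun j _ => ContinuousOn.inner
      (continuousOn_finsetSum _ fun l _ => (hG j l).smul (hc l)) (hc j)
  refine h1.congr fun u hu => ?_
  have hd := hf.differentiableWithinAt' (h.mapsTo hu)
  simp only [Function.comp_apply]
  rw [h.normSqDifferential_eq hu hd]
  simp_rw [h.fderivWithin_dualFrame hu hd]

/-- Expand |Ae + (dg - A)e|² over an orthonormal tangent basis. Since ⟨Ae, (dg - A)e⟩ = ⟨e, Aᵀ(dg -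
A)e⟩ and `A` is constant, the cross term is the divergence of a vector field, in general not tangent
to `M`. -/
theorem normSqDifferential_eq_add (A : 𝔼 n →L[ℝ] 𝔼 k) {g : 𝔼 n → 𝔼 k} {x : 𝔼 n}
    (hg : DifferentiableWithinAt ℝ g M x) :
    normSqDifferential M g x = normSqDifferential M A x
      + 2 * tangentialDiv M (fun y => A.adjoint (g y - A y)) x
      + normSqDifferential M (fun y => g y - A y) x := by
  have hA : HasFDerivWithinAt A A M x := A.hasFDerivWithinAt
  have hD := hg.hasFDerivWithinAt.sub hA
  have hAD := (A.adjoint.hasFDerivAt (x := g x - A x)).comp_hasFDerivWithinAt x hD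
  simp only [normSqDifferential, tangentialDiv]
  rw [Finset.mul_sum, ← Finset.sum_add_distrib, ← Finset.sum_add_distrib]
  refine Finset.sum_congr rfl fun i _ => ?_
  have he := (stdOrthonormalBasis ℝ (tangentSpaceAt M x) i).2
  set e : 𝔼 n := (stdOrthonormalBasis ℝ (tangentSpaceAt M x) i : 𝔼 n)
  have h1 := hA.differentiableWithinAt.hasFDerivWithinAt.eqOn_tangentSpaceAt hA he
  have h2 := hD.differentiableWithinAt.hasFDerivWithinAt.eqOn_tangentSpaceAt hD he
  have h3 := hAD.differentiableWithinAt.hasFDerivWithinAt.eqOn_tangentSpaceAt hAD he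
  rw [h1, show fderivWithin ℝ (fun y => g y - A y) M x e = _ from h2,
    show fderivWithin ℝ (fun y => A.adjoint (g y - A y)) M x e = _ from h3]
  simp only [ContinuousLinearMap.comp_apply, sub_apply]
  rw [ContinuousLinearMap.adjoint_inner_right]
  have h4 : fderivWithin ℝ g M x e = A e + (fderivWithin ℝ g M x e - A e) := by abel
  nth_rewrite 1 [h4]
  rw [norm_add_sq_real]

/-- The term linear in g - A disappears: the divergence theorem makes it a multiple of ∫ ⟨Ax, g -
Ax⟩, and for unit vectors ⟨Ax, g - Ax⟩ = -½ |g - Ax|² is already quadratic. -/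
theorem IsClosedSubmanifold.energy_eq (hM : IsClosedSubmanifold d M)
    (hmin : IsMinimalInSphere d M Pr) (A : 𝔼 n →L[ℝ] 𝔼 k) {g : 𝔼 n → 𝔼 k}
    (hg : ContDiffOn ℝ ∞ g M) (hA1 : ∀ x ∈ M, ‖A x‖ = 1) (hg1 : ∀ x ∈ M, ‖g x‖ = 1) :
    energy d M g = energy d M A + 1 / 2 * ∫ x, (normSqDifferential M (fun y => g y - A y) x
      - d * ‖g x - A x‖ ^ 2) ∂riemannianVolume d M := by
  have hA : ContDiffOn ℝ ∞ A M := A.contDiff.contDiffOn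
  have hD : ContDiffOn ℝ ∞ (fun y => g y - A y) M := hg.sub hA
  have hAD : ContDiffOn ℝ ∞ (fun y => A.adjoint (g y - A y)) M := A.adjoint.contDiff.comp_contDiffOn hD
  have i1 := hM.integrable (hM.continuousOn_normSqDifferential hA)
  have i2 := hM.integrable (hM.continuousOn_tangentialDiv hAD)
  have i3 := hM.integrable (hM.continuousOn_normSqDifferential hD)
  have i4 : Integrable (fun x => (d : ℝ) * ‖g x - A x‖ ^ 2) (riemannianVolume d M) :=
    hM.integrable (continuousOn_const.mul (hD.continuousOn.norm.pow 2))
  have h1 := hM.integral_tangentialDiv hmin hAD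
  have h2 : ∫ x, inner ℝ x (A.adjoint (g x - A x)) ∂riemannianVolume d M
      = ∫ x, -(1 / 2) * ‖g x - A x‖ ^ 2 ∂riemannianVolume d M := by
    refine hM.integral_congr fun x hx => ?_
    rw [ContinuousLinearMap.adjoint_inner_right, inner_sub_right, real_inner_self_eq_norm_sq,
      norm_sub_sq_real, hA1 x hx, hg1 x hx, real_inner_comm]
    ring
  rw [h2, integral_const_mul] at h1
  have h3 : ∫ x, normSqDifferential M g x ∂riemannianVolume d M
      = ∫ x, (normSqDifferential M A x
      + 2 * tangentialDiv M (fun y => A.adjoint (g y - A y)) x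
      + normSqDifferential M (fun y => g y - A y) x) ∂riemannianVolume d M :=
    hM.integral_congr fun x hx => normSqDifferential_eq_add A (hg.differentiableWithinAt' hx)
  have i5 : Integrable (fun x => normSqDifferential M A x
      + 2 * tangentialDiv M (fun y => A.adjoint (g y - A y)) x) (riemannianVolume d M) :=
    i1.add (i2.const_mul 2)
  rw [energy, energy, h3, integral_add i5 i3, integral_add i1 (i2.const_mul 2),
    integral_const_mul, h1, integral_sub i3 i4, integral_const_mul]
  ring

/-- Along a smooth variation, the displacement and its tangential derivative are `O(s)`, locally
uniformly. -/
theorem IsLocalParametrization.exists_variation_bound (h : IsLocalParametrization d M U φ) {u₀ : 𝔼 d}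
    (hu₀ : u₀ ∈ U) {f : 𝔼 n → 𝔼 k} {ε : ℝ} {Φ : ℝ → 𝔼 n → 𝔼 k} (hΦ : IsSmoothVariation M N f ε Φ)
    (hf : ContDiffOn ℝ ∞ f M) :
    ∃ S ∈ 𝓝[M] (φ u₀), ∃ C δ : ℝ, 0 < δ ∧ ∀ s, |s| < δ → ∀ x ∈ S, x ∈ M →
      normSqDifferential M (fun y => Φ s y - f y) x ≤ C * s ^ 2 ∧
        ‖Φ s x - f x‖ ^ 2 ≤ C * s ^ 2 := by
  let Ψ : ℝ × 𝔼 d → 𝔼 k := fun q => Φ q.1 (φ q.2)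
  have hopen : IsOpen (Ioo (-ε) ε ×ˢ U) := isOpen_Ioo.prod h.isOpen_source
  have hΨ : ContDiffOn ℝ ∞ Ψ (Ioo (-ε) ε ×ˢ U) := by
    have h1 : ContDiffOn ℝ ∞ (fun q : ℝ × 𝔼 d => (q.1, φ q.2)) (Ioo (-ε) ε ×ˢ U) :=
      contDiffOn_fst.prodMk (h.contDiffOn.comp contDiffOn_snd fun q hq => hq.2)
    exact hΦ.contDiffOn.comp h1 fun q hq => ⟨hq.1, h.mapsTo hq.2⟩
  have h0ε : (0 : ℝ) ∈ Ioo (-ε) ε := ⟨neg_lt_zero.2 hΦ.pos, hΦ.pos⟩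
  have hat : ContDiffAt ℝ ∞ Ψ (0, u₀) := hΨ.contDiffAt (hopen.mem_nhds ⟨h0ε, hu₀⟩)
  -- Local Lipschitz bounds for Ψ and for DΨ, compared at (s, u) and (0, u), make the displacement
  -- and its derivative O(|s|). The function `a` controls the inverse metric that contracts the
  -- derivatives.
  obtain ⟨K₁, t₁, ht₁, hK₁⟩ := (hat.of_le (by simp : (1 : WithTop ℕ∞) ≤ ∞)).exists_lipschitzOnWith
  obtain ⟨K₂, t₂, ht₂, hK₂⟩ := (hat.fderiv_right (m := 1)
    (by exact WithTop.coe_le_coe.2 le_top)).exists_lipschitzOnWith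
  let a : 𝔼 d → ℝ := fun u => ∑ j, ∑ l, |(Matrix.gram ℝ (coordFrame φ u))⁻¹ j l|
  have hG : ∀ j l, ContinuousOn (fun u => (Matrix.gram ℝ (coordFrame φ u))⁻¹ j l) U := fun j l =>
    (ContDiffOn.matrix_inv (N := ∞)
      (fun i j => (h.contDiffOn_coordFrame i).inner ℝ (h.contDiffOn_coordFrame j))
      (fun u hu => (det_gram_pos (h.linearIndependent_coordFrame hu)).ne') j l).continuousOn
  have ha : ContinuousAt a u₀ := (continuousOn_finsetSum _ fun j _ => continuousOn_finsetSum _ fun l _ =>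
    (hG j l).abs).continuousAt (h.mem_nhds hu₀)
  obtain ⟨δ, hδ, hball⟩ := Metric.mem_nhds_iff.1
    (inter_mem (inter_mem ht₁ ht₂) (hopen.mem_nhds (⟨h0ε, hu₀⟩ : (0, u₀) ∈ Ioo (-ε) ε ×ˢ U)))
  have hlt : ∀ᶠ u in 𝓝 u₀, a u < a u₀ + 1 := ha.eventually_lt_const (lt_add_one _)
  refine ⟨φ '' (Metric.ball u₀ δ ∩ {u | a u < a u₀ + 1}), ?_, (a u₀ + 1) * K₂ ^ 2 + K₁ ^ 2, δ, hδ, ?_⟩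
  · rw [← h.map_nhds hu₀]
    exact image_mem_map (inter_mem (Metric.ball_mem_nhds u₀ hδ) hlt)
  rintro s hs _ ⟨u, ⟨hu, hau⟩, rfl⟩ -
  have hmem : ∀ r : ℝ, |r| < δ → (r, u) ∈ (t₁ ∩ t₂) ∩ (Ioo (-ε) ε ×ˢ U) := by
    intro r hr
    apply hball
    rw [← ball_prod_same]
    exact ⟨by simpa using hr, hu⟩
  have hs1 := hmem s hs
  have h01 := hmem 0 (by simpa using hδ)
  have huU : u ∈ U := h01.2.2
  have hdist : dist (s, u) ((0 : ℝ), u) = |s| := by simp [Prod.dist_eq]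
  have hf0 : ∀ v ∈ U, f (φ v) = Ψ (0, v) := fun v hv => (hΦ.eqOn_zero (h.mapsTo hv)).symm
  have hK1' : ‖Φ s (φ u) - f (φ u)‖ ≤ K₁ * |s| := by
    have := hK₁.dist_le_mul _ hs1.1.1 _ h01.1.1
    rw [hdist, dist_eq_norm] at this
    rwa [hf0 u huU]
  have hK2' : ‖fderiv ℝ Ψ (s, u) - fderiv ℝ Ψ (0, u)‖ ≤ K₂ * |s| := by
    have := hK₂.dist_le_mul _ hs1.1.2 _ h01.1.2
    rwa [hdist, dist_eq_norm] at this
  have hder : HasFDerivAt ((fun y => Φ s y - f y) ∘ φ)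
      ((fderiv ℝ Ψ (s, u) - fderiv ℝ Ψ (0, u)) ∘L ContinuousLinearMap.inr ℝ ℝ (𝔼 d)) u := by
    have hd : ∀ r : ℝ, (r, u) ∈ Ioo (-ε) ε ×ˢ U → HasFDerivAt (fun v => Ψ (r, v))
        (fderiv ℝ Ψ (r, u) ∘L ContinuousLinearMap.inr ℝ ℝ (𝔼 d)) u := fun r hr => by
      have h1 : HasFDerivAt Ψ (fderiv ℝ Ψ (r, u)) (r, u) :=
        ((hΨ.contDiffAt (hopen.mem_nhds hr)).differentiableAt (by simp)).hasFDerivAt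
      exact h1.comp u (hasFDerivAt_prodMk_right r u)
    have := (hd s hs1.2).sub (hd 0 h01.2)
    rw [ContinuousLinearMap.sub_comp]
    refine this.congr_of_eventuallyEq ?_
    filter_upwards [h.mem_nhds huU] with v hv
    simp [hf0 v hv, Ψ]
  have hpart : ∀ j : Fin d, ‖fderiv ℝ ((fun y => Φ s y - f y) ∘ φ) u (EuclideanSpace.single j 1)‖
      ≤ K₂ * |s| := by
    intro j
    rw [hder.fderiv]
    refine (ContinuousLinearMap.le_opNorm (fderiv ℝ Ψ (s, u) - fderiv ℝ Ψ (0, u)) _).trans ?_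
    refine (mul_le_mul hK2' (b := _) (d := 1) ?_ (norm_nonneg _) (by positivity)).trans (mul_one _).le
    simp [Prod.norm_def]
  have hs' : DifferentiableWithinAt ℝ (fun y => Φ s y - f y) M (φ u) := by
    have h1 : ContDiffOn ℝ ∞ (Φ s) M := hΦ.contDiffOn.comp
      (contDiffOn_const.prodMk contDiffOn_id) fun x hx => ⟨hs1.2.1, hx⟩
    exact (h1.sub hf).differentiableWithinAt' (h.mapsTo huU)
  have hK2s : 0 ≤ (K₂ : ℝ) ^ 2 * s ^ 2 := by positivity
  constructor
  · rw [h.normSqDifferential_eq huU hs']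
    have h1 : ∀ j, (inner ℝ (fderivWithin ℝ (fun y => Φ s y - f y) M (φ u)
        (dualFrame (coordFrame φ u) j))
        (fderiv ℝ ((fun y => Φ s y - f y) ∘ φ) u (EuclideanSpace.single j 1)) : ℝ)
        ≤ (∑ l, |(Matrix.gram ℝ (coordFrame φ u))⁻¹ j l|) * (K₂ ^ 2 * s ^ 2) := by
      intro j
      rw [h.fderivWithin_dualFrame huU hs', sum_inner, Finset.sum_mul]
      refine Finset.sum_le_sum fun l _ => ?_
      rw [real_inner_smul_left]
      refine (le_abs_self _).trans ?_
      rw [abs_mul]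
      refine mul_le_mul_of_nonneg_left ?_ (abs_nonneg _)
      refine (abs_real_inner_le_norm _ _).trans ((mul_le_mul (hpart l) (hpart j) (norm_nonneg _)
        (by positivity)).trans ?_)
      rw [← sq_abs s]
      apply le_of_eq
      ring
    refine (Finset.sum_le_sum fun j _ => h1 j).trans ?_
    rw [← Finset.sum_mul]
    have h2 : a u * ((K₂ : ℝ) ^ 2 * s ^ 2) ≤ (a u₀ + 1) * (K₂ ^ 2 * s ^ 2) :=
      mul_le_mul_of_nonneg_right (le_of_lt hau) hK2s
    have h3 : 0 ≤ (K₁ : ℝ) ^ 2 * s ^ 2 := by positivity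
    change a u * ((K₂ : ℝ) ^ 2 * s ^ 2) ≤ _
    linarith
  · have h1 : ‖Φ s (φ u) - f (φ u)‖ ^ 2 ≤ (K₁ * |s|) ^ 2 := by gcongr
    rw [mul_pow, sq_abs] at h1
    have h2 : 0 ≤ a u := Finset.sum_nonneg fun _ _ => Finset.sum_nonneg fun _ _ => abs_nonneg _
    have h3 : 0 ≤ (a u₀ + 1) * ((K₂ : ℝ) ^ 2 * s ^ 2) :=
      mul_nonneg (h2.trans (le_of_lt hau)) hK2s
    linarith

theorem IsClosedSubmanifold.exists_variation_bound (hM : IsClosedSubmanifold d M)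
    {f : 𝔼 n → 𝔼 k} {ε : ℝ} {Φ : ℝ → 𝔼 n → 𝔼 k} (hΦ : IsSmoothVariation M N f ε Φ)
    (hf : ContDiffOn ℝ ∞ f M) :
    ∃ C δ : ℝ, 0 < δ ∧ ∀ s, |s| < δ → ∀ x ∈ M,
      normSqDifferential M (fun y => Φ s y - f y) x ≤ C * s ^ 2 ∧
        ‖Φ s x - f x‖ ^ 2 ≤ C * s ^ 2 := by
  have key : ∃ C δ : ℝ, 0 < δ ∧ ∀ s, |s| < δ → ∀ x ∈ M, x ∈ M →
      normSqDifferential M (fun y => Φ s y - f y) x ≤ C * s ^ 2 ∧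
        ‖Φ s x - f x‖ ^ 2 ≤ C * s ^ 2 := by
    refine hM.isCompact.induction_on (p := fun S => ∃ C δ : ℝ, 0 < δ ∧ ∀ s, |s| < δ → ∀ x ∈ S, x ∈ M →
      normSqDifferential M (fun y => Φ s y - f y) x ≤ C * s ^ 2 ∧
        ‖Φ s x - f x‖ ^ 2 ≤ C * s ^ 2) ⟨0, 1, one_pos, by simp⟩ ?_ ?_ ?_
    · rintro S T hST ⟨C, δ, hδ, h⟩
      exact ⟨C, δ, hδ, fun s hs x hx => h s hs x (hST hx)⟩
    · rintro S T ⟨C, δ, hδ, h⟩ ⟨C', δ', hδ', h'⟩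
      refine ⟨max C C', min δ δ', lt_min hδ hδ', fun s hs x hx hxM => ?_⟩
      have h1 : C * s ^ 2 ≤ max C C' * s ^ 2 :=
        mul_le_mul_of_nonneg_right (le_max_left _ _) (sq_nonneg s)
      have h2 : C' * s ^ 2 ≤ max C C' * s ^ 2 :=
        mul_le_mul_of_nonneg_right (le_max_right _ _) (sq_nonneg s)
      rcases hx with hx | hx
      · have := h s (hs.trans_le (min_le_left _ _)) x hx hxM
        exact ⟨this.1.trans h1, this.2.trans h1⟩
      · have := h' s (hs.trans_le (min_le_right _ _)) x hx hxM
        exact ⟨this.1.trans h2, this.2.trans h2⟩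
    · intro x hx
      obtain ⟨U, φ, h, u, hu, rfl⟩ := hM.exists_parametrization x hx
      exact h.exists_variation_bound hu hΦ hf
  obtain ⟨C, δ, hδ, h⟩ := key
  exact ⟨C, δ, hδ, fun s hs x hx => h s hs x hx hx⟩

/-- The restriction of a linear map to a closed minimal submanifold of the unit sphere is a harmonic
map into every closed submanifold of a unit sphere which contains its image. -/
theorem IsMinimalInSphere.isHarmonicMap (hmin : IsMinimalInSphere d M Pr)
    (hM : IsClosedSubmanifold d M) (hN : IsClosedSubmanifold e N) (hN1 : ∀ y ∈ N, ‖y‖ = 1)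
    (A : 𝔼 n →L[ℝ] 𝔼 k) (hA : MapsTo A M N) : IsHarmonicMap d e M N A where
  domain := hM
  codomain := hN
  contDiffOn := A.contDiff.contDiffOn
  mapsTo := hA
  critical := by
    intro ε Φ hΦ
    have hAs : ContDiffOn ℝ ∞ A M := A.contDiff.contDiffOn
    obtain ⟨C, δ, hδ, hC⟩ := hM.exists_variation_bound hΦ hAs
    have := hM.isFiniteMeasure
    set V := (riemannianVolume d M).real univ
    -- The energy difference is exactly quadratic in the displacement: C s² comes from the gradient
    -- term and d C s² from the displacement term, integrated over total volume V.
    have hbound : ∀ s, |s| < min δ ε → |energy d M (Φ s) - energy d M A|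
        ≤ 1 / 2 * ((1 + d) * C * V) * s ^ 2 := by
      intro s hs
      have hsδ := hs.trans_le (min_le_left _ _)
      have hsε : s ∈ Ioo (-ε) ε := abs_lt.1 (hs.trans_le (min_le_right _ _))
      have h1 : ContDiffOn ℝ ∞ (Φ s) M := hΦ.contDiffOn.comp
        (contDiffOn_const.prodMk contDiffOn_id) fun x hx => ⟨hsε, hx⟩
      rw [hM.energy_eq hmin A h1 (fun x hx => hN1 _ (hA hx)) (fun x hx => hN1 _ (hΦ.mapsTo s hsε hx)),
        add_sub_cancel_left, abs_mul, abs_of_pos (by norm_num : (0 : ℝ) < 1 / 2), mul_assoc]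
      refine mul_le_mul_of_nonneg_left ?_ (by norm_num)
      have h2 := norm_integral_le_of_norm_le_const (μ := riemannianVolume d M)
        (f := fun x => normSqDifferential M (fun y => Φ s y - A y) x - d * ‖Φ s x - A x‖ ^ 2)
        (C := (1 + d) * (C * s ^ 2)) (by
          filter_upwards [hM.ae_mem] with x hx
          obtain ⟨h3, h4⟩ := hC s hsδ x hx
          have h5 := normSqDifferential_nonneg M (fun y => Φ s y - A y) x
          have h6 : (d : ℝ) * ‖Φ s x - A x‖ ^ 2 ≤ d * (C * s ^ 2) := by gcongr
          have h7 : 0 ≤ (d : ℝ) * ‖Φ s x - A x‖ ^ 2 := by positivity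
          rw [Real.norm_eq_abs, abs_le]
          constructor <;> linarith)
      rw [Real.norm_eq_abs] at h2
      refine h2.trans (le_of_eq ?_)
      ring
    have hmin0 : 0 < min δ ε := lt_min hδ hΦ.pos
    have h0 : energy d M (Φ 0) = energy d M A := by
      have := hbound 0 (by simpa using hmin0)
      simp at this
      linarith
    rw [hasDerivAt_iff_isLittleO]
    have hO : (fun s => energy d M (Φ s) - energy d M (Φ 0) - (s - 0) • (0 : ℝ))
        =O[𝓝 0] fun s : ℝ => s ^ 2 := by
      refine Asymptotics.IsBigO.of_bound (1 / 2 * ((1 + d) * C * V)) ?_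
      filter_upwards [Metric.ball_mem_nhds (0 : ℝ) hmin0] with s hs
      have := hbound s (by simpa using hs)
      simpa [h0] using this
    refine hO.trans_isLittleO ?_
    simpa using Asymptotics.isLittleO_pow_id (𝕜 := ℝ) one_lt_two

end Harmonic

/-! ### Construction of closed submanifolds -/

section Submanifolds

variable {n d : ℕ} {M : Set (𝔼 n)}

/-- A set which is locally the preimage of a linear subspace under a local diffeomorphism has a local
parametrization. -/
theorem exists_isLocalParametrization_of_straightening {x₀ : 𝔼 n} (hx₀ : x₀ ∈ M) {G : 𝔼 n → 𝔼 n}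
    {Ω : Set (𝔼 n)} (hΩ : IsOpen Ω) (hxΩ : x₀ ∈ Ω) (hG : ContDiffOn ℝ ∞ G Ω)
    (hG' : HasFDerivAt G (ContinuousLinearMap.id ℝ (𝔼 n)) x₀) {T : Submodule ℝ (𝔼 n)}
    (hT : Module.finrank ℝ T = d) (hMT : ∀ᶠ x in 𝓝 x₀, x ∈ M ↔ G x ∈ T) :
    ∃ U φ, IsLocalParametrization d M U φ ∧ x₀ ∈ φ '' U := by
  subst hT
  obtain ⟨O, hOsub, hO, hxO⟩ := _root_.mem_nhds_iff.1 hMT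
  -- Shrinking to the open set where DG is invertible makes the local inverse smooth on its whole
  -- domain, not merely at the image of `x₀`.
  let I := Set.range ((↑) : (𝔼 n ≃L[ℝ] 𝔼 n) → (𝔼 n →L[ℝ] 𝔼 n))
  have hIopen : IsOpen (Ω ∩ fderiv ℝ G ⁻¹' I) :=
    (hG.continuousOn_fderiv_of_isOpen hΩ (by simp)).isOpen_inter_preimage hΩ
      (ContinuousLinearEquiv.isOpen)
  have hxI : x₀ ∈ Ω ∩ fderiv ℝ G ⁻¹' I :=
    ⟨hxΩ, ContinuousLinearEquiv.refl ℝ (𝔼 n), by rw [hG'.fderiv]; rfl⟩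
  have hGat : ContDiffAt ℝ ∞ G x₀ := hG.contDiffAt (hΩ.mem_nhds hxΩ)
  have hG'' : HasFDerivAt G ((ContinuousLinearEquiv.refl ℝ (𝔼 n) : 𝔼 n ≃L[ℝ] 𝔼 n) :
    𝔼 n →L[ℝ] 𝔼 n) x₀ := hG'
  let e₀ := hGat.toOpenPartialHomeomorph G hG'' (by simp)
  let e := e₀.restrOpen ((Ω ∩ fderiv ℝ G ⁻¹' I) ∩ O) (hIopen.inter hO)
  have hecoe : ∀ x, e x = G x := fun x => rfl
  have hsrc : e.source = e₀.source ∩ ((Ω ∩ fderiv ℝ G ⁻¹' I) ∩ O) := rfl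
  have hxe : x₀ ∈ e.source :=
    ⟨hGat.mem_toOpenPartialHomeomorph_source hG'' (by simp), hxI, hxO⟩
  let ι : 𝔼 (Module.finrank ℝ T) →ₗᵢ[ℝ] 𝔼 n :=
    T.subtypeₗᵢ.comp (stdOrthonormalBasis ℝ T).repr.symm.toLinearIsometry
  have hιT : ∀ v, ι v ∈ T := fun v => ((stdOrthonormalBasis ℝ T).repr.symm v).2
  have hιsurj : ∀ y ∈ T, ∃ v, ι v = y := fun y hy =>
    ⟨(stdOrthonormalBasis ℝ T).repr ⟨y, hy⟩, by simp [ι]⟩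
  let U := ι ⁻¹' e.target
  have hU : IsOpen U := e.open_target.preimage ι.continuous
  let φ := e.symm ∘ ι
  have hφU : ∀ u ∈ U, φ u ∈ e.source := fun u hu => e.map_target hu
  have hGφ : ∀ u ∈ U, G (φ u) = ι u := fun u hu => e.right_inv hu
  have hφ : ContDiffOn ℝ ∞ φ U := by
    intro u hu
    have h1 := hφU u hu
    rw [hsrc] at h1
    obtain ⟨L, hL⟩ := h1.2.1.2
    have hd : HasFDerivAt G (L : 𝔼 n →L[ℝ] 𝔼 n) (φ u) := by
      rw [hL]
      exact ((hG.contDiffAt (hΩ.mem_nhds h1.2.1.1)).differentiableAt (by simp)).hasFDerivAt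
    have h2 : ContDiffAt ℝ ∞ e.symm (ι u) :=
      e.contDiffAt_symm hu hd (hG.contDiffAt (hΩ.mem_nhds h1.2.1.1))
    exact (h2.comp u ι.contDiff.contDiffAt).contDiffWithinAt
  refine ⟨U, φ, ⟨hU, hφ, ?_, ?_, ?_⟩, ?_⟩
  · intro u hu
    have h1 := hφU u hu
    rw [hsrc] at h1
    have hd : HasFDerivAt G (fderiv ℝ G (φ u)) (φ u) :=
      ((hG.contDiffAt (hΩ.mem_nhds h1.2.1.1)).differentiableAt (by simp)).hasFDerivAt
    have hd2 : HasFDerivAt φ (fderiv ℝ φ u) u :=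
      ((hφ.contDiffAt (hU.mem_nhds hu)).differentiableAt (by simp)).hasFDerivAt
    have h3 : HasFDerivAt (G ∘ φ) ι.toContinuousLinearMap u := by
      refine ι.toContinuousLinearMap.hasFDerivAt.congr_of_eventuallyEq ?_
      filter_upwards [hU.mem_nhds hu] with v hv using hGφ v hv
    have h4 := (hd.comp u hd2).unique h3
    intro v w hvw
    apply ι.injective
    have h5 := congrArg (fun A : 𝔼 (Module.finrank ℝ T) →L[ℝ] 𝔼 n => A v) h4
    have h6 := congrArg (fun A : 𝔼 (Module.finrank ℝ T) →L[ℝ] 𝔼 n => A w) h4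
    simp only [ContinuousLinearMap.comp_apply] at h5 h6
    rw [hvw] at h5
    exact h5.symm.trans h6
  · have h1 : IsEmbedding (e.symm.source.domRestrict e.symm) := e.symm.isOpenEmbedding_restrict.isEmbedding
    have h2 : MapsTo ι U e.symm.source := fun u hu => hu
    exact h1.comp (ι.isometry.isEmbedding.restrict h2)
  · refine ⟨e.source, e.open_source, ?_⟩
    ext x
    constructor
    · rintro ⟨u, hu, rfl⟩
      have h1 := hφU u hu
      refine ⟨?_, h1⟩
      rw [hsrc] at h1
      exact (hOsub h1.2.2 : φ u ∈ M ↔ G (φ u) ∈ T).2 (hGφ u hu ▸ hιT u)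
    · rintro ⟨hxM, hx⟩
      have h1 := hx
      rw [hsrc] at h1
      obtain ⟨v, hv⟩ := hιsurj _ ((hOsub h1.2.2 : x ∈ M ↔ G x ∈ T).1 hxM)
      have hvU : v ∈ U := by
        change ι v ∈ e.target
        rw [hv]
        exact e.map_source hx
      refine ⟨v, hvU, ?_⟩
      change e.symm (ι v) = x
      rw [hv]
      exact e.left_inv hx
  · obtain ⟨v, hv⟩ := hιsurj _ ((hOsub hxO : x₀ ∈ M ↔ G x₀ ∈ T).1 hx₀)
    refine ⟨v, ?_, ?_⟩
    · change ι v ∈ e.target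
      rw [hv]
      exact e.map_source hxe
    · change e.symm (ι v) = x₀
      rw [hv]
      exact e.left_inv hxe

/-- **Regular level sets** are closed submanifolds. -/
theorem isClosedSubmanifold_of_levelSet {F : Type*} [NormedAddCommGroup F] [NormedSpace ℝ F]
    [FiniteDimensional ℝ F] (hM : IsCompact M) {h : 𝔼 n → F} (hh : ContDiff ℝ ∞ h)
    (hMh : ∀ x, x ∈ M ↔ h x = 0) (hsurj : ∀ x ∈ M, Function.Surjective (fderiv ℝ h x))
    (hd : d + Module.finrank ℝ F = n) : IsClosedSubmanifold d M := by
  refine ⟨hM, fun x₀ hx₀ => ?_⟩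
  set D := fderiv ℝ h x₀ with hD
  obtain ⟨B₀, hB₀⟩ := D.toLinearMap.exists_rightInverse_of_surjective
    (LinearMap.range_eq_top.2 (hsurj x₀ hx₀))
  let B : F →L[ℝ] 𝔼 n := LinearMap.toContinuousLinearMap B₀
  have hB : ∀ y, D (B y) = y := fun y => LinearMap.congr_fun hB₀ y
  -- With B a right inverse of D, the terms -BD and +BD cancel in the derivative of G at `x₀`, and
  -- D(G x) = h x, so G straightens the level set to ker D.
  refine exists_isLocalParametrization_of_straightening hx₀ (Ω := univ) isOpen_univ (mem_univ _)
    (G := fun x => x - B (D x) + B (h x)) (T := LinearMap.ker D.toLinearMap) ?_ ?_ ?_ ?_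
  · exact ((contDiff_id.sub (B.contDiff.comp D.contDiff)).add (B.contDiff.comp hh)).contDiffOn
  · have h1 : HasFDerivAt h D x₀ := (hh.differentiable (by simp) x₀).hasFDerivAt
    have h2 := ((hasFDerivAt_id x₀).sub (B.hasFDerivAt.comp x₀ D.hasFDerivAt)).add
      (B.hasFDerivAt.comp x₀ h1)
    rw [sub_add_cancel] at h2
    exact h2
  · have h1 := D.toLinearMap.finrank_range_add_finrank_ker
    rw [LinearMap.range_eq_top.2 (hsurj x₀ hx₀), finrank_top, finrank_euclideanSpace_fin] at h1
    omega
  · refine Eventually.of_forall fun x => ?_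
    rw [hMh, LinearMap.mem_ker]
    change h x = 0 ↔ D (x - B (D x) + B (h x)) = 0
    rw [map_add, map_sub, hB, hB, sub_self, zero_add]

/-- The image of a **smooth retraction** is a closed submanifold. -/
theorem isClosedSubmanifold_of_retraction (hM : IsCompact M) {Ω : Set (𝔼 n)} (hΩ : IsOpen Ω)
    (hMΩ : M ⊆ Ω) {r : 𝔼 n → 𝔼 n} (hr : ContDiffOn ℝ ∞ r Ω) (hrM : MapsTo r Ω M)
    (hrid : ∀ x ∈ M, r x = x)
    (hd : ∀ x ∈ M, LinearMap.trace ℝ (𝔼 n) (fderiv ℝ r x).toLinearMap = d) :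
    (∀ x ∈ M, ∀ v, fderiv ℝ r x (fderiv ℝ r x v) = fderiv ℝ r x v) ∧ IsClosedSubmanifold d M := by
  have hder : ∀ x ∈ M, HasFDerivAt r (fderiv ℝ r x) x := fun x hx =>
    ((hr.contDiffAt (hΩ.mem_nhds (hMΩ hx))).differentiableAt (by simp)).hasFDerivAt
  have hidem : ∀ x ∈ M, ∀ v, fderiv ℝ r x (fderiv ℝ r x v) = fderiv ℝ r x v := by
    intro x hx v
    have h1 : HasFDerivAt (r ∘ r) (fderiv ℝ r x ∘L fderiv ℝ r x) x := by
      refine HasFDerivAt.comp x ?_ (hder x hx)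
      rw [hrid x hx]
      exact hder x hx
    have h2 : r ∘ r =ᶠ[𝓝 x] r := by
      filter_upwards [hΩ.mem_nhds (hMΩ hx)] with y hy using hrid _ (hrM hy)
    exact congrArg (fun A : 𝔼 n →L[ℝ] 𝔼 n => A v) (h1.unique ((hder x hx).congr_of_eventuallyEq h2))
  refine ⟨hidem, hM, fun x₀ hx₀ => ?_⟩
  set D := fderiv ℝ r x₀ with hD
  have hDD : ∀ v, D (D v) = D v := hidem x₀ hx₀
  -- G = D r + (1 - D)(x - r) has derivative D² + (1 - D)² = 1 at `x₀`. On M it equals Dx.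
  -- Conversely, if G x is in the range of D, then the second summand vanishes, G x = G (r x), and
  -- local injectivity gives x = r x ∈ M.
  let G : 𝔼 n → 𝔼 n := fun x => D (r x) + ((x - r x) - D (x - r x))
  have hG : ContDiffOn ℝ ∞ G Ω := (D.contDiff.comp_contDiffOn hr).add
    ((contDiffOn_id.sub hr).sub (D.contDiff.comp_contDiffOn (contDiffOn_id.sub hr)))
  have hG' : HasFDerivAt G (ContinuousLinearMap.id ℝ (𝔼 n)) x₀ := by
    have h1 := hder x₀ hx₀
    have h2 := (hasFDerivAt_id x₀).sub h1
    have h3 := (D.hasFDerivAt.comp x₀ h1).add (h2.sub (D.hasFDerivAt.comp x₀ h2))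
    refine h3.congr_fderiv ?_
    ext1 v
    change D (D v) + ((v - D v) - D (v - D v)) = v
    rw [map_sub, hDD]
    abel
  have hinj : ∃ S ∈ 𝓝 x₀, InjOn G S := by
    have hGat : ContDiffAt ℝ ∞ G x₀ := hG.contDiffAt (hΩ.mem_nhds (hMΩ hx₀))
    have hG'' : HasFDerivAt G ((ContinuousLinearEquiv.refl ℝ (𝔼 n) : 𝔼 n ≃L[ℝ] 𝔼 n) :
      𝔼 n →L[ℝ] 𝔼 n) x₀ := hG'
    let e := hGat.toOpenPartialHomeomorph G hG'' (by simp)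
    exact ⟨e.source, e.open_source.mem_nhds (hGat.mem_toOpenPartialHomeomorph_source hG'' (by simp)),
      e.injOn⟩
  obtain ⟨S, hS, hSinj⟩ := hinj
  refine exists_isLocalParametrization_of_straightening hx₀ hΩ (hMΩ hx₀) hG hG'
    (T := LinearMap.range D.toLinearMap) ?_ ?_
  · have h1 : IsIdempotentElem D.toLinearMap := LinearMap.ext fun y => hDD y
    have h2 := (LinearMap.IsIdempotentElem.isProj_range _ h1).trace
    rw [hd x₀ hx₀] at h2
    exact_mod_cast h2.symm
  · have hrS : ∀ᶠ x in 𝓝 x₀, r x ∈ S :=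
      (hder x₀ hx₀).continuousAt.eventually (by rw [hrid x₀ hx₀]; exact hS)
    filter_upwards [hS, hrS, hΩ.mem_nhds (hMΩ hx₀)] with x hxS hrxS hxΩ
    constructor
    · intro hx
      refine ⟨x, ?_⟩
      change D x = D (r x) + ((x - r x) - D (x - r x))
      rw [hrid x hx, sub_self, map_zero, sub_zero, add_zero]
    · rintro ⟨y, hy⟩
      have hy' : D y = D (r x) + ((x - r x) - D (x - r x)) := hy
      have h1 := congrArg D hy'
      simp only [map_add, map_sub, hDD, sub_self, add_zero] at h1
      have h2 : G x = D (r x) := by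
        change D (r x) + ((x - r x) - D (x - r x)) = D (r x)
        rw [← hy', h1]
      have h3 : G (r x) = D (r x) := by
        change D (r (r x)) + ((r x - r (r x)) - D (r x - r (r x))) = D (r x)
        rw [hrid _ (hrM hxΩ), sub_self, map_zero, sub_zero, add_zero]
      rw [hSinj hxS hrxS (h2.trans h3.symm)]
      exact hrM hxΩ

end Submanifolds

/-! ### Clifford systems as families of symmetric operators -/

/-- A family of anticommuting symmetric involutions. -/
structure IsCliffordFamily {n k : ℕ} (S : Fin k → 𝔼 n →L[ℝ] 𝔼 n) : Prop where
  symm : ∀ a x y, inner ℝ (S a x) y = inner ℝ x (S a y)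
  invol : ∀ a x, S a (S a x) = x
  anti : ∀ a b, a ≠ b → ∀ x, S a (S b x) = -S b (S a x)

/-- The operator on `ℝⁿ` given by a matrix. -/
noncomputable def matrixOp {n : ℕ} (A : Matrix (Fin n) (Fin n) ℝ) : 𝔼 n →L[ℝ] 𝔼 n :=
  LinearMap.toContinuousLinearMap A.toEuclideanLin

section MatrixOp

variable {n k : ℕ}

theorem matrixOp_apply (A : Matrix (Fin n) (Fin n) ℝ) (x : 𝔼 n) :
    matrixOp A x = A.toEuclideanLin x := rfl

theorem matrixOp_mul (A B : Matrix (Fin n) (Fin n) ℝ) (x : 𝔼 n) :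
    matrixOp (A * B) x = matrixOp A (matrixOp B x) := by
  simp [matrixOp_apply, Matrix.toLpLin_apply, Matrix.mulVec_mulVec]

theorem matrixOp_add (A B : Matrix (Fin n) (Fin n) ℝ) (x : 𝔼 n) :
    matrixOp (A + B) x = matrixOp A x + matrixOp B x := by
  simp [matrixOp_apply]

theorem matrixOp_smul (c : ℝ) (A : Matrix (Fin n) (Fin n) ℝ) (x : 𝔼 n) :
    matrixOp (c • A) x = c • matrixOp A x := by
  simp [matrixOp_apply]

theorem matrixOp_one (x : 𝔼 n) : matrixOp 1 x = x := by
  simp [matrixOp_apply]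

theorem matrixOp_sum {ι : Type*} (s : Finset ι) (A : ι → Matrix (Fin n) (Fin n) ℝ) (x : 𝔼 n) :
    matrixOp (∑ i ∈ s, A i) x = ∑ i ∈ s, matrixOp (A i) x := by
  simp [matrixOp_apply, map_sum]

theorem inner_matrixOp {A : Matrix (Fin n) (Fin n) ℝ} (hA : A.IsSymm) (x y : 𝔼 n) :
    inner ℝ (matrixOp A x) y = inner ℝ x (matrixOp A y) := by
  have h1 := Matrix.toEuclideanLin_conjTranspose_eq_adjoint A
  rw [Matrix.conjTranspose_eq_transpose_of_trivial, hA.eq] at h1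
  rw [matrixOp_apply, matrixOp_apply]
  nth_rewrite 2 [h1]
  rw [LinearMap.adjoint_inner_right]

theorem IsCliffordSystem.isCliffordFamily {P : Fin k → Matrix (Fin n) (Fin n) ℝ}
    (hP : IsCliffordSystem P) : IsCliffordFamily fun a => matrixOp (P a) where
  symm a := inner_matrixOp (hP.1 a)
  invol a x := by
    have h := congrArg (fun A => matrixOp A x) (hP.2 a a)
    simp only [matrixOp_mul, if_true, matrixOp_smul, matrixOp_one, ← two_smul ℝ] at h
    exact smul_right_injective _ (two_ne_zero : (2 : ℝ) ≠ 0) h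
  anti a b hab x := by
    have h := congrArg (fun A => matrixOp A x) (hP.2 a b)
    simp only [matrixOp_add, matrixOp_mul, if_neg hab, zero_smul] at h
    rw [show matrixOp (0 : Matrix (Fin n) (Fin n) ℝ) x = 0 by simp [matrixOp_apply]] at h
    exact eq_neg_of_add_eq_zero_left h

end MatrixOp

namespace IsCliffordFamily

variable {n k : ℕ} {S : Fin k → 𝔼 n →L[ℝ] 𝔼 n}

/-- The linear combination `∑ c_a S_a`. -/
noncomputable def comb (S : Fin k → 𝔼 n →L[ℝ] 𝔼 n) (c : Fin k → ℝ) : 𝔼 n →L[ℝ] 𝔼 n :=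
  ∑ a, c a • S a

theorem comb_apply (S : Fin k → 𝔼 n →L[ℝ] 𝔼 n) (c : Fin k → ℝ) (x : 𝔼 n) :
    comb S c x = ∑ a, c a • S a x := by
  simp [comb]

/-- The quadratic forms `⟨S_a x, x⟩`. -/
noncomputable def form (S : Fin k → 𝔼 n →L[ℝ] 𝔼 n) (x : 𝔼 n) (a : Fin k) : ℝ :=
  inner ℝ (S a x) x

theorem inner_apply_apply (hS : IsCliffordFamily S) (x : 𝔼 n) (a b : Fin k) :
    inner ℝ (S a x) (S b x) = if a = b then ‖x‖ ^ 2 else 0 := by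
  split_ifs with hab
  · subst hab
    rw [hS.symm, hS.invol, real_inner_self_eq_norm_sq]
  · have h1 : inner ℝ (S a x) (S b x) = inner ℝ x (S a (S b x)) := hS.symm _ _ _
    have h2 : inner ℝ (S b x) (S a x) = inner ℝ x (S b (S a x)) := hS.symm _ _ _
    rw [hS.anti a b hab, inner_neg_right] at h1
    rw [real_inner_comm] at h2
    linarith

theorem norm_apply (hS : IsCliffordFamily S) (a : Fin k) (x : 𝔼 n) : ‖S a x‖ = ‖x‖ := by
  have h := hS.inner_apply_apply x a a
  rw [if_pos rfl, real_inner_self_eq_norm_sq] at h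
  exact (sq_eq_sq₀ (norm_nonneg _) (norm_nonneg _)).1 h

theorem symm_comb (hS : IsCliffordFamily S) (c : Fin k → ℝ) (x y : 𝔼 n) :
    inner ℝ (comb S c x) y = inner ℝ x (comb S c y) := by
  simp only [comb_apply, sum_inner, inner_sum, real_inner_smul_left, real_inner_smul_right, hS.symm]

theorem inner_comb (c : Fin k → ℝ) (x y : 𝔼 n) :
    inner ℝ (comb S c x) y = ∑ a, c a * inner ℝ (S a x) y := by
  simp only [comb_apply, sum_inner, real_inner_smul_left]

theorem comb_swap (hS : IsCliffordFamily S) (c : Fin k → ℝ) (a : Fin k) (x : 𝔼 n) :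
    comb S c (S a x) = -S a (comb S c x) + (2 * c a) • x := by
  have h1 : ∀ b, c b • S b (S a x) = -(c b • S a (S b x)) + if b = a then (2 * c a) • x else 0 := by
    intro b
    split_ifs with h
    · subst h
      rw [hS.invol]
      module
    · rw [hS.anti b a h]
      module
  rw [comb_apply, comb_apply, Finset.sum_congr rfl fun b _ => h1 b, Finset.sum_add_distrib,
    Finset.sum_neg_distrib, map_sum]
  simp

theorem comb_comb (hS : IsCliffordFamily S) (c : Fin k → ℝ) (x : 𝔼 n) :
    comb S c (comb S c x) = (∑ a, c a ^ 2) • x := by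
  have h1 : comb S c (comb S c x) = -comb S c (comb S c x) + (2 * ∑ a, c a ^ 2) • x := by
    nth_rewrite 2 [comb_apply]
    rw [map_sum, Finset.sum_congr rfl fun a _ => by rw [map_smul, hS.comb_swap, smul_add],
      Finset.sum_add_distrib]
    congr 1
    · nth_rewrite 2 [comb_apply]
      rw [← Finset.sum_neg_distrib]
      simp
    · rw [Finset.mul_sum, Finset.sum_smul]
      refine Finset.sum_congr rfl fun a _ => ?_
      rw [smul_smul]
      congr 1
      ring
  have h2 : (2 : ℝ) • comb S c (comb S c x) = (2 : ℝ) • ((∑ a, c a ^ 2) • x) := by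
    rw [smul_smul, two_smul]
    nth_rewrite 1 [h1]
    abel
  exact smul_right_injective _ (two_ne_zero : (2 : ℝ) ≠ 0) h2

theorem norm_sq_comb (hS : IsCliffordFamily S) (c : Fin k → ℝ) (x : 𝔼 n) :
    ‖comb S c x‖ ^ 2 = (∑ a, c a ^ 2) * ‖x‖ ^ 2 := by
  rw [← real_inner_self_eq_norm_sq, hS.symm_comb, hS.comb_comb, real_inner_smul_right,
    real_inner_self_eq_norm_sq]

theorem inner_comb_self (c : Fin k → ℝ) (x : 𝔼 n) :
    inner ℝ (comb S c x) x = ∑ a, c a * form S x a := inner_comb c x x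

theorem inner_apply_comb (hS : IsCliffordFamily S) (c : Fin k → ℝ) (x : 𝔼 n) (a : Fin k) :
    inner ℝ (S a x) (comb S c x) = c a * ‖x‖ ^ 2 := by
  rw [real_inner_comm, inner_comb, Finset.sum_congr rfl fun b _ => by rw [hS.inner_apply_apply]]
  simp

/-- With Q = ∑ ⟨S_a x, x⟩ S_a and g the sum in question, |Qx - x|² = g - 2g + 1 ≥ 0. The equality
case, next, says Qx = x; it drives every computation on M_-. -/
theorem sum_form_sq_le (hS : IsCliffordFamily S) {x : 𝔼 n} (hx : ‖x‖ = 1) :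
    ∑ a, form S x a ^ 2 ≤ 1 := by
  have h1 := norm_sub_sq_real (comb S (form S x) x) x
  rw [inner_comb_self, hS.norm_sq_comb, hx] at h1
  have h2 : ∑ a, form S x a * form S x a = ∑ a, form S x a ^ 2 :=
    Finset.sum_congr rfl fun a _ => (sq _).symm
  rw [h2] at h1
  have := sq_nonneg ‖comb S (form S x) x - x‖
  linarith

theorem comb_form_eq_self (hS : IsCliffordFamily S) {x : 𝔼 n} (hx : ‖x‖ = 1)
    (h : ∑ a, form S x a ^ 2 = 1) : comb S (form S x) x = x := by
  have h1 := norm_sub_sq_real (comb S (form S x) x) x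
  rw [inner_comb_self, hS.norm_sq_comb, hx, h] at h1
  have h2 : ∑ a, form S x a * form S x a = 1 := by
    rw [← h]
    exact Finset.sum_congr rfl fun a _ => (sq _).symm
  rw [h2] at h1
  have h3 : ‖comb S (form S x) x - x‖ = 0 := by
    rw [← sq_eq_zero_iff, h1]
    norm_num
  exact sub_eq_zero.1 (norm_eq_zero.1 h3)

theorem inner_apply_triple (hS : IsCliffordFamily S) (x : 𝔼 n) (a b : Fin k) :
    inner ℝ (S b x) (S a (S b x)) = if b = a then form S x a else -form S x a := by
  split_ifs with hab
  · subst hab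
    rw [hS.invol, form]
  · rw [hS.anti a b (Ne.symm hab), inner_neg_right, ← hS.symm, hS.invol, form, real_inner_comm]

theorem sum_inner_apply_triple (hS : IsCliffordFamily S) (x : 𝔼 n) (a : Fin k) :
    ∑ b, inner ℝ (S b x) (S a (S b x)) = (2 - k) * form S x a := by
  have h1 : ∀ b, inner ℝ (S b x) (S a (S b x))
      = -form S x a + if b = a then 2 * form S x a else 0 := fun b => by
    rw [hS.inner_apply_triple]
    split_ifs <;> ring
  simp only [h1, Finset.sum_add_distrib]
  simp
  ring

/-! ### Traces -/

theorem trace_eq_sum (T : 𝔼 n →L[ℝ] 𝔼 n) : LinearMap.trace ℝ (𝔼 n) T.toLinearMap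
    = ∑ i, inner ℝ (EuclideanSpace.single i (1 : ℝ)) (T (EuclideanSpace.single i 1)) := by
  rw [LinearMap.trace_eq_sum_inner _ (EuclideanSpace.basisFun (Fin n) ℝ)]
  simp only [EuclideanSpace.basisFun_apply]
  rfl

theorem sum_inner_single_smul (x : 𝔼 n) (T : 𝔼 n →L[ℝ] 𝔼 n) :
    ∑ i, inner ℝ x (EuclideanSpace.single i (1 : ℝ)) • T (EuclideanSpace.single i 1) = T x := by
  have := (EuclideanSpace.basisFun (Fin n) ℝ).sum_repr' x
  nth_rewrite 2 [← this]
  simp only [map_sum, map_smul, EuclideanSpace.basisFun_apply]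
  refine Finset.sum_congr rfl fun i _ => ?_
  rw [real_inner_comm]

theorem sum_inner_single_mul (x y : 𝔼 n) :
    ∑ i, inner ℝ x (EuclideanSpace.single i (1 : ℝ)) * inner ℝ (EuclideanSpace.single i (1 : ℝ)) y
      = inner ℝ x y := by
  simpa using (EuclideanSpace.basisFun (Fin n) ℝ).sum_inner_mul_inner x y

/-- The transpose of S_a S_b is S_b S_a = -S_a S_b. -/
theorem trace_mul (hS : IsCliffordFamily S) {a b : Fin k} (hab : a ≠ b) :
    ∑ i, inner ℝ (EuclideanSpace.single i (1 : ℝ)) (S a (S b (EuclideanSpace.single i 1)))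
      = 0 := by
  have h1 : ∑ i, inner ℝ (EuclideanSpace.single i (1 : ℝ)) (S a (S b (EuclideanSpace.single i 1)))
      = ∑ i, -inner ℝ (EuclideanSpace.single i (1 : ℝ)) (S a (S b (EuclideanSpace.single i 1))) := by
    refine Finset.sum_congr rfl fun i _ => ?_
    nth_rewrite 1 [← hS.symm]
    rw [← hS.symm, real_inner_comm, hS.anti b a hab.symm, inner_neg_right]
  rw [Finset.sum_neg_distrib] at h1
  linarith

/-- Conjugation by S_b preserves the trace and sends S_a to -S_a. A second generator is essential,
which is where m > 0 enters. -/
theorem trace_apply (hS : IsCliffordFamily S) {a b : Fin k} (hab : a ≠ b) :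
    ∑ i, inner ℝ (EuclideanSpace.single i (1 : ℝ)) (S a (EuclideanSpace.single i 1)) = 0 := by
  rw [← trace_eq_sum]
  have h1 : (S b).toLinearMap ∘ₗ ((S a).toLinearMap ∘ₗ (S b).toLinearMap) = -(S a).toLinearMap := by
    ext1 x
    change S b (S a (S b x)) = -S a x
    rw [hS.anti a b hab, map_neg, hS.invol]
  have h2 := congrArg (LinearMap.trace ℝ (𝔼 n)) h1
  have h3 : ((S a).toLinearMap ∘ₗ (S b).toLinearMap) ∘ₗ (S b).toLinearMap = (S a).toLinearMap := by
    ext1 x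
    exact congrArg (S a) (hS.invol b x)
  rw [LinearMap.trace_comp_comm', h3, map_neg] at h2
  linarith

theorem exists_ne_of_two_le (hk : 2 ≤ k) (a : Fin k) : ∃ b, a ≠ b := by
  have : Nontrivial (Fin k) := Fin.nontrivial_iff_two_le.2 hk
  obtain ⟨b, hb⟩ := exists_ne a
  exact ⟨b, hb.symm⟩

end IsCliffordFamily

/-! ### Level sets -/

section Level

open IsCliffordFamily

variable {n k : ℕ} {P : Fin k → Matrix (Fin n) (Fin n) ℝ} {c : ℝ}

theorem mem_fkmLevel {x : 𝔼 n} : x ∈ fkmLevel P c ↔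
    ‖x‖ = 1 ∧ ∑ a, form (fun a => matrixOp (P a)) x a ^ 2 = (1 - c) / 2 := by
  change ‖x‖ = 1 ∧ ‖x‖ ^ 4 - 2 * ∑ a, form (fun a => matrixOp (P a)) x a ^ 2 = c ↔ _
  refine and_congr_right fun hx => ?_
  rw [hx]
  constructor <;> intro h <;> linarith

theorem mem_focalPlus {x : 𝔼 n} : x ∈ focalPlus P ↔
    ‖x‖ = 1 ∧ ∀ a, form (fun a => matrixOp (P a)) x a = 0 := by
  rw [focalPlus, mem_fkmLevel, sub_self, zero_div, Finset.sum_eq_zero_iff_of_nonneg fun _ _ => sq_nonneg _]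
  simp

theorem mem_focalMinus {x : 𝔼 n} : x ∈ focalMinus P ↔
    ‖x‖ = 1 ∧ ∑ a, form (fun a => matrixOp (P a)) x a ^ 2 = 1 := by
  rw [focalMinus, mem_fkmLevel]
  norm_num

theorem isCompact_fkmLevel (P : Fin k → Matrix (Fin n) (Fin n) ℝ) (c : ℝ) :
    IsCompact (fkmLevel P c) := by
  have h1 : IsClosed {x : 𝔼 n | fkmPolynomial P x = c} := by
    refine isClosed_eq ?_ continuous_const
    refine (continuous_norm.pow 4).sub (continuous_const.mul (continuous_finsetSum _ fun a _ => ?_))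
    exact (Continuous.inner (matrixOp (P a)).continuous continuous_id).pow 2
  have h2 : fkmLevel P c = Metric.sphere (0 : 𝔼 n) 1 ∩ {x | fkmPolynomial P x = c} := by
    ext x
    simp [fkmLevel]
  rw [h2]
  exact (isCompact_sphere 0 1).inter_right h1

theorem hasFDerivAt_norm_sq_sub (x : 𝔼 n) :
    HasFDerivAt (fun y : 𝔼 n => inner ℝ y y - (1 : ℝ)) ((2 : ℝ) • innerSL ℝ x) x := by
  refine (((hasFDerivAt_id x).inner ℝ (hasFDerivAt_id x)).sub_const 1).congr_fderiv ?_
  ext v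
  simp [fderivInnerCLM_apply, real_inner_comm]
  ring

theorem IsCliffordFamily.hasFDerivAt_form {S : Fin k → 𝔼 n →L[ℝ] 𝔼 n} (hS : IsCliffordFamily S)
    (x : 𝔼 n) (a : Fin k) :
    HasFDerivAt (fun y : 𝔼 n => form S y a) ((2 : ℝ) • innerSL ℝ (S a x)) x := by
  refine ((S a).hasFDerivAt.inner ℝ (hasFDerivAt_id x)).congr_fderiv ?_
  ext v
  simp [fderivInnerCLM_apply, hS.symm]
  rw [real_inner_comm, hS.symm, real_inner_comm]
  ring

theorem contDiff_form (S : Fin k → 𝔼 n →L[ℝ] 𝔼 n) (a : Fin k) :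
    ContDiff ℝ ∞ (fun y : 𝔼 n => form S y a) := (S a).contDiff.inner ℝ contDiff_id

/-- F = 1 is a critical level on the sphere, so M_+ is cut out instead by |x|² = 1 and the k
equations ⟨P_a x, x⟩ = 0. Half their gradients, x and P_a x, are orthonormal on M_+, so the
equations are regular. -/
theorem isClosedSubmanifold_focalPlus (hP : IsCliffordSystem P) {d : ℕ} (hd : d + (1 + k) = n) :
    IsClosedSubmanifold d (focalPlus P) := by
  have hS := hP.isCliffordFamily
  set S := fun a => matrixOp (P a) with hSdef
  have hder : ∀ x, HasFDerivAt (fun y : 𝔼 n => (inner ℝ y y - (1 : ℝ), fun a => form S y a))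
      (((2 : ℝ) • innerSL ℝ x).prod (ContinuousLinearMap.pi fun a => (2 : ℝ) • innerSL ℝ (S a x))) x :=
    fun x => (hasFDerivAt_norm_sq_sub x).prodMk (hasFDerivAt_pi.2 fun a => hS.hasFDerivAt_form x a)
  refine isClosedSubmanifold_of_levelSet (F := ℝ × (Fin k → ℝ)) (isCompact_fkmLevel P 1)
    (h := fun y => (inner ℝ y y - 1, fun a => form S y a)) ?_ ?_ ?_ ?_
  · exact ((contDiff_id.inner ℝ contDiff_id).sub contDiff_const).prodMk
      (contDiff_pi.2 fun a => contDiff_form S a)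
  · intro x
    rw [mem_focalPlus, Prod.mk_eq_zero, funext_iff, real_inner_self_eq_norm_sq, sub_eq_zero,
      pow_eq_one_iff_of_nonneg (norm_nonneg x) two_ne_zero]
    rfl
  · intro x hx
    obtain ⟨hx1, hx0⟩ := mem_focalPlus.1 hx
    rw [(hder x).fderiv]
    rintro ⟨s, c⟩
    refine ⟨(1 / 2 : ℝ) • (s • x + comb S c x), ?_⟩
    have h1 : inner ℝ x (comb S c x) = 0 := by
      rw [real_inner_comm, inner_comb_self]
      exact Finset.sum_eq_zero fun a _ => by rw [hx0 a, mul_zero]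
    ext a
    · simp [inner_add_right, inner_smul_right, h1, hx1]
    · have h2 : inner ℝ (S a x) x = 0 := hx0 a
      simp [inner_add_right, inner_smul_right, hS.inner_apply_comb, hx1, h2]
  · simpa using hd

theorem isClosedSubmanifold_fkmLevel (hP : IsCliffordSystem P) (hc : c ∈ Ioo (-1 : ℝ) 1) {d : ℕ}
    (hd : d + 2 = n) : IsClosedSubmanifold d (fkmLevel P c) := by
  have hS := hP.isCliffordFamily
  set S := fun a => matrixOp (P a) with hSdef
  have hder : ∀ x, HasFDerivAt (fun y : 𝔼 n => ∑ a, form S y a ^ 2 - (1 - c) / 2)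
      ((4 : ℝ) • innerSL ℝ (comb S (form S x) x)) x := by
    intro x
    refine ((HasFDerivAt.fun_sum fun a _ => (hS.hasFDerivAt_form x a).pow 2).sub_const _).congr_fderiv ?_
    ext v
    simp [inner_comb, Finset.mul_sum]
    refine Finset.sum_congr rfl fun a _ => ?_
    ring
  refine isClosedSubmanifold_of_levelSet (F := ℝ × ℝ) (isCompact_fkmLevel P c)
    (h := fun y => (inner ℝ y y - 1, ∑ a, form S y a ^ 2 - (1 - c) / 2)) ?_ ?_ ?_ ?_
  · exact ((contDiff_id.inner ℝ contDiff_id).sub contDiff_const).prodMk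
      ((ContDiff.sum fun a _ => (contDiff_form S a).pow 2).sub contDiff_const)
  · intro x
    rw [mem_fkmLevel, Prod.mk_eq_zero, real_inner_self_eq_norm_sq, sub_eq_zero, sub_eq_zero,
      pow_eq_one_iff_of_nonneg (norm_nonneg x) two_ne_zero]
  · intro x hx
    obtain ⟨hx1, hx0⟩ := mem_fkmLevel.1 hx
    rw [((hasFDerivAt_norm_sq_sub x).prodMk (hder x)).fderiv]
    change ∑ a, form S x a ^ 2 = (1 - c) / 2 at hx0
    rintro ⟨s, t⟩
    set g := (1 - c) / 2 with hg
    have hg0 : 0 < g := by rw [hg]; linarith [hc.2]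
    have hg1 : 0 < 1 - g := by rw [hg]; linarith [hc.1]
    set q := comb S (form S x) x with hq
    have h1 : inner ℝ q x = g := by
      rw [hq, inner_comb_self, ← hx0]
      exact Finset.sum_congr rfl fun a _ => (sq _).symm
    have h2 : inner ℝ q q = g := by
      rw [real_inner_self_eq_norm_sq, hq, hS.norm_sq_comb, hx0, hx1]
      ring
    have h5 : ‖q‖ ^ 2 = g := by rw [← real_inner_self_eq_norm_sq, h2]
    have h3 : inner ℝ x q = g := by rw [real_inner_comm, h1]
    -- The gradients are 2x and 4q, and the preimage solves ⟨x, ·⟩ = s/2, ⟨q, ·⟩ = t/4 in span(x,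
    -- q). The Gram determinant g(1 - g) is nonzero exactly because -1 < c < 1.
    refine ⟨((s / 2 - t / 4) / (1 - g)) • x + ((t / 4 - g * (s / 2)) / (g * (1 - g))) • q, ?_⟩
    ext
    · simp [inner_add_right, inner_smul_right, h3, hx1]
      field_simp
      ring
    · simp [inner_add_right, inner_smul_right, h1, h5]
      field_simp
      ring
  · simpa using hd

end Level

/-! ### The focal submanifolds are minimal in the sphere -/

section Minimal

open IsCliffordFamily

variable {n k : ℕ} {S : Fin k → 𝔼 n →L[ℝ] 𝔼 n} {P : Fin k → Matrix (Fin n) (Fin n) ℝ}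

theorem fderiv_apply_eq_of_hasDerivAt {Pr : 𝔼 n → 𝔼 n →L[ℝ] 𝔼 n} (h : ContDiff ℝ ∞ Pr) {x v z w : 𝔼 n}
    (hw : HasDerivAt (fun t : ℝ => Pr (x + t • v) z) w 0) : fderiv ℝ Pr x v z = w := by
  have h1 := (h.differentiable (by simp) x).hasFDerivAt.clm_apply (hasFDerivAt_const z x)
  have h2 := (h1.hasLineDerivAt v).unique hw
  simpa using h2

theorem hasDerivAt_clm_line (T : 𝔼 n →L[ℝ] 𝔼 n) (x v : 𝔼 n) :
    HasDerivAt (fun t : ℝ => T (x + t • v)) (T v) 0 := T.hasFDerivAt.hasLineDerivAt v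

theorem hasDerivAt_rankOne (T : 𝔼 n →L[ℝ] 𝔼 n) (x v z : 𝔼 n) :
    HasDerivAt (fun t : ℝ => (inner ℝ (T (x + t • v)) z : ℝ) • T (x + t • v))
      ((inner ℝ (T v) z : ℝ) • T x + (inner ℝ (T x) z : ℝ) • T v) 0 := by
  have h1 := hasDerivAt_clm_line T x v
  have h2 := (h1.inner ℝ (hasDerivAt_const (0 : ℝ) z)).smul h1
  simp only [zero_smul, add_zero, inner_zero_right, zero_add] at h2
  rwa [add_comm] at h2

theorem IsCliffordFamily.hasDerivAt_form (hS : IsCliffordFamily S) (x v : 𝔼 n) (a : Fin k) :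
    HasDerivAt (fun t : ℝ => form S (x + t • v) a) (2 * inner ℝ (S a x) v) 0 := by
  have h : HasDerivAt (fun t : ℝ => form S (x + t • v) a) (((2 : ℝ) • innerSL ℝ (S a x)) v) 0 :=
    (hS.hasFDerivAt_form x a).hasLineDerivAt v
  simpa using h

theorem contDiff_rankOne (T : 𝔼 n →L[ℝ] 𝔼 n) (z : 𝔼 n) :
    ContDiff ℝ ∞ fun x => (inner ℝ (T x) z : ℝ) • T x :=
  (T.contDiff.inner ℝ contDiff_const).smul T.contDiff

/-- The projection onto the tangent space of `M_+`. -/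
noncomputable def plusProj (S : Fin k → 𝔼 n →L[ℝ] 𝔼 n) (x : 𝔼 n) : 𝔼 n →L[ℝ] 𝔼 n :=
  ContinuousLinearMap.id ℝ (𝔼 n) - (innerSL ℝ x).smulRight x
    - ∑ a, (innerSL ℝ (S a x)).smulRight (S a x)

theorem plusProj_apply (S : Fin k → 𝔼 n →L[ℝ] 𝔼 n) (x z : 𝔼 n) :
    plusProj S x z = z - (inner ℝ x z : ℝ) • x - ∑ a, (inner ℝ (S a x) z : ℝ) • S a x := by
  simp [plusProj]

/-- The projection onto the tangent space of `M_-`. -/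
noncomputable def minusProj (S : Fin k → 𝔼 n →L[ℝ] 𝔼 n) (x : 𝔼 n) : 𝔼 n →L[ℝ] 𝔼 n :=
  (1 / 2 : ℝ) • (ContinuousLinearMap.id ℝ (𝔼 n) + comb S (form S x))
    - (2 : ℝ) • (innerSL ℝ x).smulRight x + ∑ a, (innerSL ℝ (S a x)).smulRight (S a x)

theorem minusProj_apply (S : Fin k → 𝔼 n →L[ℝ] 𝔼 n) (x z : 𝔼 n) :
    minusProj S x z = (1 / 2 : ℝ) • (z + comb S (form S x) z) - (2 : ℝ) • (inner ℝ x z : ℝ) • x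
      + ∑ a, (inner ℝ (S a x) z : ℝ) • S a x := by
  simp [minusProj]

theorem contDiff_plusProj (S : Fin k → 𝔼 n →L[ℝ] 𝔼 n) : ContDiff ℝ ∞ (plusProj S) := by
  rw [contDiff_clm_apply_iff]
  intro z
  simp_rw [plusProj_apply]
  exact (contDiff_const.sub (contDiff_rankOne (ContinuousLinearMap.id ℝ _) z)).sub
    (ContDiff.sum fun a _ => contDiff_rankOne (S a) z)

theorem contDiff_minusProj (S : Fin k → 𝔼 n →L[ℝ] 𝔼 n) : ContDiff ℝ ∞ (minusProj S) := by
  rw [contDiff_clm_apply_iff]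
  intro z
  simp_rw [minusProj_apply, comb_apply]
  have h1 : ContDiff ℝ ∞ fun x => ∑ a, form S x a • S a z :=
    ContDiff.sum fun a _ => (contDiff_form S a).smul contDiff_const
  have h2 : ContDiff ℝ ∞ fun x : 𝔼 n => (inner ℝ x z : ℝ) • x :=
    contDiff_rankOne (ContinuousLinearMap.id ℝ _) z
  have h3 : ContDiff ℝ ∞ fun x => ∑ a, (inner ℝ (S a x) z : ℝ) • S a x :=
    ContDiff.sum fun a _ => contDiff_rankOne (S a) z
  exact (((contDiff_const.add h1).const_smul (1 / 2 : ℝ)).sub (h2.const_smul (2 : ℝ))).add h3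

theorem fderiv_plusProj (S : Fin k → 𝔼 n →L[ℝ] 𝔼 n) (x v z : 𝔼 n) :
    fderiv ℝ (plusProj S) x v z = -((inner ℝ v z : ℝ) • x + (inner ℝ x z : ℝ) • v)
      - ∑ a, ((inner ℝ (S a v) z : ℝ) • S a x + (inner ℝ (S a x) z : ℝ) • S a v) := by
  apply fderiv_apply_eq_of_hasDerivAt (contDiff_plusProj S)
  simp_rw [plusProj_apply]
  have h1 := hasDerivAt_rankOne (ContinuousLinearMap.id ℝ _) x v z
  exact (h1.const_sub z).sub (HasDerivAt.fun_sum fun a _ => hasDerivAt_rankOne (S a) x v z)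

theorem IsCliffordFamily.fderiv_minusProj (hS : IsCliffordFamily S) (x v z : 𝔼 n) :
    fderiv ℝ (minusProj S) x v z = ∑ a, (inner ℝ (S a x) v : ℝ) • S a z
      - (2 : ℝ) • ((inner ℝ v z : ℝ) • x + (inner ℝ x z : ℝ) • v)
      + ∑ a, ((inner ℝ (S a v) z : ℝ) • S a x + (inner ℝ (S a x) z : ℝ) • S a v) := by
  apply fderiv_apply_eq_of_hasDerivAt (contDiff_minusProj S)
  simp_rw [minusProj_apply, comb_apply]
  have h1 := (hasDerivAt_rankOne (ContinuousLinearMap.id ℝ _) x v z).const_smul (2 : ℝ)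
  have h2 : HasDerivAt (fun t : ℝ => (1 / 2 : ℝ) • (z + ∑ a, form S (x + t • v) a • S a z))
      (∑ a, (inner ℝ (S a x) v : ℝ) • S a z) 0 := by
    have := (((HasDerivAt.fun_sum (u := Finset.univ) fun a _ =>
      (hS.hasDerivAt_form x v a).smul_const (S a z))).const_add z).const_smul (1 / 2 : ℝ)
    convert! this using 1
    rw [Finset.smul_sum]
    refine Finset.sum_congr rfl fun a _ => ?_
    rw [smul_smul]
    congr 1
    ring
  exact (h2.sub h1).add (HasDerivAt.fun_sum fun a _ => hasDerivAt_rankOne (S a) x v z)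

theorem plusProj_symm (S : Fin k → 𝔼 n →L[ℝ] 𝔼 n) (x y z : 𝔼 n) :
    inner ℝ (plusProj S x y) z = inner ℝ y (plusProj S x z) := by
  simp only [plusProj_apply, inner_sub_left, inner_sub_right, sum_inner, inner_sum,
    real_inner_smul_left, real_inner_smul_right]
  congr 1
  · rw [real_inner_comm x y]
    ring
  · refine Finset.sum_congr rfl fun a _ => ?_
    rw [real_inner_comm (S a x) y]
    ring

theorem IsCliffordFamily.minusProj_symm (hS : IsCliffordFamily S) (x y z : 𝔼 n) :
    inner ℝ (minusProj S x y) z = inner ℝ y (minusProj S x z) := by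
  simp only [minusProj_apply, inner_sub_left, inner_sub_right, sum_inner, inner_sum,
    real_inner_smul_left, real_inner_smul_right, inner_add_left, inner_add_right, hS.symm_comb]
  congr 1
  · rw [real_inner_comm x y]
    ring
  · refine Finset.sum_congr rfl fun a _ => ?_
    rw [real_inner_comm (S a x) y]
    ring

theorem fderiv_eq_zero_of_tangentConeAt {M : Set (𝔼 n)} {g : 𝔼 n → ℝ} {g' : 𝔼 n →L[ℝ] ℝ} {x v : 𝔼 n}
    (hg : HasFDerivAt g g' x) {c : ℝ} (hc : ∀ y ∈ M, g y = c) (hx : x ∈ M)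
    (hv : v ∈ tangentConeAt ℝ M x) : g' v = 0 := by
  have h1 : HasFDerivWithinAt g (0 : 𝔼 n →L[ℝ] ℝ) M x :=
    (hasFDerivWithinAt_const c x M).congr hc (hc x hx)
  exact hg.hasFDerivWithinAt.unique_on h1 hv

theorem IsCliffordSystem.isMinimalInSphere_focalPlus (hP : IsCliffordSystem P) (hk : 2 ≤ k)
    {d : ℕ} (hd : d + (1 + k) = n) :
    IsMinimalInSphere d (focalPlus P) (plusProj fun a => matrixOp (P a)) := by
  have hS := hP.isCliffordFamily
  set S := fun a => matrixOp (P a) with hSdef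
  have hx1 : ∀ x ∈ focalPlus P, ‖x‖ = 1 := fun x hx => (mem_focalPlus.1 hx).1
  have hx0 : ∀ x ∈ focalPlus P, ∀ a, inner ℝ (S a x) x = 0 := fun x hx => (mem_focalPlus.1 hx).2
  have hPx : ∀ x ∈ focalPlus P, plusProj S x x = 0 := by
    intro x hx
    simp [plusProj_apply, hx0 x hx, hx1 x hx]
  have hPSx : ∀ x ∈ focalPlus P, ∀ a, plusProj S x (S a x) = 0 := by
    intro x hx a
    have h1 : inner ℝ x (S a x) = 0 := by rw [real_inner_comm, hx0 x hx]
    simp [plusProj_apply, h1, hx1 x hx, hS.inner_apply_apply]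
  have htr : ∀ x ∈ focalPlus P, ∑ i, inner ℝ (EuclideanSpace.single i (1 : ℝ))
      (plusProj S x (EuclideanSpace.single i 1)) = d := by
    intro x hx
    simp only [plusProj_apply, inner_sub_right, inner_sum, real_inner_smul_right,
      Finset.sum_sub_distrib]
    rw [Finset.sum_comm]
    simp only [mul_comm (inner ℝ x _), mul_comm (inner ℝ (S _ x) _)]
    have h2 : ∀ y : 𝔼 n, ∑ i, inner ℝ (EuclideanSpace.single i (1 : ℝ)) y
        * inner ℝ y (EuclideanSpace.single i (1 : ℝ)) = ‖y‖ ^ 2 := fun y => by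
      rw [← real_inner_self_eq_norm_sq, ← sum_inner_single_mul]
      exact Finset.sum_congr rfl fun i _ => mul_comm _ _
    simp only [h2, hS.norm_apply, hx1 x hx]
    rw [← hd]
    simp
    ring
  refine ⟨contDiff_plusProj S, fun x _ => plusProj_symm S x, ?_, ?_, ?_, ?_⟩
  · intro x hx y
    nth_rewrite 2 [plusProj_apply]
    rw [map_sub, map_sub, map_smul, map_sum, hPx x hx]
    simp [hPSx x hx]
  · intro x hx
    rw [trace_eq_sum, htr x hx]
  · intro x hx v hv
    have h1 := fderiv_eq_zero_of_tangentConeAt (hasFDerivAt_norm_sq_sub x) (c := 0) (fun y hy => by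
      rw [real_inner_self_eq_norm_sq, hx1 y hy]
      norm_num) hx hv
    have h2 := fun a => fderiv_eq_zero_of_tangentConeAt (hS.hasFDerivAt_form x a) (c := 0)
      (fun y hy => hx0 y hy a) hx hv
    simp at h1 h2
    simp [plusProj_apply, h1, h2]
  · intro x hx
    -- Up to sign, this is the trace of the shape operator in the normal direction S_a x. It equals
    -- tr S_a - ⟨x, S_a x⟩ - ∑_b ⟨S_b x, S_a S_b x⟩, and each term vanishes on M_+.
    have hSP : ∀ a, ∑ i, inner ℝ (S a (plusProj S x (EuclideanSpace.single i 1)))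
        (EuclideanSpace.single i (1 : ℝ)) = 0 := by
      intro a
      obtain ⟨b, hab⟩ := exists_ne_of_two_le hk a
      have h1 := hS.trace_apply hab
      have h2 : ∀ i, inner ℝ (S a (plusProj S x (EuclideanSpace.single i 1)))
          (EuclideanSpace.single i (1 : ℝ))
          = inner ℝ (EuclideanSpace.single i (1 : ℝ)) (S a (EuclideanSpace.single i 1))
            - inner ℝ x (EuclideanSpace.single i (1 : ℝ)) * inner ℝ (EuclideanSpace.single i (1 : ℝ)) (S a x)
            - ∑ b, inner ℝ (S b x) (EuclideanSpace.single i (1 : ℝ))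
              * inner ℝ (EuclideanSpace.single i (1 : ℝ)) (S a (S b x)) := by
        intro i
        rw [plusProj_apply, map_sub, map_sub, map_smul, map_sum, real_inner_comm]
        simp only [inner_sub_right, inner_sum, real_inner_smul_right, map_smul]
      simp only [h2, Finset.sum_sub_distrib]
      rw [h1, sum_inner_single_mul, Finset.sum_comm]
      simp only [sum_inner_single_mul]
      rw [hS.sum_inner_apply_triple, real_inner_comm, hx0 x hx, form, hx0 x hx]
      ring
    have h3 : ∀ a, ∑ i, (inner ℝ (S a x) (EuclideanSpace.single i (1 : ℝ)) : ℝ) •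
        S a (plusProj S x (EuclideanSpace.single i 1)) = 0 := fun a => by
      have := sum_inner_single_smul (S a x) (S a ∘L plusProj S x)
      rw [ContinuousLinearMap.comp_apply, hPSx x hx, map_zero] at this
      exact this
    have h4 : ∑ i, ∑ a, ((inner ℝ (S a (plusProj S x (EuclideanSpace.single i 1)))
        (EuclideanSpace.single i (1 : ℝ)) : ℝ) • S a x
        + (inner ℝ (S a x) (EuclideanSpace.single i (1 : ℝ)) : ℝ) •
          S a (plusProj S x (EuclideanSpace.single i 1))) = 0 := by
      rw [Finset.sum_comm]
      refine Finset.sum_eq_zero fun a _ => ?_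
      rw [Finset.sum_add_distrib, ← Finset.sum_smul, hSP, h3, zero_smul, add_zero]
    simp only [fderiv_plusProj, Finset.sum_sub_distrib, Finset.sum_neg_distrib]
    rw [h4, Finset.sum_add_distrib, sum_inner_single_smul x (plusProj S x), hPx x hx,
      ← Finset.sum_smul, Finset.sum_congr rfl fun i _ => real_inner_comm _ _, htr x hx]
    simp

theorem isCliffordFamily_minus_facts (hS : IsCliffordFamily S) {x : 𝔼 n} (hx : ‖x‖ = 1)
    (hg : ∑ a, form S x a ^ 2 = 1) :
    minusProj S x x = 0 ∧ ∀ a, minusProj S x (S a x) = S a x - form S x a • x := by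
  have hQ := hS.comb_form_eq_self hx hg
  constructor
  · have h1 : ∑ a, (inner ℝ (S a x) x : ℝ) • S a x = x := by
      rw [← comb_apply S (fun a => inner ℝ (S a x) x) x]
      exact hQ
    rw [minusProj_apply, hQ, h1, real_inner_self_eq_norm_sq, hx]
    module
  · intro a
    have h1 : ∑ b, (inner ℝ (S b x) (S a x) : ℝ) • S b x = S a x := by
      simp [hS.inner_apply_apply, hx]
    have h2 : inner ℝ x (S a x) = form S x a := by rw [real_inner_comm, form]
    rw [minusProj_apply, h1, hS.comb_swap, hQ, h2]
    module

/-- The identity contributes n/2, the trace-free Clifford part 0, the line of x -2, and the unit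
vectors S_a x contribute k. -/
theorem IsCliffordFamily.trace_minusProj (hS : IsCliffordFamily S) (hk : 2 ≤ k) {x : 𝔼 n}
    (hx : ‖x‖ = 1) : ∑ i, inner ℝ (EuclideanSpace.single i (1 : ℝ))
      (minusProj S x (EuclideanSpace.single i 1)) = (n : ℝ) / 2 + k - 2 := by
  have h2 : ∀ y : 𝔼 n, ∑ i, inner ℝ y (EuclideanSpace.single i (1 : ℝ))
      * inner ℝ (EuclideanSpace.single i (1 : ℝ)) y = ‖y‖ ^ 2 := fun y => by
    rw [← real_inner_self_eq_norm_sq, ← sum_inner_single_mul]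
  have h3 : ∀ a, ∑ i, inner ℝ (EuclideanSpace.single i (1 : ℝ)) (S a (EuclideanSpace.single i 1)) = 0 :=
    fun a => by
      obtain ⟨b, hab⟩ := exists_ne_of_two_le hk a
      exact hS.trace_apply hab
  have h4 : ∑ i, inner ℝ (EuclideanSpace.single i (1 : ℝ)) (comb S (form S x) (EuclideanSpace.single i 1))
      = 0 := by
    simp only [comb_apply, inner_sum, real_inner_smul_right]
    rw [Finset.sum_comm]
    simp only [← Finset.mul_sum, h3, mul_zero, Finset.sum_const_zero]
  simp only [minusProj_apply, inner_sub_right, inner_sum, real_inner_smul_right, inner_add_right,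
    Finset.sum_sub_distrib, Finset.sum_add_distrib, ← Finset.mul_sum, h4]
  rw [Finset.sum_comm]
  simp only [h2, hS.norm_apply, hx]
  simp
  ring

/-- Write d = n/2 + k - 2. Differentiating the Clifford part contributes (k - 1)x, the rank-one term
in x contributes -2d x because Pr x = 0, and the S_a terms contribute (n/2 - k)x + (k - 1)x. The sum
is d x - 2d x. -/
theorem IsCliffordFamily.mean_minusProj (hS : IsCliffordFamily S) (hk : 2 ≤ k) {x : 𝔼 n}
    (hx : ‖x‖ = 1) (hg : ∑ a, form S x a ^ 2 = 1) :
    ∑ i, fderiv ℝ (minusProj S) x (minusProj S x (EuclideanSpace.single i 1))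
      (EuclideanSpace.single i 1) = -((n : ℝ) / 2 + k - 2) • x := by
  obtain ⟨hPx, hPSx⟩ := isCliffordFamily_minus_facts hS hx hg
  have hQ := hS.comb_form_eq_self hx hg
  have hQ' : ∑ a, form S x a • S a x = x := by rw [← comb_apply, hQ]
  have hSS : ∑ a, S a (S a x - form S x a • x) = ((k : ℝ) - 1) • x := by
    simp only [map_sub, hS.invol, map_smul, Finset.sum_sub_distrib, hQ']
    simp [sub_smul, ← Nat.cast_smul_eq_nsmul ℝ]
  have htr := hS.trace_minusProj hk hx
  have hSP : ∀ a, ∑ i, inner ℝ (S a (minusProj S x (EuclideanSpace.single i 1)))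
      (EuclideanSpace.single i (1 : ℝ)) = ((n : ℝ) / 2 - k) * form S x a := by
    intro a
    obtain ⟨b, hab⟩ := exists_ne_of_two_le hk a
    have h1 := hS.trace_apply hab
    have h2 : ∀ i, inner ℝ (S a (minusProj S x (EuclideanSpace.single i 1)))
        (EuclideanSpace.single i (1 : ℝ))
        = 1 / 2 * (inner ℝ (EuclideanSpace.single i (1 : ℝ)) (S a (EuclideanSpace.single i 1))
          + ∑ b, form S x b * inner ℝ (EuclideanSpace.single i (1 : ℝ)) (S a (S b (EuclideanSpace.single i 1))))
          - 2 * (inner ℝ x (EuclideanSpace.single i (1 : ℝ)) * inner ℝ (EuclideanSpace.single i (1 : ℝ)) (S a x))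
          + ∑ b, inner ℝ (S b x) (EuclideanSpace.single i (1 : ℝ))
            * inner ℝ (EuclideanSpace.single i (1 : ℝ)) (S a (S b x)) := by
      intro i
      rw [minusProj_apply, real_inner_comm, comb_apply]
      simp only [map_add, map_sub, map_smul, map_sum, inner_add_right, inner_sub_right, inner_sum,
        real_inner_smul_right]
    have h3 : ∑ b, form S x b * ∑ i, inner ℝ (EuclideanSpace.single i (1 : ℝ))
        (S a (S b (EuclideanSpace.single i 1))) = n * form S x a := by
      rw [Finset.sum_eq_single a]
      · simp [hS.invol, mul_comm]
      · intro b _ hb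
        rw [hS.trace_mul hb.symm, mul_zero]
      · simp
    simp only [h2, Finset.sum_sub_distrib, Finset.sum_add_distrib, ← Finset.mul_sum]
    rw [h1, sum_inner_single_mul, Finset.sum_comm]
    simp only [← Finset.mul_sum, h3]
    rw [Finset.sum_comm]
    simp only [sum_inner_single_mul]
    rw [hS.sum_inner_apply_triple, real_inner_comm, form]
    ring
  have h1 : ∀ a, ∑ i, (inner ℝ (S a x) (minusProj S x (EuclideanSpace.single i 1)) : ℝ) •
      S a (EuclideanSpace.single i 1) = S a (S a x - form S x a • x) := fun a => by
    simp only [← hS.minusProj_symm, hPSx a]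
    rw [sum_inner_single_smul]
  have h3 : ∀ a, ∑ i, (inner ℝ (S a x) (EuclideanSpace.single i (1 : ℝ)) : ℝ) •
      S a (minusProj S x (EuclideanSpace.single i 1)) = S a (S a x - form S x a • x) := fun a => by
    have := sum_inner_single_smul (S a x) (S a ∘L minusProj S x)
    rw [ContinuousLinearMap.comp_apply, hPSx a] at this
    exact this
  have h4 : ∑ i, ∑ a, ((inner ℝ (S a (minusProj S x (EuclideanSpace.single i 1)))
      (EuclideanSpace.single i (1 : ℝ)) : ℝ) • S a x
      + (inner ℝ (S a x) (EuclideanSpace.single i (1 : ℝ)) : ℝ) •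
        S a (minusProj S x (EuclideanSpace.single i 1)))
      = ((n : ℝ) / 2 - k) • x + ((k : ℝ) - 1) • x := by
    have h5 : ((n : ℝ) / 2 - k) • x = ∑ a, (((n : ℝ) / 2 - k) * form S x a) • S a x := by
      simp only [mul_smul, ← Finset.smul_sum, hQ']
    rw [Finset.sum_comm, ← hSS, h5, ← Finset.sum_add_distrib]
    refine Finset.sum_congr rfl fun a _ => ?_
    rw [Finset.sum_add_distrib, ← Finset.sum_smul, hSP, h3]
  have h5 : ∑ i, ∑ a, (inner ℝ (S a x) (minusProj S x (EuclideanSpace.single i 1)) : ℝ) •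
      S a (EuclideanSpace.single i 1) = ((k : ℝ) - 1) • x := by
    rw [Finset.sum_comm, ← hSS]
    exact Finset.sum_congr rfl fun a _ => h1 a
  simp only [hS.fderiv_minusProj, Finset.sum_sub_distrib, Finset.sum_add_distrib, ← Finset.smul_sum]
  simp only [← Finset.sum_add_distrib]
  rw [h4, h5, Finset.sum_add_distrib, sum_inner_single_smul x (minusProj S x), hPx, ← Finset.sum_smul,
    Finset.sum_congr rfl fun i _ => real_inner_comm _ _, htr]
  module

end Minimal

/-! ### The explicit retraction onto M_- and its derivative. -/

section FocalMinus

open IsCliffordFamily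

variable {n k : ℕ} {S : Fin k → 𝔼 n →L[ℝ] 𝔼 n} {P : Fin k → Matrix (Fin n) (Fin n) ℝ}

/-- The numerator of the retraction onto `M_-`. -/
noncomputable def minusLift (S : Fin k → 𝔼 n →L[ℝ] 𝔼 n) (y : 𝔼 n) : 𝔼 n :=
  √(∑ a, form S y a ^ 2) • y + ∑ a, form S y a • S a y

/-- The nearest point retraction onto `M_-`. -/
noncomputable def minusRetraction (S : Fin k → 𝔼 n →L[ℝ] 𝔼 n) (y : 𝔼 n) : 𝔼 n :=
  (√(inner ℝ (minusLift S y) (minusLift S y)))⁻¹ • minusLift S y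

theorem minusLift_eq (S : Fin k → 𝔼 n →L[ℝ] 𝔼 n) (y : 𝔼 n) :
    minusLift S y = √(∑ a, form S y a ^ 2) • y + comb S (form S y) y := by
  rw [minusLift, comb_apply]

theorem continuous_sum_form_sq (S : Fin k → 𝔼 n →L[ℝ] 𝔼 n) :
    Continuous fun y => ∑ a, form S y a ^ 2 :=
  (ContDiff.sum fun a _ => (contDiff_form S a).pow 2).continuous

theorem IsCliffordFamily.inner_minusLift_pos (hS : IsCliffordFamily S) {y : 𝔼 n}
    (hy : 0 < ∑ a, form S y a ^ 2) : 0 < inner ℝ (minusLift S y) (minusLift S y) := by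
  obtain ⟨g, hg⟩ : ∃ g, ∑ a, form S y a ^ 2 = g := ⟨_, rfl⟩
  rw [hg] at hy
  have hq := Real.sqrt_pos.2 hy
  have h1 : inner ℝ y (comb S (form S y) y) = g := by
    rw [real_inner_comm, inner_comb_self, ← hg]
    exact Finset.sum_congr rfl fun a _ => (pow_two _).symm
  have h2 : ‖minusLift S y‖ ^ 2 = 2 * g * ‖y‖ ^ 2 + 2 * √g * g := by
    rw [minusLift_eq, hg, norm_add_sq_real, hS.norm_sq_comb, hg, real_inner_smul_left, h1, norm_smul,
      mul_pow, Real.norm_of_nonneg hq.le, Real.sq_sqrt hy.le]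
    ring
  rw [real_inner_self_eq_norm_sq, h2]
  exact add_pos_of_nonneg_of_pos (mul_nonneg (mul_nonneg zero_le_two hy.le) (sq_nonneg _))
    (mul_pos (mul_pos two_pos hq) hy)

theorem IsCliffordFamily.contDiffOn_minusRetraction (hS : IsCliffordFamily S) :
    ContDiffOn ℝ ∞ (minusRetraction S) {y | 0 < ∑ a, form S y a ^ 2} := by
  have h1 : ContDiffOn ℝ ∞ (minusLift S) {y | 0 < ∑ a, form S y a ^ 2} := by
    refine ContDiffOn.add (ContDiffOn.smul (ContDiffOn.sqrt ?_ fun y hy => ne_of_gt hy)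
      contDiffOn_id) ?_
    · exact (ContDiff.sum fun a _ => (contDiff_form S a).pow 2).contDiffOn
    · exact (ContDiff.sum fun a _ => (contDiff_form S a).smul (S a).contDiff).contDiffOn
  refine ContDiffOn.smul (ContDiffOn.inv (ContDiffOn.sqrt (h1.inner ℝ h1) fun y hy => ?_)
    fun y hy => ?_) h1
  · exact (hS.inner_minusLift_pos hy).ne'
  · exact (Real.sqrt_pos.2 (hS.inner_minusLift_pos hy)).ne'

/-- Since Q_y² = g, the vector (√g + Q_y)y lies in the √g-eigenspace of Q_y. For its normalization
w, Cauchy-Schwarz applied to ∑ ⟨S_a y, y⟩⟨S_a w, w⟩ = √g forces ∑ ⟨S_a w, w⟩² ≥ 1; the opposite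
bound is general. -/
theorem IsCliffordFamily.minusRetraction_mem (hS : IsCliffordFamily S) {y : 𝔼 n}
    (hy : 0 < ∑ a, form S y a ^ 2) :
    ‖minusRetraction S y‖ = 1 ∧ ∑ a, form S (minusRetraction S y) a ^ 2 = 1 := by
  set g := ∑ a, form S y a ^ 2 with hg
  set w := minusRetraction S y with hw
  have hpos := hS.inner_minusLift_pos hy
  have hw1 : ‖w‖ = 1 := by
    rw [real_inner_self_eq_norm_sq, sq_pos_iff] at hpos
    rw [hw, minusRetraction, real_inner_self_eq_norm_sq, Real.sqrt_sq (norm_nonneg _), norm_smul,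
      norm_inv, norm_norm, inv_mul_cancel₀ hpos]
  refine ⟨hw1, le_antisymm (hS.sum_form_sq_le hw1) ?_⟩
  have hqq := Real.mul_self_sqrt hy.le
  have h1 : comb S (form S y) (minusLift S y) = √g • minusLift S y := by
    rw [minusLift_eq, map_add, map_smul, hS.comb_comb, ← hg, smul_add, smul_smul, hqq, add_comm]
  have h2 : comb S (form S y) w = √g • w := by
    rw [hw, minusRetraction, map_smul, h1, smul_comm]
  have h3 : ∑ a, form S y a * form S w a = √g := by
    rw [← inner_comb_self, h2, real_inner_smul_left, real_inner_self_eq_norm_sq, hw1]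
    ring
  have h4 := Finset.sum_mul_sq_le_sq_mul_sq Finset.univ (form S y) (form S w)
  rw [h3, ← hg, sq, hqq] at h4
  exact le_of_mul_le_mul_left (by linarith) hy

theorem IsCliffordFamily.minusLift_eq_two_smul (hS : IsCliffordFamily S) {x : 𝔼 n} (hx : ‖x‖ = 1)
    (hg : ∑ a, form S x a ^ 2 = 1) : minusLift S x = (2 : ℝ) • x := by
  rw [minusLift_eq, hg, hS.comb_form_eq_self hx hg, Real.sqrt_one, one_smul, two_smul]

theorem IsCliffordFamily.sqrt_inner_minusLift (hS : IsCliffordFamily S) {x : 𝔼 n} (hx : ‖x‖ = 1)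
    (hg : ∑ a, form S x a ^ 2 = 1) : inner ℝ (minusLift S x) (minusLift S x) = (2 : ℝ) ^ 2 := by
  rw [hS.minusLift_eq_two_smul hx hg, real_inner_self_eq_norm_sq, norm_smul, hx]
  norm_num

theorem IsCliffordFamily.minusRetraction_eq_self (hS : IsCliffordFamily S) {x : 𝔼 n} (hx : ‖x‖ = 1)
    (hg : ∑ a, form S x a ^ 2 = 1) : minusRetraction S x = x := by
  rw [minusRetraction, hS.sqrt_inner_minusLift hx hg, hS.minusLift_eq_two_smul hx hg,
    Real.sqrt_sq zero_le_two, smul_smul]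
  norm_num

theorem isOpen_sum_form_sq_pos (S : Fin k → 𝔼 n →L[ℝ] 𝔼 n) :
    IsOpen {y | 0 < ∑ a, form S y a ^ 2} :=
  isOpen_lt continuous_const (continuous_sum_form_sq S)

/-- This identification lets idempotence and tangency of the projection follow from the retraction
property, with no Clifford computation. On M_- the lift is 2x; half its derivative contributes ⟨x,
v⟩x along x and the normalization -3⟨x, v⟩x, whence the coefficient -2. -/
theorem IsCliffordFamily.fderiv_minusRetraction (hS : IsCliffordFamily S) {x : 𝔼 n} (hx : ‖x‖ = 1)
    (hg : ∑ a, form S x a ^ 2 = 1) : fderiv ℝ (minusRetraction S) x = minusProj S x := by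
  have hQ := hS.comb_form_eq_self hx hg
  ext1 v
  have hdiff : DifferentiableAt ℝ (minusRetraction S) x :=
    (hS.contDiffOn_minusRetraction.contDiffAt ((isOpen_sum_form_sq_pos S).mem_nhds
      (by rw [mem_ofPred_eq, hg]; exact one_pos))).differentiableAt (by simp)
  have h0 : x + (0 : ℝ) • v = x := by simp
  have hid : HasDerivAt (fun t : ℝ => x + t • v) v 0 :=
    hasDerivAt_clm_line (ContinuousLinearMap.id ℝ _) x v
  have hQv : ∑ a, form S x a * inner ℝ (S a x) v = inner ℝ x v := by
    rw [← inner_comb, hQ]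
  have hsq : HasDerivAt (fun t : ℝ => √(∑ a, form S (x + t • v) a ^ 2)) (2 * inner ℝ x v) 0 := by
    have h1 : HasDerivAt (fun t : ℝ => ∑ a, form S (x + t • v) a ^ 2) (4 * inner ℝ x v) 0 := by
      convert! HasDerivAt.fun_sum (u := Finset.univ) fun a _ =>
        (hS.hasDerivAt_form x v a).fun_pow 2 using 1
      rw [← hQv, Finset.mul_sum]
      refine Finset.sum_congr rfl fun a _ => ?_
      simp only [h0]
      ring
    convert! h1.sqrt (by simp only [h0, hg]; exact one_ne_zero) using 1
    simp only [h0, hg, Real.sqrt_one]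
    ring
  set R := ∑ a, (inner ℝ (S a x) v : ℝ) • S a x with hR
  have hlift : HasDerivAt (fun t : ℝ => minusLift S (x + t • v))
      ((2 * inner ℝ x v : ℝ) • x + v + comb S (form S x) v + (2 : ℝ) • R) 0 := by
    have h1 := (hsq.smul hid).add (HasDerivAt.fun_sum (u := Finset.univ) fun a _ =>
      (hS.hasDerivAt_form x v a).smul (hasDerivAt_clm_line (S a) x v))
    convert! h1 using 1
    simp only [h0, hg, Real.sqrt_one, one_smul, Finset.sum_add_distrib, mul_smul, ← Finset.smul_sum]
    rw [comb_apply, hR]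
    abel
  have hxR : inner ℝ x R = inner ℝ x v := by
    rw [hR, inner_sum, ← hQv]
    refine Finset.sum_congr rfl fun a _ => ?_
    rw [real_inner_smul_right, form, real_inner_comm x]
    ring
  have hxQ : inner ℝ x (comb S (form S x) v) = inner ℝ x v := by
    rw [← hS.symm_comb, hQ]
  have hin := ((hlift.inner ℝ hlift).sqrt (by
    simp only [h0]
    exact (hS.inner_minusLift_pos (by rw [hg]; exact one_pos)).ne')).inv (by
    simp only [h0]
    exact (Real.sqrt_pos.2 (hS.inner_minusLift_pos (by rw [hg]; exact one_pos))).ne')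
  have h2 := hin.smul hlift
  have h3 := (hdiff.hasFDerivAt.hasLineDerivAt v).unique h2
  rw [h3, minusProj_apply]
  simp only [Pi.inv_apply, h0, hS.sqrt_inner_minusLift hx hg, Real.sqrt_sq zero_le_two]
  simp only [hS.minusLift_eq_two_smul hx hg, ← hR]
  simp only [inner_add_right, inner_add_left, real_inner_smul_left, real_inner_smul_right, hxR, hxQ,
    real_inner_comm x, real_inner_self_eq_norm_sq, hx]
  module

theorem IsCliffordSystem.focalMinus_spec (hP : IsCliffordSystem P) (hk : 2 ≤ k)
    {d : ℕ} (hd : (d : ℝ) = n / 2 + k - 2) :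
    IsClosedSubmanifold d (focalMinus P) ∧
      IsMinimalInSphere d (focalMinus P) (minusProj fun a => matrixOp (P a)) := by
  have hS := hP.isCliffordFamily
  set S := fun a => matrixOp (P a) with hSdef
  have hmem : ∀ x, x ∈ focalMinus P ↔ ‖x‖ = 1 ∧ ∑ a, form S x a ^ 2 = 1 := fun x => mem_focalMinus
  have hder : ∀ x ∈ focalMinus P, fderiv ℝ (minusRetraction S) x = minusProj S x := fun x hx =>
    hS.fderiv_minusRetraction ((hmem x).1 hx).1 ((hmem x).1 hx).2
  have htr : ∀ x ∈ focalMinus P, LinearMap.trace ℝ (𝔼 n) (minusProj S x).toLinearMap = d :=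
    fun x hx => by rw [trace_eq_sum, hS.trace_minusProj hk ((hmem x).1 hx).1, hd]
  have hsub : focalMinus P ⊆ {y | 0 < ∑ a, form S y a ^ 2} := fun x hx => by
    rw [mem_ofPred_eq, ((hmem x).1 hx).2]
    exact one_pos
  have hid : ∀ x ∈ focalMinus P, minusRetraction S x = x := fun x hx =>
    hS.minusRetraction_eq_self ((hmem x).1 hx).1 ((hmem x).1 hx).2
  obtain ⟨hidem, hsm⟩ := isClosedSubmanifold_of_retraction (isCompact_fkmLevel P (-1))
    (isOpen_sum_form_sq_pos S) hsub hS.contDiffOn_minusRetraction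
    (fun y hy => (hmem _).2 (hS.minusRetraction_mem hy)) hid
    (fun x hx => by rw [hder x hx]; exact htr x hx)
  refine ⟨hsm, contDiff_minusProj S, fun x _ => hS.minusProj_symm x, ?_, htr, ?_, ?_⟩
  · intro x hx y
    rw [← hder x hx]
    exact hidem x hx y
  · intro x hx v hv
    rw [← hder x hx]
    have h1 : DifferentiableAt ℝ (minusRetraction S) x :=
      (hS.contDiffOn_minusRetraction.contDiffAt
        ((isOpen_sum_form_sq_pos S).mem_nhds (hsub hx))).differentiableAt (by simp)
    have h2 : HasFDerivWithinAt (minusRetraction S) (ContinuousLinearMap.id ℝ (𝔼 n))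
        (focalMinus P) x := (hasFDerivWithinAt_id x _).congr hid (hid x hx)
    exact h1.hasFDerivAt.hasFDerivWithinAt.unique_on h2 hv
  · intro x hx
    rw [hS.mean_minusProj hk ((hmem x).1 hx).1 ((hmem x).1 hx).2, hd]

end FocalMinus

/-! ### Distances between the leaves and the normal maps -/

section Distance

open IsCliffordFamily

variable {n k : ℕ} {S : Fin k → 𝔼 n →L[ℝ] 𝔼 n} {P : Fin k → Matrix (Fin n) (Fin n) ℝ} {c : ℝ}

theorem sphericalDist_eq {A B : Set (𝔼 n)} (hA : ∀ p ∈ A, ‖p‖ = 1) (hB : ∀ q ∈ B, ‖q‖ = 1) {θ : ℝ}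
    (hθ0 : 0 ≤ θ) (hθ : θ ≤ Real.pi) (hex : ∃ p ∈ A, ∃ q ∈ B, inner ℝ p q = Real.cos θ)
    (hle : ∀ p ∈ A, ∀ q ∈ B, inner ℝ p q ≤ Real.cos θ) : sphericalDist A B = θ := by
  have hang : ∀ p ∈ A, ∀ q ∈ B, InnerProductGeometry.angle p q = Real.arccos (inner ℝ p q) :=
    fun p hp q hq => by rw [InnerProductGeometry.angle, hA p hp, hB q hq, mul_one, div_one]
  refine IsLeast.csInf_eq ⟨?_, ?_⟩
  · obtain ⟨p, hp, q, hq, h⟩ := hex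
    exact ⟨p, hp, q, hq, by rw [hang p hp q hq, h, Real.arccos_cos hθ0 hθ]⟩
  · rintro _ ⟨p, hp, q, hq, rfl⟩
    rw [hang p hp q hq, ← Real.arccos_cos hθ0 hθ]
    exact Real.arccos_le_arccos (hle p hp q hq)

/-- Split x and q into ±1-eigencomponents of T. Those of x both have norm 1/√2, those of q have
norms (cos τ ± sin τ)/√2, the minus sign requiring sin τ ≤ cos τ. Cauchy-Schwarz on each eigenspace
adds up to cos τ. -/
theorem inner_le_of_involution {T : 𝔼 n →L[ℝ] 𝔼 n} (hsymm : ∀ x y, inner ℝ (T x) y = inner ℝ x (T y))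
    (hinv : ∀ x, T (T x) = x) {x q : 𝔼 n} (hx : ‖x‖ = 1) (hq : ‖q‖ = 1) (hTx : inner ℝ (T x) x = 0)
    {τ : ℝ} (h0 : 0 ≤ Real.sin τ) (hτ : Real.sin τ ≤ Real.cos τ) (hTq : inner ℝ (T q) q = Real.sin (2 * τ)) :
    inner ℝ x q ≤ Real.cos τ := by
  have hnT : ∀ z, ‖T z‖ ^ 2 = ‖z‖ ^ 2 := fun z => by
    rw [← real_inner_self_eq_norm_sq, hsymm, hinv, real_inner_self_eq_norm_sq]
  have hp : ∀ z, ‖z + T z‖ ^ 2 = 2 * ‖z‖ ^ 2 + 2 * inner ℝ (T z) z := fun z => by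
    rw [norm_add_sq_real, hnT, real_inner_comm]; ring
  have hm : ∀ z, ‖z - T z‖ ^ 2 = 2 * ‖z‖ ^ 2 - 2 * inner ℝ (T z) z := fun z => by
    rw [norm_sub_sq_real, hnT, real_inner_comm]; ring
  have hsc := Real.sin_sq_add_cos_sq τ
  have h1 : inner ℝ (x + T x) (q + T q) ≤ 2 * (Real.cos τ + Real.sin τ) := by
    refine (real_inner_le_norm _ _).trans (abs_le_of_sq_le_sq' ?_ (by linarith)).2
    rw [mul_pow, hp, hp, hx, hq, hTx, hTq, Real.sin_two_mul]
    nlinarith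
  have h2 : inner ℝ (x - T x) (q - T q) ≤ 2 * (Real.cos τ - Real.sin τ) := by
    refine (real_inner_le_norm _ _).trans (abs_le_of_sq_le_sq' ?_ (by linarith)).2
    rw [mul_pow, hm, hm, hx, hq, hTx, hTq, Real.sin_two_mul]
    nlinarith
  have h3 : inner ℝ (x + T x) (q + T q) + inner ℝ (x - T x) (q - T q) = 4 * inner ℝ x q := by
    simp only [inner_add_left, inner_add_right, inner_sub_left, inner_sub_right]
    have : inner ℝ (T x) (T q) = inner ℝ x q := by rw [hsymm, hinv]
    rw [this]
    ring
  linarith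

theorem exists_angle (hc : c ∈ Ioo (-1 : ℝ) 1) : ∃ τ, 0 < τ ∧ τ < Real.pi / 4 ∧ Real.cos (4 * τ) = c := by
  refine ⟨Real.arccos c / 4, ?_, ?_, ?_⟩
  · have := Real.arccos_pos.2 hc.2
    linarith
  · have := Real.arccos_lt_pi.2 hc.1
    linarith
  · rw [mul_div_cancel₀ _ (by norm_num), Real.cos_arccos hc.1.le hc.2.le]

theorem half_one_sub_cos (τ : ℝ) : (1 - Real.cos (4 * τ)) / 2 = Real.sin (2 * τ) ^ 2 := by
  rw [show 4 * τ = 2 * (2 * τ) by ring, Real.cos_two_mul, Real.sin_sq]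
  ring

theorem sin_le_cos_of_le {τ : ℝ} (h0 : 0 ≤ τ) (h : τ ≤ Real.pi / 4) : Real.sin τ ≤ Real.cos τ := by
  rw [← Real.sin_pi_div_two_sub]
  apply Real.sin_le_sin_of_le_of_le_pi_div_two <;> linarith [Real.pi_pos]

theorem IsCliffordFamily.normal_plus (hS : IsCliffordFamily S) {b : Fin k → ℝ} (hb : ∑ a, b a ^ 2 = 1)
    {x : 𝔼 n} (hx : ‖x‖ = 1) (h0 : ∀ a, form S x a = 0) {C D : ℝ} (hCD : C ^ 2 + D ^ 2 = 1) :
    ‖C • x + D • comb S b x‖ = 1 ∧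
      ∑ a, form S (C • x + D • comb S b x) a ^ 2 = (2 * C * D) ^ 2 := by
  have hbx : inner ℝ (comb S b x) x = 0 := by
    rw [inner_comb_self]
    exact Finset.sum_eq_zero fun a _ => by rw [h0, mul_zero]
  have hxb : inner ℝ x (comb S b x) = 0 := by rw [real_inner_comm, hbx]
  constructor
  · rw [← pow_eq_one_iff_of_nonneg (norm_nonneg _) two_ne_zero, norm_add_sq_real, norm_smul, norm_smul,
      mul_pow, mul_pow, hS.norm_sq_comb, hb, hx, real_inner_smul_left, real_inner_smul_right, hxb,
      Real.norm_eq_abs, Real.norm_eq_abs, sq_abs, sq_abs]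
    linarith
  · have h1 : ∀ a, form S (C • x + D • comb S b x) a = 2 * C * D * b a := by
      intro a
      have e1 : inner ℝ (S a x) x = 0 := h0 a
      have e2 : inner ℝ (S a x) (comb S b x) = b a := by rw [hS.inner_apply_comb, hx]; ring
      have e3 : inner ℝ (S a (comb S b x)) x = b a := by rw [hS.symm, real_inner_comm, e2]
      have e4 : inner ℝ (S a (comb S b x)) (comb S b x) = 0 := by
        have : S a (comb S b x) = -comb S b (S a x) + (2 * b a) • x := by
          rw [hS.comb_swap]; abel
        rw [this, inner_add_left, inner_neg_left, real_inner_smul_left, hxb, hS.symm_comb, hS.comb_comb,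
          real_inner_smul_right, e1]
        ring
      rw [form, map_add, map_smul, map_smul]
      simp only [inner_add_left, inner_add_right, real_inner_smul_left, real_inner_smul_right, e1, e2, e3,
        e4]
      ring
    simp only [h1, mul_pow, ← Finset.mul_sum, hb, mul_one]

/-- R anticommutes with Q = ∑ ⟨S_a x, x⟩ S_a and Qx = x, so Rx lies in the -1-eigenspace, orthogonal
to x. Anticommutation with each S_a also reverses the signs of the forms and kills the mixed terms.
-/
theorem IsCliffordFamily.normal_minus {R : 𝔼 n →L[ℝ] 𝔼 n} (hR : ∀ x y, inner ℝ (R x) y = inner ℝ x (R y))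
    (hRR : ∀ x, R (R x) = x) (hS : IsCliffordFamily S) (hRS : ∀ a x, R (S a x) = -S a (R x))
    {x : 𝔼 n} (hx : ‖x‖ = 1) (hg : ∑ a, form S x a ^ 2 = 1) {C D : ℝ} (hCD : C ^ 2 + D ^ 2 = 1) :
    inner ℝ x (R x) = 0 ∧ ‖C • x + D • R x‖ = 1 ∧
      ∑ a, form S (C • x + D • R x) a ^ 2 = (C ^ 2 - D ^ 2) ^ 2 := by
  have hQ := hS.comb_form_eq_self hx hg
  have hRQ : comb S (form S x) (R x) = -R x := by
    nth_rewrite 3 [← hQ]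
    rw [comb_apply, comb_apply, map_sum, ← Finset.sum_neg_distrib]
    exact Finset.sum_congr rfl fun a _ => by rw [map_smul, hRS, smul_neg, neg_neg]
  have hxR : inner ℝ x (R x) = 0 := by
    have h1 := hS.symm_comb (form S x) x (R x)
    rw [hQ, hRQ, inner_neg_right] at h1
    linarith
  have hnR : ‖R x‖ ^ 2 = 1 := by
    rw [← real_inner_self_eq_norm_sq, hR, hRR, real_inner_self_eq_norm_sq, hx]
    norm_num
  refine ⟨hxR, ?_, ?_⟩
  · rw [← pow_eq_one_iff_of_nonneg (norm_nonneg _) two_ne_zero, norm_add_sq_real, norm_smul, norm_smul,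
      mul_pow, mul_pow, hnR, hx, real_inner_smul_left, real_inner_smul_right, hxR,
      Real.norm_eq_abs, Real.norm_eq_abs, sq_abs, sq_abs]
    linarith
  · have h1 : ∀ a, form S (C • x + D • R x) a = (C ^ 2 - D ^ 2) * form S x a := by
      intro a
      have e1 : inner ℝ (S a x) (R x) = 0 := by
        have h2 : inner ℝ (S a x) (R x) = -inner ℝ x (S a (R x)) := by
          rw [← hR, hRS, inner_neg_left, real_inner_comm]
        have h3 := hS.symm a x (R x)
        linarith
      have e2 : inner ℝ (S a (R x)) x = 0 := by rw [hS.symm, real_inner_comm, e1]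
      have e3 : inner ℝ (S a (R x)) (R x) = -form S x a := by
        rw [← hR, hRS, hRR, inner_neg_left, form]
      rw [form, map_add, map_smul, map_smul]
      simp only [inner_add_left, inner_add_right, real_inner_smul_left, real_inner_smul_right, e1, e2, e3]
      rw [form]
      ring
    simp only [h1, mul_pow, ← Finset.mul_sum, hg, mul_one]

theorem IsCliffordSystem.inner_le_of_focalPlus (hP : IsCliffordSystem P) {τ : ℝ} (h0 : 0 < τ)
    (hτ : τ < Real.pi / 4) {x q : 𝔼 n} (hx : x ∈ focalPlus P) (hq : q ∈ fkmLevel P (Real.cos (4 * τ))) :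
    inner ℝ x q ≤ Real.cos τ := by
  have hS := hP.isCliffordFamily
  set S := fun a => matrixOp (P a) with hSdef
  obtain ⟨hx1, hx0⟩ := mem_focalPlus.1 hx
  obtain ⟨hq1, hqg⟩ := mem_fkmLevel.1 hq
  rw [half_one_sub_cos] at hqg
  have hσ : 0 < Real.sin (2 * τ) := Real.sin_pos_of_pos_of_lt_pi (by linarith) (by linarith)
  set σ := Real.sin (2 * τ) with hσdef
  -- The unit vector in the direction of the forms of q: the resulting Clifford involution T has
  -- ⟨Tq, q⟩ = σ, while ⟨Tx, x⟩ = 0 for every x in M_+.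
  let b : Fin k → ℝ := fun a => form S q a / σ
  have hb : ∑ a, b a ^ 2 = 1 := by
    simp only [b, div_pow, ← Finset.sum_div]
    rw [show ∑ a, form S q a ^ 2 = σ ^ 2 from hqg]
    exact div_self (pow_pos hσ 2).ne'
  refine inner_le_of_involution (T := comb S b) (hS.symm_comb b) (fun z => by
    rw [hS.comb_comb, hb, one_smul]) hx1 hq1 ?_
    (Real.sin_nonneg_of_nonneg_of_le_pi h0.le (by linarith [Real.pi_pos]))
    (sin_le_cos_of_le h0.le hτ.le) ?_
  · rw [inner_comb_self]
    exact Finset.sum_eq_zero fun a _ => by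
      rw [show form S x a = 0 from hx0 a, mul_zero]
  · rw [inner_comb_self, ← hσdef]
    have : ∑ a, b a * form S q a = (∑ a, form S q a ^ 2) / σ := by
      rw [Finset.sum_div]
      refine Finset.sum_congr rfl fun a _ => ?_
      simp only [b]
      ring
    rw [this, show ∑ a, form S q a ^ 2 = σ ^ 2 from hqg, sq, mul_div_assoc, div_self hσ.ne', mul_one]

/-- Here the involution T is built from x and fixes x, so 2⟨x, q⟩ = ⟨x, q + Tq⟩ ≤ |q + Tq|.
Cauchy-Schwarz on the forms gives ⟨Tq, q⟩ ≤ sin 2τ, and 2 + 2 sin 2τ = 4 cos²(π/4 - τ). -/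
theorem IsCliffordSystem.inner_le_of_focalMinus (hP : IsCliffordSystem P) {τ : ℝ} (h0 : 0 < τ)
    (hτ : τ < Real.pi / 4) {x q : 𝔼 n} (hx : x ∈ focalMinus P) (hq : q ∈ fkmLevel P (Real.cos (4 * τ))) :
    inner ℝ x q ≤ Real.cos (Real.pi / 4 - τ) := by
  have hS := hP.isCliffordFamily
  set S := fun a => matrixOp (P a) with hSdef
  obtain ⟨hx1, hxg⟩ := mem_focalMinus.1 hx
  obtain ⟨hq1, hqg⟩ := mem_fkmLevel.1 hq
  rw [half_one_sub_cos] at hqg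
  have hσ : 0 < Real.sin (2 * τ) := Real.sin_pos_of_pos_of_lt_pi (by linarith) (by linarith)
  change ∑ a, form S x a ^ 2 = 1 at hxg
  change ∑ a, form S q a ^ 2 = Real.sin (2 * τ) ^ 2 at hqg
  set T := comb S (form S x) with hT
  have hTx : T x = x := hS.comb_form_eq_self hx1 hxg
  have hTq : inner ℝ (T q) q ≤ Real.sin (2 * τ) := by
    rw [hT, inner_comb_self]
    have h1 := Finset.sum_mul_sq_le_sq_mul_sq Finset.univ (form S x) (form S q)
    rw [hxg, hqg, one_mul] at h1
    exact (abs_le_of_sq_le_sq' h1 hσ.le).2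
  have h1 : inner ℝ x (q + T q) = 2 * inner ℝ x q := by
    rw [inner_add_right, hT, ← hS.symm_comb, ← hT, hTx]
    ring
  have h2 : ‖q + T q‖ ^ 2 = 2 + 2 * inner ℝ (T q) q := by
    rw [norm_add_sq_real, real_inner_comm, hT, hS.norm_sq_comb, hxg, hq1]
    ring
  have hcos : 0 < Real.cos (Real.pi / 4 - τ) :=
    Real.cos_pos_of_mem_Ioo ⟨by linarith [Real.pi_pos], by linarith [Real.pi_pos]⟩
  have h3 : Real.sin (2 * τ) = 2 * Real.cos (Real.pi / 4 - τ) ^ 2 - 1 := by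
    rw [← Real.cos_two_mul, ← Real.cos_pi_div_two_sub]
    congr 1
    ring
  have h4 : inner ℝ x (q + T q) ≤ 2 * Real.cos (Real.pi / 4 - τ) := by
    refine (real_inner_le_norm _ _).trans ?_
    rw [hx1, one_mul]
    refine (abs_le_of_sq_le_sq' ?_ (by positivity)).2
    rw [h2, mul_pow]
    linarith
  linarith

end Distance

/-! ### The maps land in the prescribed leaves, and conclusion. -/

section Main

open IsCliffordFamily

variable {n k : ℕ} {P : Fin k → Matrix (Fin n) (Fin n) ℝ}

theorem focalNormalMap_eq (Q : Matrix (Fin n) (Fin n) ℝ) :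
    focalNormalMap Q = ⇑((1 / √2) • ContinuousLinearMap.id ℝ (𝔼 n) + (1 / √2 : ℝ) • matrixOp Q) := by
  funext x
  exact smul_add _ _ _

theorem normalMap_eq (Q : Matrix (Fin n) (Fin n) ℝ) (t : ℝ) :
    normalMap Q t = ⇑(Real.cos t • ContinuousLinearMap.id ℝ (𝔼 n) + Real.sin t • matrixOp Q) :=
  rfl

theorem one_div_sqrt_two_sq : (1 / √2 : ℝ) ^ 2 = 1 / 2 := by
  rw [div_pow, Real.sq_sqrt zero_le_two, one_pow]

theorem one_div_sqrt_two_sq_add : (1 / √2 : ℝ) ^ 2 + (1 / √2 : ℝ) ^ 2 = 1 := by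
  rw [one_div_sqrt_two_sq]
  norm_num

theorem matrixOp_eq_comb {Q : Matrix (Fin n) (Fin n) ℝ} {b : Fin k → ℝ} (hQ : Q = ∑ i, b i • P i) :
    matrixOp Q = comb (fun a => matrixOp (P a)) b := by
  ext1 x
  simp only [hQ, matrixOp_sum, matrixOp_smul, comb_apply]

theorem inner_normalMap_of_mem_focalPlus {Q : Matrix (Fin n) (Fin n) ℝ}
    (hQ : Q ∈ cliffordSphere P) (τ : ℝ) {x : 𝔼 n} (hx : x ∈ focalPlus P) :
    inner ℝ x (normalMap Q τ x) = Real.cos τ := by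
  obtain ⟨b, hb, hQ⟩ := hQ
  obtain ⟨hx1, hx0⟩ := mem_focalPlus.1 hx
  have h : inner ℝ x (matrixOp Q x) = 0 := by
    rw [real_inner_comm, matrixOp_eq_comb hQ, inner_comb_self]
    exact Finset.sum_eq_zero fun a _ => by rw [hx0, mul_zero]
  rw [normalMap, inner_add_right, real_inner_smul_right, real_inner_smul_right, ← matrixOp_apply, h,
    real_inner_self_eq_norm_sq, hx1]
  ring

namespace IsCliffordSystem

theorem focalNormalMap_mem_focalMinus (hP : IsCliffordSystem P) {Q : Matrix (Fin n) (Fin n) ℝ}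
    (hQ : Q ∈ cliffordSphere P) : MapsTo (focalNormalMap Q) (focalPlus P) (focalMinus P) := by
  obtain ⟨b, hb, hQ⟩ := hQ
  intro x hx
  obtain ⟨hx1, hx0⟩ := mem_focalPlus.1 hx
  have h := hP.isCliffordFamily.normal_plus hb hx1 hx0 one_div_sqrt_two_sq_add
  rw [mul_assoc, ← sq, one_div_sqrt_two_sq, ← matrixOp_eq_comb hQ, ← smul_add] at h
  exact mem_focalMinus.2 ⟨h.1, h.2.trans (by norm_num)⟩

theorem normalMap_mem_fkmLevel (hP : IsCliffordSystem P) {Q : Matrix (Fin n) (Fin n) ℝ}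
    (hQ : Q ∈ cliffordSphere P) (τ : ℝ) :
    MapsTo (normalMap Q τ) (focalPlus P) (fkmLevel P (Real.cos (4 * τ))) := by
  obtain ⟨b, hb, hQ⟩ := hQ
  intro x hx
  obtain ⟨hx1, hx0⟩ := mem_focalPlus.1 hx
  have h := hP.isCliffordFamily.normal_plus hb hx1 hx0 (Real.cos_sq_add_sin_sq τ)
  rw [← matrixOp_eq_comb hQ] at h
  refine mem_fkmLevel.2 ⟨h.1, h.2.trans ?_⟩
  rw [half_one_sub_cos, Real.sin_two_mul]
  ring

theorem sphericalDist_focalPlus (hP : IsCliffordSystem P) {Q : Matrix (Fin n) (Fin n) ℝ}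
    (hQ : Q ∈ cliffordSphere P) {τ : ℝ} (h0 : 0 < τ) (hτ : τ < Real.pi / 4)
    (hne : (focalPlus P).Nonempty) :
    sphericalDist (focalPlus P) (fkmLevel P (Real.cos (4 * τ))) = τ := by
  obtain ⟨x, hx⟩ := hne
  exact sphericalDist_eq (fun p hp => hp.1) (fun q hq => hq.1) h0.le (by linarith [Real.pi_pos])
    ⟨x, hx, _, hP.normalMap_mem_fkmLevel hQ τ hx, inner_normalMap_of_mem_focalPlus hQ τ hx⟩
    fun p hp q hq => hP.inner_le_of_focalPlus h0 hτ hp hq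

theorem mapsTo_normalMap_sphericalDist_focalPlus (hP : IsCliffordSystem P)
    {Q : Matrix (Fin n) (Fin n) ℝ} (hQ : Q ∈ cliffordSphere P) {c : ℝ} (hc : c ∈ Ioo (-1 : ℝ) 1) :
    MapsTo (normalMap Q (sphericalDist (focalPlus P) (fkmLevel P c))) (focalPlus P)
      (fkmLevel P c) := by
  obtain ⟨τ, h0, hτ, rfl⟩ := exists_angle hc
  -- The distance is evaluated only once a point of M_+ is available; for empty M_+ the claim is
  -- vacuous.
  intro x hx
  rw [hP.sphericalDist_focalPlus hQ h0 hτ ⟨x, hx⟩]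
  exact hP.normalMap_mem_fkmLevel hQ τ hx

section Extension

variable {R : Matrix (Fin n) (Fin n) ℝ}

theorem extension_spec
    (hR : IsCliffordSystem (Fin.snoc (α := fun _ => Matrix (Fin n) (Fin n) ℝ) P R)) :
    (∀ x y, inner ℝ (matrixOp R x) y = inner ℝ x (matrixOp R y)) ∧
      (∀ x, matrixOp R (matrixOp R x) = x) ∧
      ∀ a x, matrixOp R (matrixOp (P a) x) = -matrixOp (P a) (matrixOp R x) := by
  have h := hR.isCliffordFamily
  refine ⟨fun x y => ?_, fun x => ?_, fun a x => ?_⟩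
  · simpa only [Fin.snoc_last] using h.symm (Fin.last k) x y
  · simpa only [Fin.snoc_last] using h.invol (Fin.last k) x
  · simpa only [Fin.snoc_last, Fin.snoc_castSucc] using
      h.anti (Fin.last k) a.castSucc (Fin.castSucc_lt_last a).ne' x

theorem normal_extension (hP : IsCliffordSystem P)
    (hR : IsCliffordSystem (Fin.snoc (α := fun _ => Matrix (Fin n) (Fin n) ℝ) P R))
    {x : 𝔼 n} (hx : x ∈ focalMinus P) {C D : ℝ} (hCD : C ^ 2 + D ^ 2 = 1) :
    inner ℝ x (matrixOp R x) = 0 ∧ ‖C • x + D • matrixOp R x‖ = 1 ∧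
      ∑ a, form (fun a => matrixOp (P a)) (C • x + D • matrixOp R x) a ^ 2 = (C ^ 2 - D ^ 2) ^ 2 :=
  normal_minus (extension_spec hR).1 (extension_spec hR).2.1 hP.isCliffordFamily
    (extension_spec hR).2.2 (mem_focalMinus.1 hx).1 (mem_focalMinus.1 hx).2 hCD

theorem focalNormalMap_mem_focalPlus (hP : IsCliffordSystem P)
    (hR : IsCliffordSystem (Fin.snoc (α := fun _ => Matrix (Fin n) (Fin n) ℝ) P R)) :
    MapsTo (focalNormalMap R) (focalMinus P) (focalPlus P) := by
  intro x hx
  obtain ⟨-, h1, h2⟩ := hP.normal_extension hR hx one_div_sqrt_two_sq_add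
  rw [← smul_add] at h1 h2
  rw [sub_self, zero_pow two_ne_zero] at h2
  refine mem_focalPlus.2 ⟨h1, fun a => ?_⟩
  exact pow_eq_zero_iff two_ne_zero |>.1
    ((Finset.sum_eq_zero_iff_of_nonneg fun a _ => sq_nonneg _).1 h2 a (Finset.mem_univ a))

theorem normalMap_extension_mem_fkmLevel (hP : IsCliffordSystem P)
    (hR : IsCliffordSystem (Fin.snoc (α := fun _ => Matrix (Fin n) (Fin n) ℝ) P R)) (τ : ℝ) :
    MapsTo (normalMap R (Real.pi / 4 - τ)) (focalMinus P) (fkmLevel P (Real.cos (4 * τ))) := by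
  intro x hx
  obtain ⟨-, h1, h2⟩ := hP.normal_extension hR hx (Real.cos_sq_add_sin_sq (Real.pi / 4 - τ))
  refine mem_fkmLevel.2 ⟨h1, h2.trans ?_⟩
  rw [half_one_sub_cos, ← Real.cos_two_mul', ← Real.cos_pi_div_two_sub]
  congr 2
  ring

theorem sphericalDist_focalMinus (hP : IsCliffordSystem P)
    (hR : IsCliffordSystem (Fin.snoc (α := fun _ => Matrix (Fin n) (Fin n) ℝ) P R))
    {τ : ℝ} (h0 : 0 < τ) (hτ : τ < Real.pi / 4) (hne : (focalMinus P).Nonempty) :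
    sphericalDist (focalMinus P) (fkmLevel P (Real.cos (4 * τ))) = Real.pi / 4 - τ := by
  obtain ⟨x, hx⟩ := hne
  refine sphericalDist_eq (fun p hp => hp.1) (fun q hq => hq.1) (by linarith)
    (by linarith [Real.pi_pos]) ⟨x, hx, _, hP.normalMap_extension_mem_fkmLevel hR τ hx, ?_⟩
    fun p hp q hq => hP.inner_le_of_focalMinus h0 hτ hp hq
  -- Only x ⊥ Rx is needed here, so the angle 0 serves as an arbitrary choice of coefficients.
  rw [normalMap, inner_add_right, real_inner_smul_right, real_inner_smul_right, ← matrixOp_apply,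
    (hP.normal_extension hR hx (Real.cos_sq_add_sin_sq 0)).1, real_inner_self_eq_norm_sq, hx.1]
  ring

theorem mapsTo_normalMap_sphericalDist_focalMinus (hP : IsCliffordSystem P)
    (hR : IsCliffordSystem (Fin.snoc (α := fun _ => Matrix (Fin n) (Fin n) ℝ) P R))
    {c : ℝ} (hc : c ∈ Ioo (-1 : ℝ) 1) :
    MapsTo (normalMap R (sphericalDist (focalMinus P) (fkmLevel P c))) (focalMinus P)
      (fkmLevel P c) := by
  obtain ⟨τ, h0, hτ, rfl⟩ := exists_angle hc
  intro x hx
  rw [hP.sphericalDist_focalMinus hR h0 hτ ⟨x, hx⟩]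
  exact hP.normalMap_extension_mem_fkmLevel hR τ hx

end Extension

end IsCliffordSystem

end Main

theorem proposition4p1 (l m : ℕ) (hm : 0 < m) (hl : m + 1 < l)
    (P : Fin (m + 1) → Matrix (Fin (2 * l)) (Fin (2 * l)) ℝ) (hP : IsCliffordSystem P) :
    (∀ Q ∈ cliffordSphere P,
      IsHarmonicMap (2 * l - m - 2) (l + m - 1) (focalPlus P) (focalMinus P) (focalNormalMap Q) ∧
      ∀ c ∈ Set.Ioo (-1 : ℝ) 1,
        IsHarmonicMap (2 * l - m - 2) (2 * l - 2) (focalPlus P) (fkmLevel P c)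
          (normalMap Q (sphericalDist (focalPlus P) (fkmLevel P c)))) ∧
    (∀ R : Matrix (Fin (2 * l)) (Fin (2 * l)) ℝ,
      IsCliffordSystem (Fin.snoc (α := fun _ => Matrix (Fin (2 * l)) (Fin (2 * l)) ℝ) P R) →
      IsHarmonicMap (l + m - 1) (2 * l - m - 2) (focalMinus P) (focalPlus P) (focalNormalMap R) ∧
      ∀ c ∈ Set.Ioo (-1 : ℝ) 1,
        IsHarmonicMap (l + m - 1) (2 * l - 2) (focalMinus P) (fkmLevel P c)
          (normalMap R (sphericalDist (focalMinus P) (fkmLevel P c)))) := by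
  -- The codimension counts one equation for the sphere and one for each of the m + 1 forms.
  have hplus : 2 * l - m - 2 + (1 + (m + 1)) = 2 * l := by omega
  have hlevel : 2 * l - 2 + 2 = 2 * l := by omega
  have hminus : ((l + m - 1 : ℕ) : ℝ) = ((2 * l : ℕ) : ℝ) / 2 + ((m + 1 : ℕ) : ℝ) - 2 := by
    rw [Nat.cast_sub (by omega)]
    push_cast
    ring
  have hk : 2 ≤ m + 1 := by omega
  have hMp := isClosedSubmanifold_focalPlus hP hplus
  have hminp := hP.isMinimalInSphere_focalPlus hk hplus
  obtain ⟨hMm, hminm⟩ := hP.focalMinus_spec hk hminus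
  have hMc : ∀ c ∈ Ioo (-1 : ℝ) 1, IsClosedSubmanifold (2 * l - 2) (fkmLevel P c) := fun c hc =>
    isClosedSubmanifold_fkmLevel hP hc hlevel
  have hunit : ∀ c, ∀ y ∈ fkmLevel P c, ‖y‖ = 1 := fun c y hy => hy.1
  refine ⟨fun Q hQ => ⟨?_, fun c hc => ?_⟩, fun R hR => ⟨?_, fun c hc => ?_⟩⟩
  · have h := hP.focalNormalMap_mem_focalMinus hQ
    rw [focalNormalMap_eq] at h ⊢
    exact hminp.isHarmonicMap hMp hMm (hunit _) _ h
  · have h := hP.mapsTo_normalMap_sphericalDist_focalPlus hQ hc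
    rw [normalMap_eq] at h ⊢
    exact hminp.isHarmonicMap hMp (hMc c hc) (hunit _) _ h
  · have h := hP.focalNormalMap_mem_focalPlus hR
    rw [focalNormalMap_eq] at h ⊢
    exact hminm.isHarmonicMap hMm hMp (hunit _) _ h
  · have h := hP.mapsTo_normalMap_sphericalDist_focalMinus hR hc
    rw [normalMap_eq] at h ⊢
    exact hminm.isHarmonicMap hMm (hMc c hc) (hunit _) _ h
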